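/- **Conventions.** Arrows compose from right to left; $v^+$ (resp. $v^-$) is the set of arrows starting (resp. ending) at $v$, and "xor" means exactly one of the two. $\mathbb H$ has basis $1,\mathbf j,\mathbf k,\mathbf l$ with $\mathbf j\mathbf k=\mathbf l$, and is embedded in $M_2(\mathbb C)$ as the matrices $\begin{bmatrix}a&b\\-\bar b&\bar a\end{bmatrix}$ with $\mathbf j\leftrightarrow(a,b)=(\mathbf i,0)$, $\mathbf k\leftrightarrow(0,1)$, $\mathbf l\leftrightarrow(0,\mathbf i)$. Morita equivalence means $\mathbb R$-linear equivalence of module categories. **Modulated quivers.** A modulated quiver $(Q,\mathcal M)$ over $\mathbb R$ is a finite quiver $Q$ with $\mathcal M(v)\in\{\mathbb R,\mathbb C,\mathbb H\}$ for each vertex $v$ and, for each arrow $\alpha$, a simple $\mathcal M(t(\alpha))$-$\mathcal M(s(\alpha))$-bimodule $\mathcal M(\alpha)$ from the list ${}_{\mathbb R}\mathbb R_{\mathbb R}$, ${}_{\mathbb H}\mathbb H_{\mathbb H}$, ${}_{\mathbb R}\mathbb C_{\mathbb C}$, ${}_{\mathbb C}\mathbb C_{\mathbb R}$, ${}_{\mathbb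 R}\mathbb H_{\mathbb H}$, ${}_{\mathbb H}\mathbb H_{\mathbb R}$, ${}_{\mathbb H}(\mathbb C^2)_{\mathbb C}$ (columns), ${}_{\mathbb C}(\mathbb C^2)_{\mathbb H}$ (rows), ${}_{\mathbb C}\mathbb C_{\mathbb C}$, ${}_{\mathbb C}\overline{\mathbb C}_{\mathbb C}$ (where $x\cdot c=\bar c x$). $T(Q,\mathcal M)$ is the tensor algebra of the bimodule $\bigoplus_\alpha\mathcal M(\alpha)$ over $\prod_v\mathcal M(v)$, and $\mathcal M(\alpha\beta)=\mathcal M(\alpha)\otimes\mathcal M(\beta)$. Let $I$ be an ideal of $T(Q,\mathcal M)$ and $v$ a vertex. * $v$ is *ordinarily gentle with $\mathbb C$* if $\mathcal M(v)=\mathbb C$, $|v^\pm|\le2$; for $\alpha\in v^+$ and $\beta\ne\gamma$ in $v^-$, $I$ includes $\mathcal M(\alpha\beta)$ xor $\mathcal M(\alpha\gamma)$; for $\alpha\in v^-$ and $\beta\neq\gamma$ in $v^+$, $I$ includes $\mathcal M(\beta\alpha)$ xor $\mathcal M(\gamma\alpha)$; and for $\alpha\in v^+$, $\beta\in v^-$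 with $\mathcal M(t(\alpha))\ne\mathbb C\neq\mathcal M(s(\beta))$, $I\cap\mathcal M(\alpha\beta)$ is $\mathcal M(\alpha\beta)$ or $0$. * Suppose $\mathcal M(v)\neq\mathbb C$. Say that $v^+$ is *standard* if either it is a single arrow $\alpha:v\to w$ with $\mathcal M(w)\ne\mathcal M(v)$, or it is a pair of distinct parallel arrows $\alpha,\alpha^{\mathbf i}:v\to w$ with $\mathcal M(w)=\mathcal M(v)$; dually for $v^-$, with arrows $\beta$ (and $\beta^{\mathbf i}$) from $u$. Then $v$ is *specially gentle* if one of the following holds: (1) $v^+$ and $v^-$ are both standard (with $\alpha=\beta$, $\alpha^{\mathbf i}=\beta^{\mathbf i}$ if $w=v$) and $I$ includes $I_v^0$ xor $I_v^1$; (2) each of $v^+$, $v^-$ is empty or standard, and at least one of them is empty. Here $I_v^0$ and $I_v^1$ are the $\mathcal M(w)$-$\mathcal M(u)$-bimodules generated by the following elements, for each value of $\mathcal M(u)\,\mathcal M(v)\,\mathcal M(w)$ (with $x_\alpha$ the element $x$ of $\mathcal M(\alpha)$, and $v_1=(1,0)$, $v_2=(0,1)$ as rows or columns): | case | $I^0_v$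 | $I^1_v$ | |---|---|---| | $\mathbb{RRR}$ | $1_\alpha\otimes1_\beta-1_{\alpha^{\mathbf i}}\otimes1_{\beta^{\mathbf i}}$, $-1_\alpha\otimes1_{\beta^{\mathbf i}}-1_{\alpha^{\mathbf i}}\otimes1_\beta$ | $1_\alpha\otimes1_\beta+1_{\alpha^{\mathbf i}}\otimes1_{\beta^{\mathbf i}}$, $1_\alpha\otimes1_{\beta^{\mathbf i}}-1_{\alpha^{\mathbf i}}\otimes1_\beta$ | | $\mathbb{RRH}$ | $1_\alpha\otimes1_\beta+\mathbf j_\alpha\otimes1_{\beta^{\mathbf i}}$ | $1_\alpha\otimes1_\beta-\mathbf j_\alpha\otimes1_{\beta^{\mathbf i}}$ | | $\mathbb{RRC}$ | $1_\alpha\otimes1_\beta+\mathbf i_\alpha\otimes1_{\beta^{\mathbf i}}$ | $1_\alpha\otimes1_\beta-\mathbf i_\alpha\otimes1_{\beta^{\mathbf i}}$ | | $\mathbb{HHR}$ | $1_\alpha\otimes1_\beta+1_\alpha\otimes\mathbf j_{\beta^{\mathbf i}}$ | $1_\alpha\otimes\mathbf k_\beta-1_\alpha\otimes\mathbf l_{\beta^{\mathbf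 i}}$ | | $\mathbb{HHH}$ | $1_\alpha\otimes1_\beta-1_{\alpha^{\mathbf i}}\otimes1_{\beta^{\mathbf i}}+1_\alpha\otimes\mathbf j_{\beta^{\mathbf i}}+1_{\alpha^{\mathbf i}}\otimes\mathbf j_\beta$ | $1_\alpha\otimes\mathbf k_\beta+1_{\alpha^{\mathbf i}}\otimes\mathbf k_{\beta^{\mathbf i}}-1_\alpha\otimes\mathbf l_{\beta^{\mathbf i}}+1_{\alpha^{\mathbf i}}\otimes\mathbf l_\beta$ | | $\mathbb{HHC}$ | $(v_1)_\alpha\otimes1_\beta+(v_1)_\alpha\otimes\mathbf j_{\beta^{\mathbf i}}$ | $(v_1)_\alpha\otimes\mathbf k_\beta-(v_1)_\alpha\otimes\mathbf l_{\beta^{\mathbf i}}$ | | $\mathbb{HRR}$ | $1_\alpha\otimes1_\beta+1_{\alpha^{\mathbf i}}\otimes\mathbf j_\beta$ | $1_\alpha\otimes1_\beta-1_{\alpha^{\mathbf i}}\otimes\mathbf j_\beta$ | | $\mathbb{CRR}$ | $1_\alpha\otimes1_\beta+1_{\alpha^{\mathbf i}}\otimes\mathbf i_\beta$ | $1_\alpha\otimes1_\beta-1_{\alpha^{\mathbf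 i}}\otimes\mathbf i_\beta$ | | $\mathbb{RHH}$ | $1_\alpha\otimes1_\beta+1_{\alpha^{\mathbf i}}\otimes\mathbf j_\beta$ | $1_\alpha\otimes\mathbf k_\beta+1_{\alpha^{\mathbf i}}\otimes\mathbf l_\beta$ | | $\mathbb{CHH}$ | $1_\alpha\otimes(v_1)_\beta+\mathbf j_{\alpha^{\mathbf i}}\otimes(v_1)_\beta$ | $\mathbf k_\alpha\otimes(v_1)_\beta+\mathbf l_{\alpha^{\mathbf i}}\otimes(v_1)_\beta$ | | $\mathbb{HRH}$ | $1_\alpha\otimes1_\beta-\mathbf j_\alpha\otimes\mathbf j_\beta$ | $1_\alpha\otimes1_\beta+\mathbf j_\alpha\otimes\mathbf j_\beta$ | | $\mathbb{HRC}$ | $1_\alpha\otimes1_\beta-\mathbf i_\alpha\otimes\mathbf j_\beta$ | $1_\alpha\otimes1_\beta+\mathbf i_\alpha\otimes\mathbf j_\beta$ | | $\mathbb{CRH}$ | $1_\alpha\otimes1_\beta-\mathbf j_\alpha\otimes\mathbf i_\beta$ | $1_\alpha\otimes1_\beta+\mathbf j_\alpha\otimes\mathbf i_\beta$ | | $\mathbb{CRC}$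 | $1_\alpha\otimes1_\beta-\mathbf i_\alpha\otimes\mathbf i_\beta$ | $1_\alpha\otimes1_\beta+\mathbf i_\alpha\otimes\mathbf i_\beta$ | | $\mathbb{RHC}$ | $(v_1)_\alpha\otimes1_\beta$ | $(v_1)_\alpha\otimes\mathbf k_\beta$ | | $\mathbb{CHR}$ | $1_\alpha\otimes(v_1)_\beta$ | $-\mathbf k_\alpha\otimes(v_1)_\beta$ | | $\mathbb{CHC}$ | $(v_1)_\alpha\otimes(v_1)_\beta$ | $(v_1)_\alpha\otimes(v_2)_\beta$ | | $\mathbb{RHR}$ | $1_\alpha\otimes1_\beta$, $1_\alpha\otimes\mathbf j_\beta$ | $1_\alpha\otimes\mathbf k_\beta$, $1_\alpha\otimes\mathbf l_\beta$ | Put $I_v=\big(\bigoplus_{\alpha\in v^+,\beta\in v^-}\mathcal M(\alpha\beta)\big)\cap I$. An $\mathbb R$-algebra is *locally complexified-gentle of special type* if it is Morita equivalent to some $T(Q,\mathcal M)/I$ in which each vertex is ordinarily gentle with $\mathbb C$ or specially gentle, and $I$ is generated by the $I_v$. **Semilinear clannish algebras.** Let $Q$ be a finite quiver with twists $\sigma:Q_1\to\mathrm{Gal}(\mathbb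 C/\mathbb R)$, and let $\mathbb C_\sigma Q$ be the semilinear path algebra (generated by $\mathbb C$, the trivial paths and the arrows, with the usual path algebra relations, $e_ic=ce_i$, and $\alpha c=\sigma_\alpha(c)\alpha$ for $c\in\mathbb C$). Let $\mathbb S$ be a set of loops (special loops), at most one at each vertex, with $\sigma_s$ the conjugation for $s\in\mathbb S$, each associated with $x^2-1$ or $x^2+1$; this gives $Q_0=Q_{\mathbb R}\sqcup Q_{\mathbb H}\sqcup Q_{\mathbb C}$ (special loop with $x^2-1$, with $x^2+1$, no special loop). Let $S=\{s_i^2-e_i\mid i\in Q_{\mathbb R}\}\cup\{s_i^2+e_i\mid i\in Q_{\mathbb H}\}$, and let $Z$ be a set of paths of length at least two, none of which starts or ends with a special loop or contains the square of one. The algebra $\mathbb C_\sigma Q/\langle S\cup Z\rangle$ is *$\mathbb C$-semilinear clannish of gentle type* if (G1) $|v^+|\le2$ and $|v^-|\le2$ for all $v\in Q_0$ (special loops included); (G2) for each $\alpha\in Q_1\setminus\mathbb S$ there is at most one arrow $\beta$ (special or not) with $\alpha\beta$ a path not in $Z$, at most one arrow $\gamma$ with $\gamma\alpha$ a path not in $Z$,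 at most one arrow $\beta$ with $\alpha\beta$ a path in $Z$, and at most one arrow $\gamma$ with $\gamma\alpha$ a path in $Z$; (G3) all paths in $Z$ have length two. Let $(Q^{\mathrm b},\mathcal M)$ be the modulated quiver with $Q^{\mathrm b}_0=Q_0$ and $\mathcal M(i)=D$ for $i\in Q_D$; each $\alpha\in Q_1\setminus\mathbb S$ gives two parallel arrows $\alpha,\alpha^{\mathbf i}$ with the same ends if these are both in $Q_{\mathbb R}$ or both in $Q_{\mathbb H}$, and one arrow $\alpha$ otherwise; $\mathcal M(\alpha)$ is $\mathbb C$ or $\overline{\mathbb C}$, as $\sigma_\alpha=\mathrm{Id}$ or not, if both ends are in $Q_{\mathbb C}$, and the unique simple bimodule otherwise. Let $\epsilon=\sum_i\epsilon_i\in\mathbb C_\sigma Q/\langle S\rangle$ with $\epsilon_i=(e_i+s_i)/2$ for $i\in Q_{\mathbb R}$ and $\epsilon_i=e_i$ otherwise. **Proposition.** Every $\mathbb C$-semilinear clannish algebra of gentle type $\mathbb C_\sigma Q/\langle S\cup Z\rangle$ is locally complexified-gentle of special type. More precisely, there is an isomorphism of $\mathbb R$-algebras $\Phi:\epsilon(\mathbb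 C_\sigma Q/\langle S\rangle)\epsilon\to T(Q^{\mathrm b},\mathcal M)$, taking $\epsilon_i$ to $1\in\mathcal M(i)$ for each $i\in Q_0$, such that, with $I=\Phi(\epsilon\langle Z\rangle\epsilon)$, the algebra $\mathbb C_\sigma Q/\langle S\cup Z\rangle$ is Morita equivalent to $T(Q^{\mathrm b},\mathcal M)/I$, each vertex is ordinarily gentle with $\mathbb C$ or specially gentle in $T(Q^{\mathrm b},\mathcal M)/I$, and $I$ is generated by the $I_v$, $v\in Q_0$. -/

import Mathlib

namespace CGentle

universe u v

/-! ### Division rings over `ℝ` and their simple bimodules -/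

/-- The three finite-dimensional division rings over `ℝ`. -/
inductive DivKind : Type
  | R
  | C
  | H

/-- The division ring `ℝ`, `ℂ` or `ℍ`. The quaternion units `𝐣, 𝐤, 𝐥` (with `𝐣𝐤 = 𝐥`) are
Mathlib's units `i, j, k` of `Quaternion ℝ`. -/
def DivKind.carrier : DivKind → Type
  | .R => ℝ
  | .C => ℂ
  | .H => Quaternion ℝ

noncomputable instance (d : DivKind) : DivisionRing d.carrier :=
  match d with
  | .R => inferInstanceAs (DivisionRing ℝ)
  | .C => inferInstanceAs (DivisionRing ℂ)
  | .H => inferInstanceAs (DivisionRing (Quaternion ℝ))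

noncomputable instance (d : DivKind) : Algebra ℝ d.carrier :=
  match d with
  | .R => inferInstanceAs (Algebra ℝ ℝ)
  | .C => inferInstanceAs (Algebra ℝ ℂ)
  | .H => inferInstanceAs (Algebra ℝ (Quaternion ℝ))

/-- The standard embedding of `ℍ` in `M₂(ℂ)`: `q` goes to `[[a, b], [-b̄, ā]]`. -/
noncomputable def quatMatrix (q : Quaternion ℝ) : Matrix (Fin 2) (Fin 2) ℂ :=
  !![⟨q.re, q.imI⟩, ⟨q.imJ, q.imK⟩; ⟨-q.imJ, q.imK⟩, ⟨q.re, -q.imI⟩]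

/-- `quatMatrix` as a ring homomorphism. -/
noncomputable def quatHom : Quaternion ℝ →+* Matrix (Fin 2) (Fin 2) ℂ where
  toFun := quatMatrix
  map_one' := by
    ext i j
    fin_cases i <;> fin_cases j <;> apply Complex.ext <;> simp [quatMatrix] <;> rfl
  map_zero' := by
    ext i j
    fin_cases i <;> fin_cases j <;> apply Complex.ext <;> simp [quatMatrix] <;> rfl
  map_add' p q := by
    ext i j
    fin_cases i <;> fin_cases j <;> apply Complex.ext <;> simp [quatMatrix] <;> ring
  map_mul' p q := by
    ext i j
    fin_cases i <;> fin_cases j <;> apply Complex.ext <;>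
      simp [quatMatrix, Matrix.mul_apply, Fin.sum_univ_two] <;> ring

/-- The list of simple bimodules; `SimpleBimod x y` lists the simple `x`-`y`-bimodules
(left ring first). -/
inductive SimpleBimod : DivKind → DivKind → Type
  /-- `ℝ` as an `ℝ`-`ℝ`-bimodule -/
  | RR : SimpleBimod .R .R
  /-- `ℍ` as an `ℍ`-`ℍ`-bimodule -/
  | HH : SimpleBimod .H .H
  /-- `ℂ` as an `ℝ`-`ℂ`-bimodule -/
  | RC : SimpleBimod .R .C
  /-- `ℂ` as a `ℂ`-`ℝ`-bimodule -/
  | CR : SimpleBimod .C .R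
  /-- `ℍ` as an `ℝ`-`ℍ`-bimodule -/
  | RH : SimpleBimod .R .H
  /-- `ℍ` as an `ℍ`-`ℝ`-bimodule -/
  | HR : SimpleBimod .H .R
  /-- column vectors `ℂ²` as an `ℍ`-`ℂ`-bimodule -/
  | HC : SimpleBimod .H .C
  /-- row vectors `ℂ²` as a `ℂ`-`ℍ`-bimodule -/
  | CH : SimpleBimod .C .H
  /-- `ℂ` as a `ℂ`-`ℂ`-bimodule -/
  | CC : SimpleBimod .C .C
  /-- `ℂ` as a `ℂ`-`ℂ`-bimodule, the right action being twisted by conjugation -/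
  | CCbar : SimpleBimod .C .C

namespace SimpleBimod

variable {x y : DivKind}

/-- The underlying set of a simple bimodule. -/
def carrier : {x y : DivKind} → SimpleBimod x y → Type
  | _, _, .RR => ℝ
  | _, _, .HH => Quaternion ℝ
  | _, _, .RC => ℂ
  | _, _, .CR => ℂ
  | _, _, .RH => Quaternion ℝ
  | _, _, .HR => Quaternion ℝ
  | _, _, .HC => Fin 2 → ℂ
  | _, _, .CH => Fin 2 → ℂ
  | _, _, .CC => ℂ
  | _, _, .CCbar => ℂ

noncomputable instance (b : SimpleBimod x y) : AddCommGroup b.carrier :=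
  match b with
  | .RR => inferInstanceAs (AddCommGroup ℝ)
  | .HH => inferInstanceAs (AddCommGroup (Quaternion ℝ))
  | .RC => inferInstanceAs (AddCommGroup ℂ)
  | .CR => inferInstanceAs (AddCommGroup ℂ)
  | .RH => inferInstanceAs (AddCommGroup (Quaternion ℝ))
  | .HR => inferInstanceAs (AddCommGroup (Quaternion ℝ))
  | .HC => inferInstanceAs (AddCommGroup (Fin 2 → ℂ))
  | .CH => inferInstanceAs (AddCommGroup (Fin 2 → ℂ))
  | .CC => inferInstanceAs (AddCommGroup ℂ)
  | .CCbar => inferInstanceAs (AddCommGroup ℂ)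

/-- Column vectors as a left `ℍ`-module: matrices act by multiplication. -/
@[reducible] noncomputable def colModule : Module (Quaternion ℝ) (Fin 2 → ℂ) where
  smul q m := (quatHom q).mulVec m
  one_smul m := (congrArg (Matrix.mulVec · m) quatHom.map_one).trans (Matrix.one_mulVec m)
  mul_smul p q m := (congrArg (Matrix.mulVec · m) (quatHom.map_mul p q)).trans
    (Matrix.mulVec_mulVec m _ _).symm
  smul_zero _ := Matrix.mulVec_zero _
  smul_add _ _ _ := Matrix.mulVec_add _ _ _
  add_smul p q m := (congrArg (Matrix.mulVec · m) (quatHom.map_add p q)).trans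
    (Matrix.add_mulVec _ _ m)
  zero_smul m := (congrArg (Matrix.mulVec · m) quatHom.map_zero).trans (Matrix.zero_mulVec m)

/-- Row vectors as a right `ℍ`-module: matrices act by multiplication. -/
@[reducible] noncomputable def rowModule : Module (Quaternion ℝ)ᵐᵒᵖ (Fin 2 → ℂ) where
  smul q m := Matrix.vecMul m (quatHom q.unop)
  one_smul m := (congrArg (Matrix.vecMul m) quatHom.map_one).trans (Matrix.vecMul_one m)
  mul_smul p q m := (congrArg (Matrix.vecMul m) (quatHom.map_mul q.unop p.unop)).trans
    (Matrix.vecMul_vecMul m _ _).symm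
  smul_zero _ := Matrix.zero_vecMul _
  smul_add _ _ _ := Matrix.add_vecMul _ _ _
  add_smul p q m := (congrArg (Matrix.vecMul m) (quatHom.map_add p.unop q.unop)).trans
    (Matrix.vecMul_add _ _ m)
  zero_smul m := (congrArg (Matrix.vecMul m) quatHom.map_zero).trans (Matrix.vecMul_zero m)

/-- The left module structure. -/
noncomputable instance leftModule (b : SimpleBimod x y) : Module x.carrier b.carrier :=
  match b with
  | .RR => inferInstanceAs (Module ℝ ℝ)
  | .HH => inferInstanceAs (Module (Quaternion ℝ) (Quaternion ℝ))
  | .RC => inferInstanceAs (Module ℝ ℂ)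
  | .CR => inferInstanceAs (Module ℂ ℂ)
  | .RH => inferInstanceAs (Module ℝ (Quaternion ℝ))
  | .HR => inferInstanceAs (Module (Quaternion ℝ) (Quaternion ℝ))
  | .HC => colModule
  | .CH => inferInstanceAs (Module ℂ (Fin 2 → ℂ))
  | .CC => inferInstanceAs (Module ℂ ℂ)
  | .CCbar => inferInstanceAs (Module ℂ ℂ)

/-- The right module structure, a module over the opposite ring. -/
noncomputable instance rightModule (b : SimpleBimod x y) : Module y.carrierᵐᵒᵖ b.carrier :=
  match b with
  | .RR => inferInstanceAs (Module ℝᵐᵒᵖ ℝ)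
  | .HH => inferInstanceAs (Module (Quaternion ℝ)ᵐᵒᵖ (Quaternion ℝ))
  | .RC => inferInstanceAs (Module ℂᵐᵒᵖ ℂ)
  | .CR => Module.compHom ℂ (RingHom.op (algebraMap ℝ ℂ))
  | .RH => inferInstanceAs (Module (Quaternion ℝ)ᵐᵒᵖ (Quaternion ℝ))
  | .HR => Module.compHom (Quaternion ℝ) (RingHom.op (algebraMap ℝ (Quaternion ℝ)))
  | .HC => inferInstanceAs (Module ℂᵐᵒᵖ (Fin 2 → ℂ))
  | .CH => rowModule
  | .CC => inferInstanceAs (Module ℂᵐᵒᵖ ℂ)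
  | .CCbar => Module.compHom ℂ (RingHom.op (starRingEnd ℂ))

/-- The two actions commute. -/
instance (b : SimpleBimod x y) : SMulCommClass x.carrier y.carrierᵐᵒᵖ b.carrier :=
  match b with
  | .RR => inferInstanceAs (SMulCommClass ℝ ℝᵐᵒᵖ ℝ)
  | .HH => inferInstanceAs (SMulCommClass (Quaternion ℝ) (Quaternion ℝ)ᵐᵒᵖ (Quaternion ℝ))
  | .RC => inferInstanceAs (SMulCommClass ℝ ℂᵐᵒᵖ ℂ)
  | .CR => ⟨fun (a : ℂ) (c : ℝᵐᵒᵖ) (m : ℂ) =>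
      show a * (m * (c.unop : ℂ)) = a * m * (c.unop : ℂ) from (mul_assoc _ _ _).symm⟩
  | .RH => inferInstanceAs (SMulCommClass ℝ (Quaternion ℝ)ᵐᵒᵖ (Quaternion ℝ))
  | .HR => ⟨fun (a : Quaternion ℝ) c (m : Quaternion ℝ) =>
      show a * (m * algebraMap ℝ (Quaternion ℝ) c.unop) = a * m * algebraMap ℝ (Quaternion ℝ) c.unop
        from (mul_assoc _ _ _).symm⟩
  | .HC => ⟨fun (a : Quaternion ℝ) (c : ℂᵐᵒᵖ) (m : Fin 2 → ℂ) =>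
      show (quatHom a).mulVec (c • m) = c • (quatHom a).mulVec m from Matrix.mulVec_smul _ _ _⟩
  | .CH => ⟨fun (a : ℂ) c (m : Fin 2 → ℂ) =>
      show a • Matrix.vecMul m (quatHom c.unop) = Matrix.vecMul (a • m) (quatHom c.unop) from
        (Matrix.smul_vecMul _ _ _).symm⟩
  | .CC => inferInstanceAs (SMulCommClass ℂ ℂᵐᵒᵖ ℂ)
  | .CCbar => ⟨fun (a : ℂ) c (m : ℂ) =>
      show a * (m * (starRingEnd ℂ) c.unop) = a * m * (starRingEnd ℂ) c.unop from
        (mul_assoc _ _ _).symm⟩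

/-- Symbols for the elements of simple bimodules that occur in the standard relations:
`1`, the complex unit `𝐢`, the quaternion units `𝐣, 𝐤, 𝐥`, and the vectors `(1, 0)` and `(0, 1)`
(columns or rows). -/
inductive Sym : Type
  | one
  | i
  | j
  | k
  | l
  | v₁
  | v₂

/-- The complex number named by a symbol (`0` if the symbol names no complex number). -/
noncomputable def Sym.toComplex : Sym → ℂ
  | .one => 1
  | .i => Complex.I
  | _ => 0

/-- The quaternion named by a symbol (`0` if the symbol names no quaternion). -/
def Sym.toQuaternion : Sym → Quaternion ℝ
  | .one => ⟨1, 0, 0, 0⟩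
  | .j => ⟨0, 1, 0, 0⟩
  | .k => ⟨0, 0, 1, 0⟩
  | .l => ⟨0, 0, 0, 1⟩
  | _ => ⟨0, 0, 0, 0⟩

/-- The vector named by a symbol (`0` if the symbol names no vector). -/
def Sym.toVec : Sym → Fin 2 → ℂ
  | .v₁ => ![1, 0]
  | .v₂ => ![0, 1]
  | _ => 0

/-- The element of a simple bimodule named by a symbol. The symbols are only used on bimodules in
which they name an element. -/
noncomputable def elt : {x y : DivKind} → (b : SimpleBimod x y) → Sym → b.carrier
  | _, _, .RR => fun c => (match c with | .one => 1 | _ => 0 : ℝ)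
  | _, _, .HH => Sym.toQuaternion
  | _, _, .RC => Sym.toComplex
  | _, _, .CR => Sym.toComplex
  | _, _, .RH => Sym.toQuaternion
  | _, _, .HR => Sym.toQuaternion
  | _, _, .HC => Sym.toVec
  | _, _, .CH => Sym.toVec
  | _, _, .CC => Sym.toComplex
  | _, _, .CCbar => Sym.toComplex

/-- The simple `x`-`y`-bimodule; for `x = y = ℂ`, where there are two, the twisted one if
`twisted` holds and the regular one otherwise. -/
def std : (x y : DivKind) → (twisted : Bool) → SimpleBimod x y
  | .R, .R, _ => .RR
  | .H, .H, _ => .HH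
  | .R, .C, _ => .RC
  | .C, .R, _ => .CR
  | .R, .H, _ => .RH
  | .H, .R, _ => .HR
  | .H, .C, _ => .HC
  | .C, .H, _ => .CH
  | .C, .C, false => .CC
  | .C, .C, true => .CCbar

end SimpleBimod

/-! ### The tensor algebra of a bimodule -/

section TensorAlgebra

variable (A : Type u) (M : Type v) [Ring A] [Algebra ℝ A] [AddCommGroup M] [Module A M]
  [Module Aᵐᵒᵖ M] [SMulCommClass A Aᵐᵒᵖ M]

/-- The defining relations of the tensor algebra `T(A, M) = A ⊕ M ⊕ (M ⊗_A M) ⊕ ⋯` of an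
`A`-`A`-bimodule `M` on the generators `A` and `M`: the map from `A` is a homomorphism of
`ℝ`-algebras, and the map from `M` is a homomorphism of `A`-`A`-bimodules. -/
inductive TensorRel : FreeAlgebra ℝ (A ⊕ M) → FreeAlgebra ℝ (A ⊕ M) → Prop
  | add (a b : A) : TensorRel (FreeAlgebra.ι ℝ (.inl (a + b)))
      (FreeAlgebra.ι ℝ (.inl a) + FreeAlgebra.ι ℝ (.inl b))
  | mul (a b : A) : TensorRel (FreeAlgebra.ι ℝ (.inl (a * b)))
      (FreeAlgebra.ι ℝ (.inl a) * FreeAlgebra.ι ℝ (.inl b))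
  | algebraMap (r : ℝ) : TensorRel (FreeAlgebra.ι ℝ (.inl (algebraMap ℝ A r)))
      (algebraMap ℝ (FreeAlgebra ℝ (A ⊕ M)) r)
  | add' (m n : M) : TensorRel (FreeAlgebra.ι ℝ (.inr (m + n)))
      (FreeAlgebra.ι ℝ (.inr m) + FreeAlgebra.ι ℝ (.inr n))
  | left (a : A) (m : M) : TensorRel (FreeAlgebra.ι ℝ (.inr (a • m)))
      (FreeAlgebra.ι ℝ (.inl a) * FreeAlgebra.ι ℝ (.inr m))
  | right (a : A) (m : M) : TensorRel (FreeAlgebra.ι ℝ (.inr (MulOpposite.op a • m)))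
      (FreeAlgebra.ι ℝ (.inr m) * FreeAlgebra.ι ℝ (.inl a))

/-- The tensor algebra of the `A`-`A`-bimodule `M`, as an `ℝ`-algebra: the universal
`ℝ`-algebra with an algebra homomorphism from `A` and a bimodule homomorphism from `M`. -/
abbrev BimodTensorAlgebra : Type (max u v) := RingQuot (TensorRel A M)

variable {A M}

/-- The degree zero part `A → T(A, M)`. -/
noncomputable def BimodTensorAlgebra.ι₀ (a : A) : BimodTensorAlgebra A M :=
  RingQuot.mkAlgHom ℝ (TensorRel A M) (FreeAlgebra.ι ℝ (.inl a))

/-- The degree one part `M → T(A, M)`. -/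
noncomputable def BimodTensorAlgebra.ι₁ (m : M) : BimodTensorAlgebra A M :=
  RingQuot.mkAlgHom ℝ (TensorRel A M) (FreeAlgebra.ι ℝ (.inr m))

end TensorAlgebra

/-! ### Modulated quivers -/

/-- A finite quiver. -/
structure FinQuiver where
  /-- vertices -/
  V : Type u
  /-- arrows -/
  E : Type u
  [fintypeV : Fintype V]
  [fintypeE : Fintype E]
  /-- start of an arrow -/
  s : E → V
  /-- end of an arrow -/
  t : E → V

attribute [instance] FinQuiver.fintypeV FinQuiver.fintypeE

namespace FinQuiver

variable (Q : FinQuiver.{u})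

/-- The arrows `v⁺` that start at `v`. -/
def outArrows (v : Q.V) : Set Q.E := {α | Q.s α = v}

/-- The arrows `v⁻` that end at `v`. -/
def inArrows (v : Q.V) : Set Q.E := {α | Q.t α = v}

end FinQuiver

/-- A modulated quiver over `ℝ`. -/
structure ModulatedQuiver extends FinQuiver.{u} where
  /-- the division ring at a vertex -/
  vert : V → DivKind
  /-- the bimodule at an arrow -/
  arr : (α : E) → SimpleBimod (vert (t α)) (vert (s α))

namespace ModulatedQuiver

variable (M : ModulatedQuiver.{u})

/-- The ring `∏ᵢ M(i)`. -/
abbrev VertexRing : Type u := (i : M.V) → (M.vert i).carrier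

/-- The bimodule `⨁_α M(α)`. -/
def ArrowBimod : Type u := (α : M.E) → (M.arr α).carrier

noncomputable instance : AddCommGroup M.ArrowBimod :=
  inferInstanceAs (AddCommGroup ((α : M.E) → (M.arr α).carrier))

noncomputable instance : Module M.VertexRing M.ArrowBimod where
  smul a m := fun α => a (M.t α) • m α
  one_smul _ := funext fun _ => one_smul _ _
  mul_smul _ _ _ := funext fun _ => mul_smul _ _ _
  smul_zero _ := funext fun _ => smul_zero _
  smul_add _ _ _ := funext fun _ => smul_add _ _ _
  add_smul _ _ _ := funext fun _ => add_smul _ _ _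
  zero_smul _ := funext fun _ => zero_smul _ _

noncomputable instance : Module M.VertexRingᵐᵒᵖ M.ArrowBimod where
  smul a m := fun α => MulOpposite.op (a.unop (M.s α)) • m α
  one_smul _ := funext fun _ => one_smul _ _
  mul_smul _ _ _ := funext fun _ => mul_smul (MulOpposite.op _) (MulOpposite.op _) _
  smul_zero _ := funext fun _ => smul_zero _
  smul_add _ _ _ := funext fun _ => smul_add _ _ _
  add_smul _ _ _ := funext fun _ => add_smul (MulOpposite.op _) (MulOpposite.op _) _
  zero_smul _ := funext fun _ => zero_smul _ _

instance : SMulCommClass M.VertexRing M.VertexRingᵐᵒᵖ M.ArrowBimod where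
  smul_comm _ _ _ := funext fun _ => smul_comm _ (MulOpposite.op _) _

/-- The tensor algebra `T(Q, M)`. -/
abbrev T : Type u := BimodTensorAlgebra M.VertexRing M.ArrowBimod

open Classical in
/-- The element `a` of `M(i)`, in `T(Q, M)`. -/
noncomputable def ofVert (i : M.V) (a : (M.vert i).carrier) : M.T :=
  BimodTensorAlgebra.ι₀ (Pi.single i a)

open Classical in
/-- The inclusion of `M(α)` in `⨁_α M(α)`. -/
noncomputable def single (α : M.E) (m : (M.arr α).carrier) : M.ArrowBimod :=
  Pi.single (M := fun α => (M.arr α).carrier) α m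

/-- The element `m` of `M(α)`, in `T(Q, M)`. -/
noncomputable def ofArr (α : M.E) (m : (M.arr α).carrier) : M.T :=
  BimodTensorAlgebra.ι₁ (A := M.VertexRing) (M.single α m)

/-- For a path `αβ` (first `β`, then `α`), the subspace `M(αβ) = M(α) ⊗ M(β)` of `T(Q, M)`. -/
def pathSpace (α β : M.E) : Submodule ℝ M.T :=
  Submodule.span ℝ {x | ∃ m n, x = M.ofArr α m * M.ofArr β n}

/-- The quotient `T(Q, M)/I`. -/
abbrev Quot (I : TwoSidedIdeal M.T) : Type u := I.ringCon.Quotient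

/-- `I` includes the subspace `W`. -/
def Includes (I : TwoSidedIdeal M.T) (W : Submodule ℝ M.T) : Prop := ∀ x ∈ W, x ∈ I

/-- The vertex `v` is ordinarily gentle with `ℂ` in `T(Q, M)/I`. -/
def OrdinarilyGentleC (I : TwoSidedIdeal M.T) (v : M.V) : Prop :=
  M.vert v = .C ∧
  ((M.outArrows v).ncard ≤ 2 ∧ (M.inArrows v).ncard ≤ 2) ∧
  ((∀ α ∈ M.outArrows v, ∀ β ∈ M.inArrows v, ∀ γ ∈ M.inArrows v, β ≠ γ →
      Xor (M.Includes I (M.pathSpace α β)) (M.Includes I (M.pathSpace α γ))) ∧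
    (∀ α ∈ M.inArrows v, ∀ β ∈ M.outArrows v, ∀ γ ∈ M.outArrows v, β ≠ γ →
      Xor (M.Includes I (M.pathSpace β α)) (M.Includes I (M.pathSpace γ α)))) ∧
  (∀ α ∈ M.outArrows v, ∀ β ∈ M.inArrows v, M.vert (M.t α) ≠ .C → M.vert (M.s β) ≠ .C →
    M.Includes I (M.pathSpace α β) ∨ ∀ x ∈ M.pathSpace α β, x ∈ I → x = 0)

/-- `v⁺` consists of the arrows `α, α'`: two parallel arrows if `M(v) = M(t(α))`, and one arrow
`α = α'` otherwise. -/
def OutPair (v : M.V) (α α' : M.E) : Prop :=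
  M.outArrows v = {α, α'} ∧ M.t α' = M.t α ∧ (α ≠ α' ↔ M.vert (M.t α) = M.vert v)

/-- `v⁻` consists of the arrows `β, β'`: two parallel arrows if `M(v) = M(s(β))`, and one arrow
`β = β'` otherwise. -/
def InPair (v : M.V) (β β' : M.E) : Prop :=
  M.inArrows v = {β, β'} ∧ M.s β' = M.s β ∧ (β ≠ β' ↔ M.vert (M.s β) = M.vert v)

/-- `a_α ⊗ b_β`. -/
noncomputable def ten (α : M.E) (a : SimpleBimod.Sym) (β : M.E) (b : SimpleBimod.Sym) : M.T :=
  M.ofArr α ((M.arr α).elt a) * M.ofArr β ((M.arr β).elt b)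

open SimpleBimod.Sym in
/-- The standard relations at a vertex `v` with `M(v) ≠ ℂ`, for paths `u → v → w` along
`β` (and its parallel arrow `β'`, if `M(u) = M(v)`) and `α` (and its parallel arrow `α'`, if
`M(v) = M(w)`). The division rings `M(u), M(v), M(w)` are listed in this order; the two components
are the generators of the first and of the second standard subbimodule. -/
noncomputable def relations (α α' β β' : M.E) : (u v w : DivKind) → Set M.T × Set M.T
  | .R, .R, .R =>
    ({M.ten α one β one - M.ten α' one β' one, - M.ten α one β' one - M.ten α' one β one},
     {M.ten α one β one + M.ten α' one β' one, M.ten α one β' one - M.ten α' one β one})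
  | .R, .R, .H =>
    ({M.ten α one β one + M.ten α j β' one}, {M.ten α one β one - M.ten α j β' one})
  | .R, .R, .C =>
    ({M.ten α one β one + M.ten α i β' one}, {M.ten α one β one - M.ten α i β' one})
  | .H, .H, .R =>
    ({M.ten α one β one + M.ten α one β' j}, {M.ten α one β k - M.ten α one β' l})
  | .H, .H, .H =>
    ({M.ten α one β one - M.ten α' one β' one + M.ten α one β' j + M.ten α' one β j},
     {M.ten α one β k + M.ten α' one β' k - M.ten α one β' l + M.ten α' one β l})
  | .H, .H, .C =>
    ({M.ten α v₁ β one + M.ten α v₁ β' j}, {M.ten α v₁ β k - M.ten α v₁ β' l})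
  | .H, .R, .R =>
    ({M.ten α one β one + M.ten α' one β j}, {M.ten α one β one - M.ten α' one β j})
  | .C, .R, .R =>
    ({M.ten α one β one + M.ten α' one β i}, {M.ten α one β one - M.ten α' one β i})
  | .R, .H, .H =>
    ({M.ten α one β one + M.ten α' one β j}, {M.ten α one β k + M.ten α' one β l})
  | .C, .H, .H =>
    ({M.ten α one β v₁ + M.ten α' j β v₁}, {M.ten α k β v₁ + M.ten α' l β v₁})
  | .H, .R, .H =>
    ({M.ten α one β one - M.ten α j β j}, {M.ten α one β one + M.ten α j β j})
  | .H, .R, .C =>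
    ({M.ten α one β one - M.ten α i β j}, {M.ten α one β one + M.ten α i β j})
  | .C, .R, .H =>
    ({M.ten α one β one - M.ten α j β i}, {M.ten α one β one + M.ten α j β i})
  | .C, .R, .C =>
    ({M.ten α one β one - M.ten α i β i}, {M.ten α one β one + M.ten α i β i})
  | .R, .H, .C =>
    ({M.ten α v₁ β one}, {M.ten α v₁ β k})
  | .C, .H, .R =>
    ({M.ten α one β v₁}, {- M.ten α k β v₁})
  | .C, .H, .C =>
    ({M.ten α v₁ β v₁}, {M.ten α v₁ β v₂})
  | .R, .H, .R =>
    ({M.ten α one β one, M.ten α one β j}, {M.ten α one β k, M.ten α one β l})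
  | _, .C, _ => (∅, ∅)

/-- The `M(w)`-`M(u)`-bimodule generated by a subset of `T(Q, M)`. -/
def bimodSpan (w u : M.V) (X : Set M.T) : Submodule ℝ M.T :=
  Submodule.span ℝ {y | ∃ a b, ∃ x ∈ X, y = M.ofVert w a * x * M.ofVert u b}

/-- The vertex `v` is specially gentle in `T(Q, M)/I`. Its modulation is `ℝ` or `ℍ`, and
either `v⁺` and `v⁻` are both non-empty, form one of the 18 standard configurations, and `I`
includes exactly one of the two standard subbimodules; or `v` is a source or a sink, and the
arrows at `v` form one half of such a configuration, or there are none. -/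
def SpeciallyGentle (I : TwoSidedIdeal M.T) (v : M.V) : Prop :=
  M.vert v ≠ .C ∧
  ((∃ α α' β β' : M.E, M.OutPair v α α' ∧ M.InPair v β β' ∧
      (M.t α = v → β = α ∧ β' = α') ∧
      Xor
        (M.Includes I (M.bimodSpan (M.t α) (M.s β)
          (M.relations α α' β β' (M.vert (M.s β)) (M.vert v) (M.vert (M.t α))).1))
        (M.Includes I (M.bimodSpan (M.t α) (M.s β)
          (M.relations α α' β β' (M.vert (M.s β)) (M.vert v) (M.vert (M.t α))).2))) ∨
    (M.outArrows v = ∅ ∧ M.inArrows v = ∅) ∨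
    (M.inArrows v = ∅ ∧ ∃ α α', M.OutPair v α α') ∨
    (M.outArrows v = ∅ ∧ ∃ β β', M.InPair v β β'))

/-- `I_v = (⨁_{α ∈ v⁺, β ∈ v⁻} M(αβ)) ∩ I`. -/
def localIdeal (I : TwoSidedIdeal M.T) (v : M.V) : Set M.T :=
  {x | x ∈ (⨆ α ∈ M.outArrows v, ⨆ β ∈ M.inArrows v, M.pathSpace α β) ∧ x ∈ I}

/-- Each vertex is ordinarily gentle with `ℂ` or specially gentle in `T(Q, M)/I`, and `I` is
generated by the `I_v`. -/
def SpecialCondition (I : TwoSidedIdeal M.T) : Prop :=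
  (∀ v, M.OrdinarilyGentleC I v ∨ M.SpeciallyGentle I v) ∧
  I = TwoSidedIdeal.span (⋃ v, M.localIdeal I v)

end ModulatedQuiver

/-- An `ℝ`-algebra is locally complexified-gentle of special type if it is Morita equivalent to
some `T(Q, M)/I` with each vertex ordinarily gentle with `ℂ` or specially gentle, and `I`
generated by the `I_v`. -/
def IsLocallyComplexifiedGentleOfSpecialType (A : Type u) [Ring A] [Algebra ℝ A] : Prop :=
  ∃ (M : ModulatedQuiver.{u}) (I : TwoSidedIdeal M.T),
    M.SpecialCondition I ∧ IsMoritaEquivalent ℝ A (M.Quot I)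

/-! ### Semilinear clannish algebras -/

/-- Generators of the semilinear path algebra: scalars, trivial paths and arrows. -/
inductive PathGen (Q : FinQuiver.{u}) : Type u
  | scalar (c : ℂ)
  | triv (i : Q.V)
  | arrow (α : Q.E)

open PathGen in
/-- The defining relations of the semilinear path algebra `ℂ_σ Q`. -/
inductive PathRel (Q : FinQuiver.{u}) (σ : Q.E → (ℂ ≃ₐ[ℝ] ℂ)) :
    FreeAlgebra ℝ (PathGen Q) → FreeAlgebra ℝ (PathGen Q) → Prop
  | scalar_add (a b : ℂ) : PathRel Q σ (FreeAlgebra.ι ℝ (scalar (a + b)))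
      (FreeAlgebra.ι ℝ (scalar a) + FreeAlgebra.ι ℝ (scalar b))
  | scalar_mul (a b : ℂ) : PathRel Q σ (FreeAlgebra.ι ℝ (scalar (a * b)))
      (FreeAlgebra.ι ℝ (scalar a) * FreeAlgebra.ι ℝ (scalar b))
  | scalar_real (r : ℝ) : PathRel Q σ (FreeAlgebra.ι ℝ (scalar (r : ℂ)))
      (algebraMap ℝ (FreeAlgebra ℝ (PathGen Q)) r)
  | triv_self (i : Q.V) : PathRel Q σ
      (FreeAlgebra.ι ℝ (triv i) * FreeAlgebra.ι ℝ (triv i)) (FreeAlgebra.ι ℝ (triv i))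
  | triv_ne (i j : Q.V) : i ≠ j → PathRel Q σ
      (FreeAlgebra.ι ℝ (triv i) * FreeAlgebra.ι ℝ (triv j)) 0
  | triv_sum : PathRel Q σ (∑ i, FreeAlgebra.ι ℝ (triv i)) 1
  | arrow_left (α : Q.E) : PathRel Q σ
      (FreeAlgebra.ι ℝ (triv (Q.t α)) * FreeAlgebra.ι ℝ (arrow α)) (FreeAlgebra.ι ℝ (arrow α))
  | arrow_right (α : Q.E) : PathRel Q σ
      (FreeAlgebra.ι ℝ (arrow α) * FreeAlgebra.ι ℝ (triv (Q.s α))) (FreeAlgebra.ι ℝ (arrow α))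
  | triv_scalar (i : Q.V) (c : ℂ) : PathRel Q σ
      (FreeAlgebra.ι ℝ (triv i) * FreeAlgebra.ι ℝ (scalar c))
      (FreeAlgebra.ι ℝ (scalar c) * FreeAlgebra.ι ℝ (triv i))
  | arrow_scalar (α : Q.E) (c : ℂ) : PathRel Q σ
      (FreeAlgebra.ι ℝ (arrow α) * FreeAlgebra.ι ℝ (scalar c))
      (FreeAlgebra.ι ℝ (scalar (σ α c)) * FreeAlgebra.ι ℝ (arrow α))

/-- The data `(Q, σ, 𝕊, Z)` from which an algebra `ℂ_σ Q/⟨S ∪ Z⟩` is formed. -/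
structure ClannishDatum where
  /-- the quiver -/
  Q : FinQuiver.{u}
  /-- the twists on the arrows -/
  σ : Q.E → (ℂ ≃ₐ[ℝ] ℂ)
  /-- the special loops with polynomial `x² - 1` -/
  SR : Set Q.E
  /-- the special loops with polynomial `x² + 1` -/
  SH : Set Q.E
  disjoint : Disjoint SR SH
  isLoop : ∀ l ∈ SR ∪ SH, Q.s l = Q.t l
  twist : ∀ l ∈ SR ∪ SH, σ l = Complex.conjAe
  unique : ∀ l ∈ SR ∪ SH, ∀ l' ∈ SR ∪ SH, Q.s l = Q.s l' → l = l'
  /-- the zero relations: `α₁α₂⋯αₙ` (last arrow first) is the list `[α₁, α₂, …, αₙ]` -/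
  Z : Set (List Q.E)
  isPath : ∀ p ∈ Z, p.IsChain (fun α β => Q.s α = Q.t β)
  two_le : ∀ p ∈ Z, 2 ≤ p.length
  head_ordinary : ∀ p ∈ Z, ∀ l ∈ p.head?, l ∉ SR ∪ SH
  last_ordinary : ∀ p ∈ Z, ∀ l ∈ p.getLast?, l ∉ SR ∪ SH
  no_square : ∀ p ∈ Z, ∀ l ∈ SR ∪ SH, ¬ [l, l] <:+: p

namespace ClannishDatum

variable (D : ClannishDatum.{u})

/-- The set `𝕊` of special loops. -/
def special : Set D.Q.E := D.SR ∪ D.SH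

/-- `ℂ_σ Q/⟨S ∪ Z⟩` is of gentle type. -/
def IsGentleType : Prop :=
  (∀ v, (D.Q.outArrows v).ncard ≤ 2 ∧ (D.Q.inArrows v).ncard ≤ 2) ∧
  (∀ α, α ∉ D.special →
    ({β | D.Q.s α = D.Q.t β ∧ [α, β] ∉ D.Z}.Subsingleton ∧
      {γ | D.Q.s γ = D.Q.t α ∧ [γ, α] ∉ D.Z}.Subsingleton) ∧
    ({β | D.Q.s α = D.Q.t β ∧ [α, β] ∈ D.Z}.Subsingleton ∧
      {γ | D.Q.s γ = D.Q.t α ∧ [γ, α] ∈ D.Z}.Subsingleton)) ∧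
  (∀ p ∈ D.Z, p.length = 2)

/-- The semilinear path algebra `ℂ_σ Q`. -/
abbrev PathAlg : Type u := RingQuot (PathRel D.Q D.σ)

/-- The trivial path `e_i` in `ℂ_σ Q`. -/
noncomputable def e (i : D.Q.V) : D.PathAlg :=
  RingQuot.mkAlgHom ℝ (PathRel D.Q D.σ) (FreeAlgebra.ι ℝ (.triv i))

/-- The arrow `α` in `ℂ_σ Q`. -/
noncomputable def a (α : D.Q.E) : D.PathAlg :=
  RingQuot.mkAlgHom ℝ (PathRel D.Q D.σ) (FreeAlgebra.ι ℝ (.arrow α))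

/-- The relations `S` for the special loops. -/
def S : Set D.PathAlg :=
  {x | (∃ l ∈ D.SR, x = D.a l * D.a l - D.e (D.Q.s l)) ∨
    ∃ l ∈ D.SH, x = D.a l * D.a l + D.e (D.Q.s l)}

/-- The paths in `Z`, as elements of `ℂ_σ Q`. -/
def ZElements : Set D.PathAlg := {x | ∃ p ∈ D.Z, x = (p.map D.a).prod}

/-- The algebra `ℂ_σ Q/⟨S ∪ Z⟩`. -/
abbrev Alg : Type u := (TwoSidedIdeal.span (D.S ∪ D.ZElements)).ringCon.Quotient

/-- The algebra `ℂ_σ Q/⟨S⟩`. -/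
abbrev LoopAlg : Type u := (TwoSidedIdeal.span D.S).ringCon.Quotient

/-- The quotient map `ℂ_σ Q → ℂ_σ Q/⟨S⟩`. -/
def toLoopAlg : D.PathAlg →+* D.LoopAlg := (TwoSidedIdeal.span D.S).ringCon.mk'

/-- The ideal `⟨⌈p⌉ | p ∈ Z⟩` of `ℂ_σ Q/⟨S⟩`. -/
def zIdeal : TwoSidedIdeal D.LoopAlg := TwoSidedIdeal.span (D.toLoopAlg '' D.ZElements)

open Classical in
/-- The type of a vertex: `R` or `H` if it has a special loop with polynomial `x² - 1` or
`x² + 1`, and `C` if it has no special loop. -/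
noncomputable def kind (i : D.Q.V) : DivKind :=
  if ∃ l ∈ D.SR, D.Q.s l = i then .R else if ∃ l ∈ D.SH, D.Q.s l = i then .H else .C

open Classical in
/-- The idempotent `ε_i`, which is `(⌈e_i⌉ + ⌈s_i⌉)/2` if `i` has a special loop `s_i` with
polynomial `x² - 1`, and `⌈e_i⌉` otherwise. -/
noncomputable def epsV (i : D.Q.V) : D.LoopAlg :=
  if h : ∃ l ∈ D.SR, D.Q.s l = i then
    (2⁻¹ : ℝ) • (D.toLoopAlg (D.e i) + D.toLoopAlg (D.a h.choose))
  else D.toLoopAlg (D.e i)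

/-- The idempotent `ε = ∑ ε_i`. -/
noncomputable def eps : D.LoopAlg := ∑ i, D.epsV i

/-- The arrows of `Q^b`: `(α, false)` is `α` and `(α, true)` is `α^𝐢`. -/
def BasicArrow : Type u :=
  {p : D.Q.E × Bool // p.1 ∉ D.special ∧
    (p.2 = true → D.kind (D.Q.s p.1) = D.kind (D.Q.t p.1) ∧ D.kind (D.Q.s p.1) ≠ .C)}

open Classical in
noncomputable instance : Fintype D.BasicArrow :=
  inferInstanceAs (Fintype {p : D.Q.E × Bool // p.1 ∉ D.special ∧
    (p.2 = true → D.kind (D.Q.s p.1) = D.kind (D.Q.t p.1) ∧ D.kind (D.Q.s p.1) ≠ .C)})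

open Classical in
/-- The modulated quiver `(Q^b, M)`. -/
noncomputable def basic : ModulatedQuiver.{u} where
  V := D.Q.V
  E := D.BasicArrow
  s p := D.Q.s p.1.1
  t p := D.Q.t p.1.1
  vert := D.kind
  arr p := SimpleBimod.std _ _ (decide (D.σ p.1.1 ≠ AlgEquiv.refl))

end ClannishDatum

end CGentle

set_option linter.unusedSimpArgs false
set_option linter.unusedSectionVars false

namespace CGentle

universe u v

/-! ### Lifting to corners -/

section CornerLift

variable {B : Type*} [Ring B] [Algebra ℝ B] {E : B}

noncomputable instance cornerAlgebra (hE : IsIdempotentElem E) : Algebra ℝ hE.Corner where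
  smul r x := ⟨r • x.1, r • x.1, by
    have h := (Subsemigroup.mem_corner_iff hE).mp x.2
    simp only [Algebra.mul_smul_comm, Algebra.smul_mul_assoc, h.1, h.2]⟩
  algebraMap :=
    { toFun := fun r => ⟨r • E, r • E, by
        simp only [Algebra.mul_smul_comm, Algebra.smul_mul_assoc, hE.eq]⟩
      map_one' := Subtype.ext (one_smul ℝ E)
      map_mul' := fun r s => Subtype.ext (show (r * s) • E = r • E * s • E by
        rw [smul_mul_smul_comm, hE.eq])
      map_zero' := Subtype.ext (zero_smul ℝ E)
      map_add' := fun r s => Subtype.ext (add_smul r s E) }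
  commutes' r x := Subtype.ext (show r • E * x.1 = x.1 * r • E by
    have h := (Subsemigroup.mem_corner_iff hE).mp x.2
    rw [smul_mul_assoc, mul_smul_comm, h.1, h.2])
  smul_def' r x := Subtype.ext (show r • x.1 = r • E * x.1 by
    have h := (Subsemigroup.mem_corner_iff hE).mp x.2
    rw [smul_mul_assoc, h.1])

/-- The inclusion of a corner. -/
noncomputable def cornerVal (hE : IsIdempotentElem E) : hE.Corner →ₙₐ[ℝ] B where
  toFun x := x.1
  map_smul' _ _ := rfl
  map_zero' := rfl
  map_add' _ _ := rfl
  map_mul' _ _ := rfl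

variable {X : Type*} (hE : IsIdempotentElem E) (f : X → B) (hf : ∀ x, E * f x = f x ∧ f x * E = f x)

/-- A map with values in a corner. -/
def cornerMk (x : X) : hE.Corner := ⟨f x, (Subsemigroup.mem_corner_iff hE).mpr (hf x)⟩

/-- The homomorphism from the free algebra to the corner `EBE` extending `f`. -/
noncomputable def freeCornerAlgHom : FreeAlgebra ℝ X →ₐ[ℝ] hE.Corner :=
  FreeAlgebra.lift ℝ (cornerMk hE f hf)

/-- The non-unital homomorphism from the free algebra extending `f` and sending `1` to `E`. -/
noncomputable def freeCornerLift : FreeAlgebra ℝ X →ₙₐ[ℝ] B :=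
  (cornerVal hE).comp (freeCornerAlgHom hE f hf : FreeAlgebra ℝ X →ₙₐ[ℝ] hE.Corner)

@[simp] lemma freeCornerLift_ι (x : X) : freeCornerLift hE f hf (FreeAlgebra.ι ℝ x) = f x := by
  change ((freeCornerAlgHom hE f hf) (FreeAlgebra.ι ℝ x)).1 = f x
  exact congrArg Subtype.val (FreeAlgebra.lift_ι_apply (cornerMk hE f hf) x)

@[simp] lemma freeCornerLift_algebraMap (r : ℝ) :
    freeCornerLift hE f hf (algebraMap ℝ _ r) = r • E := by
  change ((freeCornerAlgHom hE f hf) (algebraMap ℝ _ r)).1 = r • E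
  rw [AlgHom.commutes]; rfl

@[simp] lemma freeCornerLift_one : freeCornerLift hE f hf 1 = E := by
  change ((freeCornerAlgHom hE f hf) 1).1 = E
  rw [map_one]; rfl

variable {r : FreeAlgebra ℝ X → FreeAlgebra ℝ X → Prop}

/-- The non-unital homomorphism induced on a quotient of a free algebra. -/
noncomputable def quotCornerLift
    (hr : ∀ ⦃x y⦄, r x y → freeCornerLift hE f hf x = freeCornerLift hE f hf y) :
    RingQuot r →ₙₐ[ℝ] B :=
  (cornerVal hE).comp ((RingQuot.liftAlgHom ℝ ⟨freeCornerAlgHom hE f hf,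
    fun _ _ h => Subtype.ext (hr h)⟩ : RingQuot r →ₐ[ℝ] hE.Corner) : RingQuot r →ₙₐ[ℝ] hE.Corner)

lemma quotCornerLift_mk (hr : ∀ ⦃x y⦄, r x y → freeCornerLift hE f hf x = freeCornerLift hE f hf y)
    (x : FreeAlgebra ℝ X) :
    quotCornerLift hE f hf hr (RingQuot.mkAlgHom ℝ r x) = freeCornerLift hE f hf x := by
  exact congrArg Subtype.val (RingQuot.liftAlgHom_mkAlgHom_apply ℝ (freeCornerAlgHom hE f hf)
    (fun _ _ h => Subtype.ext (hr h)) x)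

end CornerLift

/-- An induction principle for quotients of free algebras. -/
lemma ringQuot_induction {X : Type*} {r : FreeAlgebra ℝ X → FreeAlgebra ℝ X → Prop}
    {p : RingQuot r → Prop} (one : p 1) (ι : ∀ x, p (RingQuot.mkAlgHom ℝ r (FreeAlgebra.ι ℝ x)))
    (add : ∀ x y, p x → p y → p (x + y)) (mul : ∀ x y, p x → p y → p (x * y))
    (smul : ∀ (c : ℝ) x, p x → p (c • x)) (x : RingQuot r) : p x := by
  obtain ⟨y, rfl⟩ := RingQuot.mkAlgHom_surjective ℝ r x
  induction y using FreeAlgebra.induction with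
  | grade0 c =>
    rw [AlgHom.commutes, Algebra.algebraMap_eq_smul_one]
    exact smul _ _ one
  | grade1 x => exact ι x
  | mul a b ha hb => rw [map_mul]; exact mul _ _ ha hb
  | add a b ha hb => rw [map_add]; exact add _ _ ha hb

/-! ### The tensor algebra of a bimodule -/

namespace BimodTensorAlgebra

variable {A : Type u} {M : Type v} [Ring A] [Algebra ℝ A] [AddCommGroup M] [Module A M]
  [Module Aᵐᵒᵖ M]

lemma ι₀_add (a b : A) : ι₀ (M := M) (a + b) = ι₀ a + ι₀ b := by
  simpa [ι₀] using RingQuot.mkAlgHom_rel ℝ (TensorRel.add (M := M) a b)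

lemma ι₀_mul (a b : A) : ι₀ (M := M) (a * b) = ι₀ a * ι₀ b := by
  simpa [ι₀] using RingQuot.mkAlgHom_rel ℝ (TensorRel.mul (M := M) a b)

lemma ι₀_algebraMap (r : ℝ) : ι₀ (M := M) (algebraMap ℝ A r) = algebraMap ℝ _ r := by
  simpa [ι₀] using RingQuot.mkAlgHom_rel ℝ (TensorRel.algebraMap (A := A) (M := M) r)

lemma ι₁_add (m n : M) : ι₁ (A := A) (m + n) = ι₁ m + ι₁ n := by
  simpa [ι₁] using RingQuot.mkAlgHom_rel ℝ (TensorRel.add' (A := A) m n)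

lemma ι₁_smul (a : A) (m : M) : ι₁ (A := A) (a • m) = ι₀ a * ι₁ m := by
  simpa [ι₁, ι₀] using RingQuot.mkAlgHom_rel ℝ (TensorRel.left (A := A) a m)

lemma ι₁_op_smul (a : A) (m : M) : ι₁ (A := A) (MulOpposite.op a • m) = ι₁ m * ι₀ a := by
  simpa [ι₁, ι₀] using RingQuot.mkAlgHom_rel ℝ (TensorRel.right (A := A) a m)

lemma ι₀_one : ι₀ (A := A) (M := M) 1 = 1 := by
  simpa using ι₀_algebraMap (A := A) (M := M) 1

lemma ι₀_zero : ι₀ (A := A) (M := M) 0 = 0 := by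
  simpa using ι₀_algebraMap (A := A) (M := M) 0

lemma ι₁_zero : ι₁ (A := A) (M := M) 0 = 0 := by
  simpa using ι₁_add (A := A) (0 : M) 0

/-- `ι₀` as a homomorphism of algebras. -/
noncomputable def ι₀Hom : A →ₐ[ℝ] BimodTensorAlgebra A M where
  toFun := ι₀
  map_one' := ι₀_one
  map_mul' := ι₀_mul
  map_zero' := ι₀_zero
  map_add' := ι₀_add
  commutes' := ι₀_algebraMap

/-- `ι₁` as an additive map. -/
noncomputable def ι₁Hom : M →+ BimodTensorAlgebra A M where
  toFun := ι₁
  map_zero' := ι₁_zero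
  map_add' := ι₁_add

lemma ι₀Hom_apply (a : A) : ι₀Hom (M := M) a = ι₀ a := rfl

lemma ι₁Hom_apply (m : M) : ι₁Hom (A := A) m = ι₁ m := rfl

end BimodTensorAlgebra

/-! ### The algebra of a modulated quiver -/

namespace ModulatedQuiver

open BimodTensorAlgebra

variable (M : ModulatedQuiver.{u})

lemma smul_apply (a : M.VertexRing) (m : M.ArrowBimod) (α : M.E) :
    (a • m) α = a (M.t α) • m α := rfl

lemma op_smul_apply (a : M.VertexRing) (m : M.ArrowBimod) (α : M.E) :
    (MulOpposite.op a • m) α = MulOpposite.op (a (M.s α)) • m α := rfl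

open Classical in
lemma ι₀_eq_sum (a : M.VertexRing) : (ι₀ a : M.T) = ∑ i, M.ofVert i (a i) := by
  simp only [ofVert, ← ι₀Hom_apply, ← map_sum]
  rw [Finset.univ_sum_single]

open Classical in
lemma ι₁_eq_sum (m : M.ArrowBimod) : (ι₁ m : M.T) = ∑ α, M.ofArr α (m α) := by
  simp only [ofArr, ← ι₁Hom_apply, ← map_sum]
  congr 1
  exact (Finset.univ_sum_single (M := fun α => (M.arr α).carrier) m).symm

lemma ofVert_add (i : M.V) (a b : (M.vert i).carrier) :
    M.ofVert i (a + b) = M.ofVert i a + M.ofVert i b := by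
  simp only [ofVert, Pi.single_add, ι₀_add]

lemma ofVert_mul (i : M.V) (a b : (M.vert i).carrier) :
    M.ofVert i (a * b) = M.ofVert i a * M.ofVert i b := by
  simp only [ofVert, Pi.single_mul, ι₀_mul]

lemma ofVert_smul (i : M.V) (r : ℝ) (a : (M.vert i).carrier) :
    M.ofVert i (r • a) = r • M.ofVert i a := by
  simp only [ofVert, Pi.single_smul, ← ι₀Hom_apply, map_smul]

open Classical in
lemma ofVert_mul_of_ne {i j : M.V} (h : i ≠ j) (a : (M.vert i).carrier) (b : (M.vert j).carrier) :
    M.ofVert i a * M.ofVert j b = 0 := by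
  simp only [ofVert, ← ι₀_mul]
  rw [← ι₀_zero]
  congr 1
  ext k
  by_cases hk : k = i
  · subst hk; simp [Pi.single_eq_of_ne h]
  · simp [Pi.single_eq_of_ne hk]

lemma one_eq_sum : (1 : M.T) = ∑ i, M.ofVert i 1 := by
  rw [← ι₀_one, ι₀_eq_sum]; rfl

open Classical in
lemma ofArr_add (α : M.E) (m n : (M.arr α).carrier) :
    M.ofArr α (m + n) = M.ofArr α m + M.ofArr α n := by
  rw [ofArr, ofArr, ofArr, ← ι₁_add]
  congr 1
  exact Pi.single_add (f := fun α => (M.arr α).carrier) α m n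

open Classical in
lemma ofVert_mul_ofArr (α : M.E) (a : (M.vert (M.t α)).carrier) (m : (M.arr α).carrier) :
    M.ofVert (M.t α) a * M.ofArr α m = M.ofArr α (a • m) := by
  rw [ofArr, ofArr, ofVert, ← ι₁_smul]
  congr 1
  funext β
  rw [smul_apply]
  by_cases h : β = α
  · subst h; simp [single]
  · simp only [single, Pi.single_eq_of_ne h]; exact smul_zero _

open Classical in
lemma ofArr_mul_ofVert (α : M.E) (a : (M.vert (M.s α)).carrier) (m : (M.arr α).carrier) :
    M.ofArr α m * M.ofVert (M.s α) a = M.ofArr α (MulOpposite.op a • m) := by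
  rw [ofArr, ofArr, ofVert, ← ι₁_op_smul]
  congr 1
  funext β
  rw [op_smul_apply]
  by_cases h : β = α
  · subst h; simp [single]
  · simp only [single, Pi.single_eq_of_ne h]; exact smul_zero _

/-- `ofArr α` as an additive map. -/
noncomputable def ofArrHom (α : M.E) : (M.arr α).carrier →+ M.T :=
  AddMonoidHom.mk' (M.ofArr α) (M.ofArr_add α)

lemma ofArr_zero (α : M.E) : M.ofArr α 0 = 0 := map_zero (M.ofArrHom α)

/-- An induction principle for `T(Q, M)`. -/
lemma T_induction {p : M.T → Prop} (vert : ∀ i a, p (M.ofVert i a)) (arr : ∀ α m, p (M.ofArr α m))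
    (zero : p 0) (add : ∀ x y, p x → p y → p (x + y)) (mul : ∀ x y, p x → p y → p (x * y))
    (smul : ∀ (c : ℝ) x, p x → p (c • x)) (x : M.T) : p x := by
  have hs : ∀ {ι : Type u} (s : Finset ι) (f : ι → M.T), (∀ i, p (f i)) → p (∑ i ∈ s, f i) := by
    intro ι s f hf
    classical
    induction s using Finset.induction_on with
    | empty => simpa using zero
    | insert a s ha ih => rw [Finset.sum_insert ha]; exact add _ _ (hf a) ih
  refine ringQuot_induction ?_ ?_ add mul smul x
  · rw [one_eq_sum]
    exact hs _ _ fun i => vert i 1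
  · rintro (a | m)
    · change p (ι₀ a)
      rw [ι₀_eq_sum]; exact hs _ _ fun i => vert i _
    · change p (ι₁ (A := M.VertexRing) (M := M.ArrowBimod) m)
      rw [ι₁_eq_sum]; exact hs _ _ fun i => arr i _

section Lift

variable {B : Type*} [Ring B] [Algebra ℝ B] (f : (i : M.V) → (M.vert i).carrier →ₙₐ[ℝ] B)
  (g : (α : M.E) → (M.arr α).carrier →+ B)

/-- Non-unital homomorphisms `T(Q, M) → B`: the universal property. -/
lemma exists_lift (orth : ∀ i j, i ≠ j → f i 1 * f j 1 = 0)
    (left : ∀ α a m, g α (a • m) = f (M.t α) a * g α m)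
    (right : ∀ α a m, g α (MulOpposite.op a • m) = g α m * f (M.s α) a) :
    ∃ F : M.T →ₙₐ[ℝ] B, (∀ i a, F (M.ofVert i a) = f i a) ∧ ∀ α m, F (M.ofArr α m) = g α m := by
  classical
  have f1 : ∀ i a, f i 1 * f i a = f i a := fun i a => by rw [← map_mul, one_mul]
  have f2 : ∀ i a, f i a * f i 1 = f i a := fun i a => by rw [← map_mul, mul_one]
  have orth' : ∀ i j, i ≠ j → ∀ a b, f i a * f j b = 0 := fun i j h a b => by
    rw [← f2, ← f1 j b, mul_assoc, ← mul_assoc (f i 1), orth i j h, zero_mul, mul_zero]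
  have g1 : ∀ α m, f (M.t α) 1 * g α m = g α m := fun α m => by rw [← left, one_smul]
  have g2 : ∀ α m, g α m * f (M.s α) 1 = g α m := fun α m => by
    rw [← right, MulOpposite.op_one, one_smul]
  have sumf : ∀ a b : M.VertexRing, (∑ i, f i (a i)) * (∑ i, f i (b i)) =
      ∑ i, f i (a i * b i) := fun a b => by
    rw [Finset.sum_mul_sum]
    refine Finset.sum_congr rfl fun i _ => ?_
    rw [Finset.sum_eq_single i, map_mul]
    · exact fun j _ h => orth' i j h.symm _ _
    · simp
  have sumg1 : ∀ (a : M.VertexRing) α m, (∑ i, f i (a i)) * g α m = g α (a (M.t α) • m) := by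
    intro a α m
    rw [Finset.sum_mul, Finset.sum_eq_single (M.t α), left]
    · intro j _ h
      rw [← g1, ← mul_assoc, orth' _ _ h, zero_mul]
    · simp
  have sumg2 : ∀ (a : M.VertexRing) α m,
      g α m * (∑ i, f i (a i)) = g α (MulOpposite.op (a (M.s α)) • m) := by
    intro a α m
    rw [Finset.mul_sum, Finset.sum_eq_single (M.s α), right]
    · intro j _ h
      rw [← g2, mul_assoc, orth' _ _ h.symm, mul_zero]
    · simp
  let E : B := ∑ i, f i ((1 : M.VertexRing) i)
  have hE : IsIdempotentElem E := by
    simp only [IsIdempotentElem, E, sumf]; simp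
  let F₀ : M.VertexRing ⊕ M.ArrowBimod → B :=
    Sum.elim (fun a => ∑ i, f i (a i)) (fun m => ∑ α, g α (m α))
  have hF : ∀ x, E * F₀ x = F₀ x ∧ F₀ x * E = F₀ x := by
    rintro (a | m)
    · simp only [F₀, E, Sum.elim_inl, sumf]; simp
    · simp only [F₀, Sum.elim_inr]
      rw [Finset.mul_sum, Finset.sum_mul]
      simp only [E, sumg1, sumg2, Pi.one_apply, MulOpposite.op_one, one_smul, and_self]
  have hr : ∀ ⦃x y⦄, TensorRel M.VertexRing M.ArrowBimod x y →
      freeCornerLift hE F₀ hF x = freeCornerLift hE F₀ hF y := by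
    intro x y h
    cases h with
    | add a b => simp [F₀, Finset.sum_add_distrib]
    | mul a b =>
      rw [map_mul]
      simp only [freeCornerLift_ι, F₀, Sum.elim_inl, sumf, Pi.mul_apply]
    | algebraMap r =>
      simp only [freeCornerLift_ι, freeCornerLift_algebraMap, F₀, E, Finset.smul_sum,
        Sum.elim_inl, ← map_smul]
      refine Finset.sum_congr rfl fun i _ => ?_
      rw [Pi.algebraMap_apply, Algebra.algebraMap_eq_smul_one]; rfl
    | add' m n =>
      simp only [map_add, freeCornerLift_ι, F₀, Sum.elim_inr, ← Finset.sum_add_distrib]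
      refine Finset.sum_congr rfl fun i _ => ?_
      rw [← map_add]; rfl
    | left a m =>
      rw [map_mul]
      simp only [freeCornerLift_ι, F₀, Sum.elim_inr, Sum.elim_inl]
      rw [Finset.mul_sum]
      simp only [sumg1, smul_apply]
    | right a m =>
      rw [map_mul]
      simp only [freeCornerLift_ι, F₀, Sum.elim_inr, Sum.elim_inl]
      rw [Finset.sum_mul]
      simp only [sumg2, op_smul_apply]
  refine ⟨quotCornerLift hE F₀ hF hr, fun i a => ?_, fun α m => ?_⟩
  · refine (quotCornerLift_mk hE F₀ hF hr _).trans ?_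
    rw [freeCornerLift_ι]
    change ∑ j, f j ((Pi.single i a : M.VertexRing) j) = f i a
    rw [Finset.sum_eq_single i]
    · simp
    · intro j _ h; simp [Pi.single_eq_of_ne h]
    · simp
  · refine (quotCornerLift_mk hE F₀ hF hr _).trans ?_
    rw [freeCornerLift_ι]
    change ∑ β, g β (M.single α m β) = g α m
    rw [Finset.sum_eq_single α]
    · simp [single]
    · intro j _ h; simp [single, Pi.single_eq_of_ne h]
    · simp

end Lift

end ModulatedQuiver

/-- Non-unital homomorphisms that vanish on an ideal factor through the quotient. -/
lemma exists_quotient_lift {R B : Type*} [Ring R] [Algebra ℝ R] [Ring B] [Algebra ℝ B]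
    (I : TwoSidedIdeal R) (F : R →ₙₐ[ℝ] B) (h : ∀ x ∈ I, F x = 0) :
    ∃ G : I.ringCon.Quotient →ₙₐ[ℝ] B, ∀ x, G (I.ringCon.mk' x) = F x := by
  have key : ∀ x y, I.ringCon x y → F x = F y := fun x y hxy => by
    rw [← sub_eq_zero, ← map_sub]
    exact h _ ((I.rel_iff x y).mp hxy)
  refine ⟨{ toFun := fun q => Quotient.lift (s := I.ringCon.toSetoid) F key q
            map_smul' := ?_
            map_zero' := map_zero F
            map_add' := ?_
            map_mul' := ?_ }, fun _ => rfl⟩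
  · intro r x
    obtain ⟨x, rfl⟩ := I.ringCon.mk'_surjective x
    exact map_smul F r x
  · intro x y
    obtain ⟨x, rfl⟩ := I.ringCon.mk'_surjective x
    obtain ⟨y, rfl⟩ := I.ringCon.mk'_surjective y
    exact map_add F x y
  · intro x y
    obtain ⟨x, rfl⟩ := I.ringCon.mk'_surjective x
    obtain ⟨y, rfl⟩ := I.ringCon.mk'_surjective y
    exact map_mul F x y

lemma complexAut_apply (σ : ℂ ≃ₐ[ℝ] ℂ) :
    (σ = AlgEquiv.refl ∧ ∀ z, σ z = z) ∨ (σ ≠ AlgEquiv.refl ∧ ∀ z, σ z = starRingEnd ℂ z) := by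
  by_cases h : σ = AlgEquiv.refl
  · left; subst h; exact ⟨rfl, fun _ => rfl⟩
  · right
    refine ⟨h, ?_⟩
    rcases Complex.real_algHom_eq_id_or_conj (σ : ℂ →ₐ[ℝ] ℂ) with h' | h'
    · exact absurd (AlgEquiv.ext fun z => DFunLike.congr_fun h' z) h
    · exact fun z => DFunLike.congr_fun h' z

namespace ClannishDatum

variable (D : ClannishDatum.{u})

/-- The scalar `c` in `ℂ_σ Q/⟨S⟩`. -/
noncomputable def scal (c : ℂ) : D.LoopAlg :=
  D.toLoopAlg (RingQuot.mkAlgHom ℝ (PathRel D.Q D.σ) (FreeAlgebra.ι ℝ (.scalar c)))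

/-- The scalar `𝐢` in `ℂ_σ Q/⟨S⟩`. -/
noncomputable def im : D.LoopAlg := D.scal Complex.I

/-- The trivial path at `i` in `ℂ_σ Q/⟨S⟩`. -/
noncomputable def ve (i : D.Q.V) : D.LoopAlg := D.toLoopAlg (D.e i)

/-- The arrow `α` in `ℂ_σ Q/⟨S⟩`. -/
noncomputable def ar (α : D.Q.E) : D.LoopAlg := D.toLoopAlg (D.a α)

lemma toLoopAlg_smul (r : ℝ) (x : D.PathAlg) : D.toLoopAlg (r • x) = r • D.toLoopAlg x := rfl

lemma toLoopAlg_surjective : Function.Surjective D.toLoopAlg :=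
  (TwoSidedIdeal.span D.S).ringCon.mk'_surjective

lemma toLoopAlg_eq_zero_iff (x : D.PathAlg) : D.toLoopAlg x = 0 ↔ x ∈ TwoSidedIdeal.span D.S := by
  conv_rhs => rw [← TwoSidedIdeal.ker_ringCon_mk' (TwoSidedIdeal.span D.S),
    TwoSidedIdeal.mem_ker]
  rfl

lemma path_rel {x y : FreeAlgebra ℝ (PathGen D.Q)} (h : PathRel D.Q D.σ x y) :
    D.toLoopAlg (RingQuot.mkAlgHom ℝ _ x) = D.toLoopAlg (RingQuot.mkAlgHom ℝ _ y) := by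
  rw [RingQuot.mkAlgHom_rel ℝ h]

lemma scal_add (a b : ℂ) : D.scal (a + b) = D.scal a + D.scal b := by
  have h := D.path_rel (.scalar_add a b)
  simp only [map_add] at h
  exact h

lemma scal_mul (a b : ℂ) : D.scal (a * b) = D.scal a * D.scal b := by
  have h := D.path_rel (.scalar_mul a b)
  simp only [map_mul] at h
  exact h

lemma scal_real (r : ℝ) : D.scal r = r • 1 := by
  have h := D.path_rel (.scalar_real r)
  rw [AlgHom.commutes, Algebra.algebraMap_eq_smul_one, toLoopAlg_smul, map_one] at h
  exact h

lemma scal_eq (c : ℂ) : D.scal c = c.re • 1 + c.im • D.im := by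
  conv_lhs => rw [← Complex.re_add_im c]
  rw [scal_add, scal_mul, scal_real, scal_real, smul_mul_assoc, one_mul]; rfl

lemma im_mul_im : D.im * D.im = -1 := by
  rw [im, ← scal_mul, Complex.I_mul_I, scal_eq]; simp

lemma ve_mul_self (i : D.Q.V) : D.ve i * D.ve i = D.ve i := by
  have h := D.path_rel (.triv_self i)
  simp only [map_mul] at h
  exact h

lemma ve_mul_of_ne {i j : D.Q.V} (h : i ≠ j) : D.ve i * D.ve j = 0 := by
  have h' := D.path_rel (.triv_ne i j h)
  simp only [map_mul, map_zero] at h'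
  exact h'

lemma sum_ve : ∑ i, D.ve i = 1 := by
  have h := D.path_rel .triv_sum
  simp only [map_sum, map_one] at h
  exact h

lemma ve_mul_ar (α : D.Q.E) : D.ve (D.Q.t α) * D.ar α = D.ar α := by
  have h := D.path_rel (.arrow_left α)
  simp only [map_mul] at h
  exact h

lemma ar_mul_ve (α : D.Q.E) : D.ar α * D.ve (D.Q.s α) = D.ar α := by
  have h := D.path_rel (.arrow_right α)
  simp only [map_mul] at h
  exact h

lemma ve_mul_im (i : D.Q.V) : D.ve i * D.im = D.im * D.ve i := by
  have h := D.path_rel (.triv_scalar i Complex.I)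
  simp only [map_mul] at h
  exact h

lemma ar_mul_im' (α : D.Q.E) : D.ar α * D.im = D.scal (D.σ α Complex.I) * D.ar α := by
  have h := D.path_rel (.arrow_scalar α Complex.I)
  simp only [map_mul] at h
  exact h

lemma ar_mul_im (α : D.Q.E) (h : D.σ α = AlgEquiv.refl) : D.ar α * D.im = D.im * D.ar α := by
  rw [ar_mul_im', h]; rfl

lemma ar_mul_im_of_ne (α : D.Q.E) (h : D.σ α ≠ AlgEquiv.refl) :
    D.ar α * D.im = -(D.im * D.ar α) := by
  rcases complexAut_apply (D.σ α) with h' | h'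
  · exact absurd h'.1 h
  · rw [ar_mul_im', h'.2, scal_eq]; simp

lemma ar_mul_self_of_mem_SR {l : D.Q.E} (h : l ∈ D.SR) :
    D.ar l * D.ar l = D.ve (D.Q.s l) := by
  have := (D.toLoopAlg_eq_zero_iff _).mpr (TwoSidedIdeal.subset_span
    (show D.a l * D.a l - D.e (D.Q.s l) ∈ D.S from Or.inl ⟨l, h, rfl⟩))
  rw [map_sub, map_mul, sub_eq_zero] at this
  exact this

lemma ar_mul_self_of_mem_SH {l : D.Q.E} (h : l ∈ D.SH) :
    D.ar l * D.ar l = -D.ve (D.Q.s l) := by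
  have := (D.toLoopAlg_eq_zero_iff _).mpr (TwoSidedIdeal.subset_span
    (show D.a l * D.a l + D.e (D.Q.s l) ∈ D.S from Or.inr ⟨l, h, rfl⟩))
  rw [map_add, map_mul, ← eq_neg_iff_add_eq_zero] at this
  exact this

/-- An induction principle for `ℂ_σ Q/⟨S⟩`. -/
lemma loopAlg_induction {p : D.LoopAlg → Prop} (im : p D.im) (ve : ∀ i, p (D.ve i))
    (ar : ∀ α, p (D.ar α)) (zero : p 0)
    (add : ∀ x y, p x → p y → p (x + y)) (mul : ∀ x y, p x → p y → p (x * y))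
    (smul : ∀ (c : ℝ) x, p x → p (c • x)) (x : D.LoopAlg) : p x := by
  have one : p 1 := by
    rw [← D.sum_ve]
    exact Finset.sum_induction _ p add zero fun i _ => ve i
  obtain ⟨y, rfl⟩ := D.toLoopAlg_surjective x
  refine ringQuot_induction (p := fun y => p (D.toLoopAlg y)) ?_ ?_ ?_ ?_ ?_ y
  · rwa [map_one]
  · rintro (c | i | α)
    · change p (D.scal c)
      rw [scal_eq]
      exact add _ _ (smul _ _ one) (smul _ _ im)
    · exact ve i
    · exact ar α
  · intro x y hx hy; rw [map_add]; exact add _ _ hx hy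
  · intro x y hx hy; rw [map_mul]; exact mul _ _ hx hy
  · intro c x hx; rw [toLoopAlg_smul]; exact smul _ _ hx

variable {D} in
lemma loopAlg_hom_ext {B : Type*} [Ring B] [Algebra ℝ B] {F G : D.LoopAlg →ₙₐ[ℝ] B}
    (im : F D.im = G D.im) (ve : ∀ i, F (D.ve i) = G (D.ve i)) (ar : ∀ α, F (D.ar α) = G (D.ar α))
    (x : D.LoopAlg) : F x = G x := by
  refine D.loopAlg_induction (p := fun x => F x = G x) im ve ar ?_ ?_ ?_ ?_ x
  · rw [map_zero, map_zero]
  · intro x y hx hy; rw [map_add, map_add, hx, hy]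
  · intro x y hx hy; rw [map_mul, map_mul, hx, hy]
  · intro c x hx; rw [map_smul, map_smul, hx]

/-- Non-unital homomorphisms from `ℂ_σ Q/⟨S⟩`: the universal property. -/
lemma exists_loopAlg_lift {B : Type*} [Ring B] [Algebra ℝ B] (J : B) (e : D.Q.V → B)
    (a : D.Q.E → B) (he : ∀ i, e i * e i = e i) (hne : ∀ i j, i ≠ j → e i * e j = 0)
    (hJ : (∑ i, e i) * J = J) (hJJ : J * J = -∑ i, e i) (heJ : ∀ i, e i * J = J * e i)
    (hta : ∀ α, e (D.Q.t α) * a α = a α) (has : ∀ α, a α * e (D.Q.s α) = a α)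
    (hid : ∀ α, D.σ α = AlgEquiv.refl → a α * J = J * a α)
    (hconj : ∀ α, D.σ α ≠ AlgEquiv.refl → a α * J = -(J * a α))
    (hR : ∀ l ∈ D.SR, a l * a l = e (D.Q.s l)) (hH : ∀ l ∈ D.SH, a l * a l = -e (D.Q.s l)) :
    ∃ F : D.LoopAlg →ₙₐ[ℝ] B, F D.im = J ∧ (∀ i, F (D.ve i) = e i) ∧ ∀ α, F (D.ar α) = a α := by
  classical
  set E : B := ∑ i, e i with hEdef
  have Ee : ∀ i, E * e i = e i := fun i => by
    rw [hEdef, Finset.sum_mul, Finset.sum_eq_single i (fun j _ h => hne j i h) (by simp), he]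
  have eE : ∀ i, e i * E = e i := fun i => by
    rw [hEdef, Finset.mul_sum, Finset.sum_eq_single i (fun j _ h => hne i j h.symm) (by simp), he]
  have hE : IsIdempotentElem E := by
    change E * E = E
    conv_lhs => rw [hEdef, ← hEdef, hEdef, Finset.sum_mul, ← hEdef]
    simp only [eE, ← hEdef]
  have JE : J * E = J := by
    rw [← hJ]; conv_lhs => rw [hJ, hEdef]
    rw [Finset.mul_sum, hEdef, Finset.sum_mul]
    simp only [heJ]
  have Ea : ∀ α, E * a α = a α := fun α => by rw [← hta, ← mul_assoc, Ee]
  have aE : ∀ α, a α * E = a α := fun α => by rw [← has, mul_assoc, eE]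
  let F₀ : PathGen D.Q → B
    | .scalar c => c.re • E + c.im • J
    | .triv i => e i
    | .arrow α => a α
  have hF : ∀ x, E * F₀ x = F₀ x ∧ F₀ x * E = F₀ x := by
    rintro (c | i | α)
    · simp only [F₀, mul_add, add_mul, mul_smul_comm, smul_mul_assoc, hE.eq, hJ, JE, and_self]
    · exact ⟨Ee i, eE i⟩
    · exact ⟨Ea α, aE α⟩
  have hr : ∀ ⦃x y⦄, PathRel D.Q D.σ x y →
      freeCornerLift hE F₀ hF x = freeCornerLift hE F₀ hF y := by
    intro x y h
    cases h with
    | scalar_add a b =>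
      simp only [map_add, freeCornerLift_ι, F₀, Complex.add_re, Complex.add_im]; module
    | scalar_mul a b =>
      simp only [map_mul, freeCornerLift_ι, F₀, Complex.mul_re, Complex.mul_im, mul_add, add_mul,
        mul_smul_comm, smul_mul_assoc, hE.eq, hJ, JE, hJJ]
      module
    | scalar_real r => simp [F₀]
    | triv_self i => rw [map_mul]; simp only [freeCornerLift_ι, F₀, he]
    | triv_ne i j h => rw [map_mul, map_zero]; simp only [freeCornerLift_ι, F₀, hne i j h]
    | triv_sum => rw [map_sum, freeCornerLift_one]; simp only [freeCornerLift_ι, F₀, ← hEdef]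
    | arrow_left α => rw [map_mul]; simp only [freeCornerLift_ι, F₀, hta]
    | arrow_right α => rw [map_mul]; simp only [freeCornerLift_ι, F₀, has]
    | triv_scalar i c =>
      rw [map_mul, map_mul]
      simp only [freeCornerLift_ι, F₀, mul_add, add_mul, mul_smul_comm, smul_mul_assoc, heJ, eE, Ee]
    | arrow_scalar α c =>
      rw [map_mul, map_mul]
      simp only [freeCornerLift_ι, F₀, mul_add, add_mul, mul_smul_comm, smul_mul_assoc, aE, Ea]
      rcases complexAut_apply (D.σ α) with h | h
      · rw [h.2, hid α h.1]
      · rw [h.2, hconj α h.1]; simp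
  let F₁ : D.PathAlg →ₙₐ[ℝ] B := quotCornerLift hE F₀ hF hr
  have Fe : ∀ i, F₁ (D.e i) = e i := fun i => by
    refine (quotCornerLift_mk hE F₀ hF hr _).trans ?_
    rw [freeCornerLift_ι]
  have Fa : ∀ α, F₁ (D.a α) = a α := fun α => by
    refine (quotCornerLift_mk hE F₀ hF hr _).trans ?_
    rw [freeCornerLift_ι]
  have hker : TwoSidedIdeal.span D.S ≤ TwoSidedIdeal.ker F₁ := by
    refine TwoSidedIdeal.span_le.mpr ?_
    rintro x (⟨l, hl, rfl⟩ | ⟨l, hl, rfl⟩)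
    · rw [SetLike.mem_coe, TwoSidedIdeal.mem_ker, map_sub, map_mul, Fe, Fa, hR l hl, sub_self]
    · rw [SetLike.mem_coe, TwoSidedIdeal.mem_ker, map_add, map_mul, Fe, Fa, hH l hl, neg_add_cancel]
  obtain ⟨F, hF'⟩ := exists_quotient_lift _ F₁ fun x hx => (TwoSidedIdeal.mem_ker F₁).mp (hker hx)
  refine ⟨F, ?_, fun i => (hF' _).trans (Fe i), fun α => (hF' _).trans (Fa α)⟩
  refine (hF' _).trans ((quotCornerLift_mk hE F₀ hF hr _).trans ?_)
  rw [freeCornerLift_ι]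
  simp [F₀]

end ClannishDatum

/-! ### The division ring at a vertex -/

/-- In a ring with a square root `J` of `-1`: an idempotent `e` and a special loop `s` of kind `x`
at the same vertex (`s` may be `0` if `x = ℂ`). -/
structure IsVertex {B : Type*} [Ring B] (x : DivKind) (J e s : B) : Prop where
  JJ : J * J = -1
  ee : e * e = e
  eJ : e * J = J * e
  es : e * s = s
  se : s * e = s
  sJ : s * J = -(J * s)
  ssR : x = .R → s * s = e
  ssH : x = .H → s * s = -e

namespace IsVertex

variable {B : Type*} [Ring B] {x : DivKind} {J e s : B} (h : IsVertex x J e s)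
include h

lemma JJ_mul (z : B) : J * (J * z) = -z := by rw [← mul_assoc, h.JJ, neg_one_mul]
lemma ee_mul (z : B) : e * (e * z) = e * z := by rw [← mul_assoc, h.ee]
lemma eJ_mul (z : B) : e * (J * z) = J * (e * z) := by rw [← mul_assoc, h.eJ, mul_assoc]
lemma es_mul (z : B) : e * (s * z) = s * z := by rw [← mul_assoc, h.es]
lemma se_mul (z : B) : s * (e * z) = s * z := by rw [← mul_assoc, h.se]
lemma sJ_mul (z : B) : s * (J * z) = -(J * (s * z)) := by
  rw [← mul_assoc, h.sJ, neg_mul, mul_assoc]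
lemma ssR_mul (hx : x = .R) (z : B) : s * (s * z) = e * z := by rw [← mul_assoc, h.ssR hx]
lemma ssH_mul (hx : x = .H) (z : B) : s * (s * z) = -(e * z) := by
  rw [← mul_assoc, h.ssH hx, neg_mul]

end IsVertex

section

variable {B : Type*} [Ring B] [Algebra ℝ B]

/-- The embedding of `ℝ` given by `e` and `s`. -/
noncomputable def rfun (e s : B) (r : ℝ) : B := r • ((2⁻¹ : ℝ) • (e + s))

/-- The embedding of `ℂ` given by `J` and `e`. -/
noncomputable def cfun (J e : B) (z : ℂ) : B := z.re • e + z.im • (J * e)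

/-- The embedding of `ℍ` given by `J`, `e` and `s`. -/
noncomputable def qfun (J e s : B) (q : Quaternion ℝ) : B :=
  q.re • e + q.imI • (J * e) + q.imJ • s + q.imK • (J * s)

/-- The embedding of `ℝ`, `ℂ` or `ℍ` given by `J`, `e` and `s`. -/
noncomputable def vfun (x : DivKind) (J e s : B) : x.carrier → B :=
  match x with
  | .R => rfun e s
  | .C => cfun J e
  | .H => qfun J e s

lemma rfun_add (e s : B) (p q : ℝ) : rfun e s (p + q) = rfun e s p + rfun e s q := add_smul _ _ _

lemma cfun_add (J e : B) (p q : ℂ) : cfun J e (p + q) = cfun J e p + cfun J e q := by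
  simp only [cfun, Complex.add_re, Complex.add_im]; module

lemma qfun_add (J e s : B) (p q : Quaternion ℝ) :
    qfun J e s (p + q) = qfun J e s p + qfun J e s q := by
  simp only [qfun, Quaternion.re_add, Quaternion.imI_add, Quaternion.imJ_add, Quaternion.imK_add]
  module

lemma rfun_smul (e s : B) (r p : ℝ) : rfun e s (r * p) = r • rfun e s p := mul_smul _ _ _

lemma cfun_smul (J e : B) (r : ℝ) (p : ℂ) : cfun J e (r • p) = r • cfun J e p := by
  simp only [cfun, Complex.smul_re, Complex.smul_im, smul_eq_mul]; module

lemma qfun_smul (J e s : B) (r : ℝ) (p : Quaternion ℝ) :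
    qfun J e s (r • p) = r • qfun J e s p := by
  simp only [qfun, Quaternion.re_smul, Quaternion.imI_smul, Quaternion.imJ_smul,
    Quaternion.imK_smul, smul_eq_mul]
  module

lemma rfun_one (e s : B) : rfun e s 1 = (2⁻¹ : ℝ) • (e + s) := one_smul _ _

lemma cfun_one (J e : B) : cfun J e 1 = e := by simp [cfun]

lemma qfun_one (J e s : B) : qfun J e s 1 = e := by
  change (1 : ℝ) • e + (0 : ℝ) • (J * e) + (0 : ℝ) • s + (0 : ℝ) • (J * s) = e
  simp

/-- The quaternion unit `𝐣`. -/
abbrev qj : Quaternion ℝ := SimpleBimod.Sym.toQuaternion .j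

/-- The quaternion unit `𝐤`. -/
abbrev qk : Quaternion ℝ := SimpleBimod.Sym.toQuaternion .k

lemma qfun_k (J e s : B) : qfun J e s qk = s := by
  change (0 : ℝ) • e + (0 : ℝ) • (J * e) + (1 : ℝ) • s + (0 : ℝ) • (J * s) = s
  simp

lemma vfun_map {B' : Type*} [Ring B'] [Algebra ℝ B'] (F : B →ₙₐ[ℝ] B') (x : DivKind) (J e s : B)
    (a : x.carrier) : F (vfun x J e s a) = vfun x (F J) (F e) (F s) a := by
  cases x with
  | R =>
    have aux : ∀ r : ℝ, F (rfun e s r) = rfun (F e) (F s) r := fun r => by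
      simp only [rfun, map_smul, map_add]
    exact aux a
  | C => simp only [vfun, cfun, map_smul, map_add, map_mul]
  | H => simp only [vfun, qfun, map_smul, map_add, map_mul]

lemma vfun_add (x : DivKind) (J e s : B) (a b : x.carrier) :
    vfun x J e s (a + b) = vfun x J e s a + vfun x J e s b := by
  cases x with
  | R => exact rfun_add e s a b
  | C => exact cfun_add J e a b
  | H => exact qfun_add J e s a b

lemma vfun_smul (x : DivKind) (J e s : B) (r : ℝ) (a : x.carrier) :
    vfun x J e s (r • a) = r • vfun x J e s a := by
  cases x with
  | R => exact rfun_smul e s r a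
  | C => exact cfun_smul J e r a
  | H => exact qfun_smul J e s r a

variable {x y : DivKind} {J e s e' s' a : B}

namespace IsVertex

lemma rfun_mul (h : IsVertex .R J e s) (p q : ℝ) :
    rfun e s (p * q) = rfun e s p * rfun e s q := by
  simp only [rfun, mul_add, add_mul, mul_smul_comm, smul_mul_assoc, h.ee, h.es, h.se, h.ssR rfl]
  module

lemma cfun_mul (h : IsVertex x J e s) (p q : ℂ) :
    cfun J e (p * q) = cfun J e p * cfun J e q := by
  simp only [cfun, Complex.mul_re, Complex.mul_im, mul_add, add_mul, mul_smul_comm,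
    smul_mul_assoc, mul_assoc, h.ee, h.eJ_mul, h.JJ_mul]
  module

lemma qfun_mul (h : IsVertex .H J e s) (p q : Quaternion ℝ) :
    qfun J e s (p * q) = qfun J e s p * qfun J e s q := by
  simp only [qfun, Quaternion.re_mul, Quaternion.imI_mul, Quaternion.imJ_mul,
    Quaternion.imK_mul, mul_add, add_mul, mul_smul_comm,
    smul_mul_assoc, mul_assoc, h.ee, h.eJ_mul, h.JJ_mul, h.es, h.se, h.sJ_mul, h.ssH rfl,
    mul_neg, neg_neg]
  module

variable (h : IsVertex x J e s)
include h

lemma vfun_mul (p q : x.carrier) : vfun x J e s (p * q) = vfun x J e s p * vfun x J e s q := by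
  cases x with
  | R => exact rfun_mul h p q
  | C => exact cfun_mul h p q
  | H => exact qfun_mul h p q

/-- `vfun` as a homomorphism. -/
noncomputable def hom : x.carrier →ₙₐ[ℝ] B where
  toFun := vfun x J e s
  map_smul' := vfun_smul x J e s
  map_zero' := by simpa using vfun_smul x J e s 0 0
  map_add' := vfun_add x J e s
  map_mul' := h.vfun_mul

end IsVertex

/-! ### The bimodule at an arrow -/

/-- The `ℝ`-linear map on a simple `x`-`y`-bimodule attached to a map `A(p, q) = paq`; it sends the
generator `1` (or `(1, 0)`) to the untwisted element `a`, up to averaging. -/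
noncomputable def SimpleBimod.arrfun {N : Type*} [AddCommGroup N] : {x y : DivKind} →
    (b : SimpleBimod x y) → (A : x.carrier → y.carrier → N) → b.carrier → N
  | _, _, .RR => fun A m => A m (1 : ℝ)
  | _, _, .HH => fun A (m : Quaternion ℝ) => A m (1 : Quaternion ℝ) - A (m * qk : Quaternion ℝ) qk
  | _, _, .RC => fun A m => A (1 : ℝ) m
  | _, _, .CR => fun A m => A m (1 : ℝ)
  | _, _, .RH => fun A m => A (1 : ℝ) m
  | _, _, .HR => fun A m => A m (1 : ℝ)
  | _, _, .HC => fun A (m : Fin 2 → ℂ) => A (1 : Quaternion ℝ) (m 0) - A qk (m 1)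
  | _, _, .CH => fun A (m : Fin 2 → ℂ) => A (m 0) (1 : Quaternion ℝ) + A (m 1) qk
  | _, _, .CC => fun A m => A m (1 : ℂ)
  | _, _, .CCbar => fun A m => A m (1 : ℂ)

lemma SimpleBimod.arrfun_map {N N' : Type*} [AddCommGroup N] [AddCommGroup N'] (F : N →+ N')
    (b : SimpleBimod x y) (A : x.carrier → y.carrier → N) (m : b.carrier) :
    F (b.arrfun A m) = b.arrfun (fun p q => F (A p q)) m := by
  cases b with
  | HH => exact map_sub F _ _
  | HC => exact map_sub F _ _
  | CH => exact map_add F _ _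
  | _ => rfl

/-- `a` commutes with `J`, up to the sign given by the bimodule. -/
def SimpleBimod.Balanced (b : SimpleBimod x y) (J a : B) : Prop :=
  match b with
  | .CCbar => a * J = -(J * a)
  | _ => a * J = J * a

/-- `p * a * q`, for `p` and `q` in the division rings at the ends of an arrow. -/
noncomputable def sandwich (x y : DivKind) (J e s e' s' a : B) (p : x.carrier) (q : y.carrier) : B :=
  vfun x J e s p * a * vfun y J e' s' q

lemma arrfun_add (b : SimpleBimod x y) (m n : b.carrier) :
    b.arrfun (sandwich x y J e s e' s' a) (m + n) =
      b.arrfun (sandwich x y J e s e' s' a) m + b.arrfun (sandwich x y J e s e' s' a) n := by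
  have h1 : ∀ p p' q, sandwich x y J e s e' s' a (p + p') q =
      sandwich x y J e s e' s' a p q + sandwich x y J e s e' s' a p' q := fun p p' q => by
    simp only [sandwich, vfun_add, add_mul]
  have h2 : ∀ p q q', sandwich x y J e s e' s' a p (q + q') =
      sandwich x y J e s e' s' a p q + sandwich x y J e s e' s' a p q' := fun p p' q => by
    simp only [sandwich, vfun_add, mul_add]
  cases b with
  | RR => exact h1 _ _ _
  | HH =>
    have aux : ∀ m n : Quaternion ℝ, (m + n) * qk = m * qk + n * qk := fun m n => add_mul _ _ _
    refine (congrArg₂ (· - ·) (h1 _ _ _)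
      ((congrArg (sandwich .H .H J e s e' s' a · qk) (aux m n)).trans (h1 _ _ _))).trans ?_
    exact add_sub_add_comm _ _ _ _
  | RC => exact h2 _ _ _
  | CR => exact h1 _ _ _
  | RH => exact h2 _ _ _
  | HR => exact h1 _ _ _
  | HC =>
    refine (congrArg₂ (· - ·) (h2 _ _ _) (h2 _ _ _)).trans ?_
    exact add_sub_add_comm _ _ _ _
  | CH =>
    refine (congrArg₂ (· + ·) (h1 _ _ _) (h1 _ _ _)).trans ?_
    exact add_add_add_comm _ _ _ _
  | CC => exact h1 _ _ _
  | CCbar => exact h1 _ _ _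

section

variable (h : IsVertex .H J e s) (hl : e * a = a) (hr : a * e' = a) (hb : a * J = J * a)
include h hl hr hb

lemma qfun_mul_column (p : Quaternion ℝ) (m : Fin 2 → ℂ) :
    qfun J e s 1 * a * cfun J e' ((quatMatrix p).mulVec m 0) -
      qfun J e s qk * a * cfun J e' ((quatMatrix p).mulVec m 1) =
    qfun J e s p * (qfun J e s 1 * a * cfun J e' (m 0) - qfun J e s qk * a * cfun J e' (m 1)) := by
  have hr' : ∀ z, a * (e' * z) = a * z := fun z => by rw [← mul_assoc, hr]
  have hl' : ∀ z, e * (a * z) = a * z := fun z => by rw [← mul_assoc, hl]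
  have hb' : ∀ z, a * (J * z) = J * (a * z) := fun z => by rw [← mul_assoc, hb, mul_assoc]
  rw [qfun_one, qfun_k]
  simp only [cfun, qfun, quatMatrix, Matrix.mulVec, dotProduct, Fin.sum_univ_two,
    Matrix.of_apply, Matrix.cons_val', Matrix.cons_val_zero, Matrix.cons_val_one,
    Matrix.cons_val_fin_one, Complex.add_re, Complex.add_im, Complex.mul_re, Complex.mul_im,
    mul_add, add_mul, mul_sub, mul_smul_comm, smul_mul_assoc, mul_assoc, hl, hr, hl', hb',
    h.eJ_mul, h.JJ_mul, h.es_mul, h.sJ_mul, h.ssH_mul rfl, mul_neg, neg_neg, smul_neg]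
  module

end

section

variable (h : IsVertex .H J e' s') (hl : e * a = a) (hr : a * e' = a) (hb : a * J = J * a)
include h hl hr hb

lemma row_mul_qfun (p : Quaternion ℝ) (m : Fin 2 → ℂ) :
    cfun J e (Matrix.vecMul m (quatMatrix p) 0) * a * qfun J e' s' 1 +
      cfun J e (Matrix.vecMul m (quatMatrix p) 1) * a * qfun J e' s' qk =
    (cfun J e (m 0) * a * qfun J e' s' 1 + cfun J e (m 1) * a * qfun J e' s' qk) *
      qfun J e' s' p := by
  have hl' : ∀ z, e * (a * z) = a * z := fun z => by rw [← mul_assoc, hl]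
  have hb' : ∀ z, a * (J * z) = J * (a * z) := fun z => by rw [← mul_assoc, hb, mul_assoc]
  rw [qfun_one, qfun_k]
  simp only [cfun, qfun, quatMatrix, Matrix.vecMul, dotProduct, Fin.sum_univ_two,
    Matrix.of_apply, Matrix.cons_val', Matrix.cons_val_zero, Matrix.cons_val_one,
    Matrix.cons_val_fin_one, Complex.add_re, Complex.add_im, Complex.mul_re, Complex.mul_im,
    mul_add, add_mul, mul_smul_comm, smul_mul_assoc, mul_assoc, hl, hr, hl', hb',
    h.ee, h.eJ_mul, h.JJ_mul, h.es, h.sJ_mul, h.se, h.ssH rfl, mul_neg, neg_neg, smul_neg]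
  module

lemma quat_mul_qfun (hq : IsVertex .H J e s) (p m : Quaternion ℝ) :
    qfun J e s (m * p) * a * qfun J e' s' 1 - qfun J e s (m * p * qk) * a * qfun J e' s' qk =
    (qfun J e s m * a * qfun J e' s' 1 - qfun J e s (m * qk) * a * qfun J e' s' qk) *
      qfun J e' s' p := by
  have hl' : ∀ z, e * (a * z) = a * z := fun z => by rw [← mul_assoc, hl]
  have hr' : ∀ z, a * (e' * z) = a * z := fun z => by rw [← mul_assoc, hr]
  have hb' : ∀ z, a * (J * z) = J * (a * z) := fun z => by rw [← mul_assoc, hb, mul_assoc]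
  suffices hs : qfun J e s p * a * e' - qfun J e s p * s * a * s' =
      (a * e' - s * a * s') * qfun J e' s' p by
    simp only [qfun_one, hq.qfun_mul, qfun_k]
    calc _ = qfun J e s m * (qfun J e s p * a * e' - qfun J e s p * s * a * s') := by
            simp only [mul_sub, mul_assoc]
      _ = _ := by rw [hs]; simp only [mul_sub, sub_mul, mul_assoc]
  simp only [qfun, mul_add, add_mul, sub_mul, mul_smul_comm, smul_mul_assoc, mul_assoc, hl, hr,
    hl', hr', hb', h.ee, h.eJ_mul, h.JJ_mul, h.es, h.sJ_mul, h.se, h.ssH rfl, mul_neg, neg_neg, smul_neg,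
    hq.ee, hq.eJ_mul, hq.JJ_mul, hq.es_mul, hq.sJ_mul, hq.se, hq.ssH_mul rfl, neg_mul]
  module

end

lemma complex_mul_cfun (h : IsVertex x J e s) (h' : IsVertex y J e' s') (hl : e * a = a)
    (hr : a * e' = a) (hb : a * J = J * a) (p m : ℂ) :
    cfun J e (m * p) * a * cfun J e' 1 = cfun J e m * a * cfun J e' 1 * cfun J e' p := by
  have hb' : ∀ z, a * (J * z) = J * (a * z) := fun z => by rw [← mul_assoc, hb, mul_assoc]
  suffices hs : cfun J e p * a = a * cfun J e' p by
    rw [h.cfun_mul, mul_assoc (cfun J e m), hs, mul_assoc, mul_assoc, mul_assoc, ← h'.cfun_mul,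
      mul_assoc, ← h'.cfun_mul, mul_one, one_mul]
  simp only [cfun, mul_add, add_mul, mul_smul_comm, smul_mul_assoc, mul_assoc, hl, hr, hb']

lemma complex_mul_cfun_conj (h : IsVertex x J e s) (h' : IsVertex y J e' s') (hl : e * a = a)
    (hr : a * e' = a) (hb : a * J = -(J * a)) (p m : ℂ) :
    cfun J e (m * starRingEnd ℂ p) * a * cfun J e' 1 =
      cfun J e m * a * cfun J e' 1 * cfun J e' p := by
  have hb' : ∀ z, a * (J * z) = -(J * (a * z)) := fun z => by
    rw [← mul_assoc, hb, neg_mul, mul_assoc]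
  suffices hs : cfun J e (starRingEnd ℂ p) * a = a * cfun J e' p by
    rw [h.cfun_mul, mul_assoc (cfun J e m), hs, mul_assoc, mul_assoc, mul_assoc, ← h'.cfun_mul,
      mul_assoc, ← h'.cfun_mul, mul_one, one_mul]
  simp only [cfun, mul_add, add_mul, mul_smul_comm, smul_mul_assoc, mul_assoc, hl, hr, hb',
    Complex.conj_re, Complex.conj_im, smul_neg, neg_smul, neg_mul]

section

variable (h : IsVertex x J e s) (h' : IsVertex y J e' s') (hl : e * a = a)
  (hr : a * e' = a) (b : SimpleBimod x y) (hb : b.Balanced J a)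
include h h' hl hr hb

lemma arrfun_smul (p : x.carrier) (m : b.carrier) :
    b.arrfun (sandwich x y J e s e' s' a) (p • m) =
      vfun x J e s p * b.arrfun (sandwich x y J e s e' s' a) m := by
  have key : ∀ p p' q, sandwich x y J e s e' s' a (p * p') q =
      vfun x J e s p * sandwich x y J e s e' s' a p' q := fun p p' q => by
    simp only [sandwich, h.vfun_mul, mul_assoc]
  cases b with
  | RR => exact key p m _
  | HH =>
    have aux : ∀ m n : Quaternion ℝ, (m * n) * qk = m * (n * qk) := fun m n => mul_assoc _ _ _
    refine (congrArg₂ (· - ·) (key p m _)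
      ((congrArg (sandwich .H .H J e s e' s' a · qk) (aux p m)).trans (key _ _ _))).trans ?_
    exact (mul_sub _ _ _).symm
  | RC =>
    have aux : ∀ (p : ℝ) (m : ℂ), rfun e s 1 * a * cfun J e' (p • m) =
        rfun e s p * (rfun e s 1 * a * cfun J e' m) := fun p m => by
      rw [← mul_assoc, ← mul_assoc, ← h.rfun_mul, mul_comm, rfun_smul e s 1, cfun_smul,
        ← mul_one p, rfun_smul e s p]
      simp
    exact aux p m
  | CR => exact key p m _
  | RH =>
    have aux : ∀ (p : ℝ) (m : Quaternion ℝ), rfun e s 1 * a * qfun J e' s' (p • m) =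
        rfun e s p * (rfun e s 1 * a * qfun J e' s' m) := fun p m => by
      rw [← mul_assoc, ← mul_assoc, ← h.rfun_mul, mul_comm, rfun_smul e s 1, qfun_smul,
        ← mul_one p, rfun_smul e s p]
      simp
    exact aux p m
  | HR => exact key p m _
  | HC => exact qfun_mul_column h hl hr hb p m
  | CH =>
    refine (congrArg₂ (· + ·) (key _ _ _) (key _ _ _)).trans ?_
    exact (mul_add _ _ _).symm
  | CC => exact key p m _
  | CCbar => exact key p m _

lemma arrfun_op_smul (p : y.carrier) (m : b.carrier) :
    b.arrfun (sandwich x y J e s e' s' a) (MulOpposite.op p • m) =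
      b.arrfun (sandwich x y J e s e' s' a) m * vfun y J e' s' p := by
  have key : ∀ p q q', sandwich x y J e s e' s' a p (q * q') =
      sandwich x y J e s e' s' a p q * vfun y J e' s' q' := fun p p' q => by
    simp only [sandwich, h'.vfun_mul, mul_assoc]
  cases b with
  | RR =>
    have aux : ∀ (p : ℝ) (m : ℝ), rfun e s (m * p) * a * rfun e' s' 1 =
        rfun e s m * a * rfun e' s' 1 * rfun e' s' p := fun p m => by
      rw [mul_assoc _ (rfun e' s' 1), ← h'.rfun_mul, one_mul, mul_comm, rfun_smul e s p,
        ← mul_one p, rfun_smul e' s' p]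
      simp
    exact aux p m
  | HH => exact quat_mul_qfun h' hl hr hb h p m
  | RC => exact key _ m p
  | CR =>
    have aux : ∀ (p : ℝ) (m : ℂ), cfun J e (m * (p : ℂ)) * a * rfun e' s' 1 =
        cfun J e m * a * rfun e' s' 1 * rfun e' s' p := fun p m => by
      rw [mul_assoc _ (rfun e' s' 1), ← h'.rfun_mul, one_mul, mul_comm, ← Complex.real_smul,
        cfun_smul, ← mul_one p, rfun_smul e' s' p]
      simp
    exact aux p m
  | RH => exact key _ m p
  | HR =>
    have aux : ∀ (p : ℝ) (m : Quaternion ℝ), qfun J e s (m * algebraMap ℝ _ p) * a * rfun e' s' 1 =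
        qfun J e s m * a * rfun e' s' 1 * rfun e' s' p := fun p m => by
      rw [mul_assoc _ (rfun e' s' 1), ← h'.rfun_mul, one_mul, ← Algebra.commutes,
        ← Algebra.smul_def, qfun_smul, ← mul_one p, rfun_smul e' s' p]
      simp
    exact aux p m
  | HC =>
    have aux : ∀ (p : ℂ) (m : Fin 2 → ℂ), qfun J e s 1 * a * cfun J e' (m 0 * p) -
        qfun J e s qk * a * cfun J e' (m 1 * p) = (qfun J e s 1 * a * cfun J e' (m 0) -
        qfun J e s qk * a * cfun J e' (m 1)) * cfun J e' p := fun p m => by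
      simp only [h'.cfun_mul, sub_mul, mul_assoc]
    exact aux p m
  | CH => exact row_mul_qfun h' hl hr hb p m
  | CC => exact complex_mul_cfun h h' hl hr hb p m
  | CCbar => exact complex_mul_cfun_conj h h' hl hr hb p m

end

end

noncomputable instance : DecidableEq DivKind := Classical.decEq _

lemma SimpleBimod.balanced_std {B : Type*} [Ring B] (x y : DivKind) (tw : Bool) (J a : B)
    (h : a * J = if x = .C ∧ y = .C ∧ tw = true then -(J * a) else J * a) :
    (SimpleBimod.std x y tw).Balanced J a := by
  cases x <;> cases y <;> cases tw <;> simpa [SimpleBimod.std, SimpleBimod.Balanced] using h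

lemma SimpleBimod.Balanced.J_mul {B : Type*} [Ring B] {x y : DivKind} {b : SimpleBimod x y} {J a : B}
    (h : b.Balanced J a) : b.Balanced J (J * a) := by
  cases b with
  | CCbar => exact (mul_assoc _ _ _).trans ((congrArg (J * ·) h).trans (mul_neg _ _))
  | _ => exact (mul_assoc _ _ _).trans (congrArg (J * ·) h)

namespace ClannishDatum

variable (D : ClannishDatum.{u})

/-! ### Special loops and kinds -/

lemma eq_of_special {l l' : D.Q.E} (h : l ∈ D.special) (h' : l' ∈ D.special)
    (e : D.Q.s l = D.Q.s l') : l = l' := D.unique l h l' h' e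

open Classical in
/-- The special loop at `v` in `ℂ_σ Q/⟨S⟩`, and `0` if there is none. -/
noncomputable def spl (v : D.Q.V) : D.LoopAlg :=
  if h : ∃ l ∈ D.special, D.Q.s l = v then D.ar h.choose else 0

lemma spl_of_special {l : D.Q.E} (h : l ∈ D.special) : D.spl (D.Q.s l) = D.ar l := by
  have h' : ∃ l' ∈ D.special, D.Q.s l' = D.Q.s l := ⟨l, h, rfl⟩
  rw [spl, dif_pos h', D.eq_of_special h'.choose_spec.1 h h'.choose_spec.2]

lemma kind_eq_R_iff (v : D.Q.V) : D.kind v = .R ↔ ∃ l ∈ D.SR, D.Q.s l = v := by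
  unfold kind; split_ifs <;> simp_all

lemma kind_eq_H_iff (v : D.Q.V) : D.kind v = .H ↔ ∃ l ∈ D.SH, D.Q.s l = v := by
  unfold kind
  split_ifs with h1 h2
  · simp only [reduceCtorEq, false_iff]
    rintro ⟨l, hl, rfl⟩
    obtain ⟨l', hl', e⟩ := h1
    rw [D.eq_of_special (Or.inl hl') (Or.inr hl) e] at hl'
    exact Set.disjoint_left.mp D.disjoint hl' hl
  · simpa using h2
  · simpa using h2

lemma kind_ne_C_iff (v : D.Q.V) : D.kind v ≠ .C ↔ ∃ l ∈ D.special, D.Q.s l = v := by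
  constructor
  · intro h
    cases hk : D.kind v with
    | R =>
      obtain ⟨l, hl, e⟩ := (D.kind_eq_R_iff v).mp hk
      exact ⟨l, Or.inl hl, e⟩
    | C => exact absurd hk h
    | H =>
      obtain ⟨l, hl, e⟩ := (D.kind_eq_H_iff v).mp hk
      exact ⟨l, Or.inr hl, e⟩
  · rintro ⟨l, hl | hl, e⟩
    · rw [(D.kind_eq_R_iff v).mpr ⟨l, hl, e⟩]; simp
    · rw [(D.kind_eq_H_iff v).mpr ⟨l, hl, e⟩]; simp

lemma conj_ne_refl : Complex.conjAe ≠ AlgEquiv.refl := fun h => by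
  have := congrArg (fun f : ℂ ≃ₐ[ℝ] ℂ => (f Complex.I).im) h
  norm_num at this

lemma isVertex (v : D.Q.V) : IsVertex (D.kind v) D.im (D.ve v) (D.spl v) := by
  by_cases h : ∃ l ∈ D.special, D.Q.s l = v
  · obtain ⟨l, hl, rfl⟩ := h
    rw [D.spl_of_special hl]
    refine ⟨D.im_mul_im, D.ve_mul_self _, D.ve_mul_im _, ?_, D.ar_mul_ve l, ?_, ?_, ?_⟩
    · rw [D.isLoop l hl]; exact D.ve_mul_ar l
    · exact D.ar_mul_im_of_ne l (by rw [D.twist l hl]; exact conj_ne_refl)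
    · intro hR
      obtain ⟨l', hl', e⟩ := (D.kind_eq_R_iff _).mp hR
      obtain rfl := D.eq_of_special (Or.inl hl') hl e
      exact D.ar_mul_self_of_mem_SR hl'
    · intro hH
      obtain ⟨l', hl', e⟩ := (D.kind_eq_H_iff _).mp hH
      obtain rfl := D.eq_of_special (Or.inr hl') hl e
      exact D.ar_mul_self_of_mem_SH hl'
  · have hs : D.spl v = 0 := by rw [spl, dif_neg h]
    have hC : D.kind v = .C := by
      by_contra hC; exact h ((D.kind_ne_C_iff v).mp hC)
    rw [hs, hC]
    exact ⟨D.im_mul_im, D.ve_mul_self _, D.ve_mul_im _, by simp, by simp, by simp, by simp, by simp⟩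

/-- The embedding of `M(v)` in `ℂ_σ Q/⟨S⟩`. -/
noncomputable def vmap (v : D.Q.V) : (D.kind v).carrier → D.LoopAlg :=
  vfun (D.kind v) D.im (D.ve v) (D.spl v)

lemma vfun_one {B : Type*} [Ring B] [Algebra ℝ B] (x : DivKind) (J e s : B) :
    vfun x J e s 1 = if x = .R then (2⁻¹ : ℝ) • (e + s) else e := by
  cases x with
  | R => rw [if_pos rfl]; exact rfun_one e s
  | C => rw [if_neg (by simp)]; exact cfun_one J e
  | H => rw [if_neg (by simp)]; exact qfun_one J e s

lemma vmap_one (v : D.Q.V) : D.vmap v 1 = D.epsV v := by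
  rw [vmap, vfun_one, epsV]
  by_cases h : ∃ l ∈ D.SR, D.Q.s l = v
  · rw [if_pos ((D.kind_eq_R_iff v).mpr h), dif_pos h]
    have h2 := D.spl_of_special (Or.inl h.choose_spec.1)
    rw [h.choose_spec.2] at h2
    rw [h2]; rfl
  · rw [if_neg (fun hk => h ((D.kind_eq_R_iff v).mp hk)), dif_neg h]; rfl

/-! ### Untwisting the arrows -/

/-- The arrow is untwisted by the special loop at its end. -/
def FlipT (α : D.Q.E) : Prop := D.σ α ≠ AlgEquiv.refl ∧ D.kind (D.Q.t α) ≠ .C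

/-- The arrow is untwisted by the special loop at its start. -/
def FlipS (α : D.Q.E) : Prop :=
  D.σ α ≠ AlgEquiv.refl ∧ D.kind (D.Q.t α) = .C ∧ D.kind (D.Q.s α) ≠ .C

open Classical in
/-- The factor at the end of `α` used for untwisting. -/
noncomputable def flipT (α : D.Q.E) : D.LoopAlg :=
  if D.FlipT α then D.spl (D.Q.t α) else D.ve (D.Q.t α)

open Classical in
/-- The factor at the start of `α` used for untwisting. -/
noncomputable def flipS (α : D.Q.E) : D.LoopAlg :=
  if D.FlipS α then D.spl (D.Q.s α) else D.ve (D.Q.s α)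

/-- The arrow `α`, multiplied with a special loop at one end so that it commutes with `𝐢`
whenever one of its ends has a special loop. -/
noncomputable def unt (α : D.Q.E) : D.LoopAlg := D.flipT α * D.ar α * D.flipS α

lemma ve_mul_flipT (α : D.Q.E) : D.ve (D.Q.t α) * D.flipT α = D.flipT α := by
  unfold flipT; split_ifs
  · exact (D.isVertex _).es
  · exact (D.isVertex _).ee

lemma flipS_mul_ve (α : D.Q.E) : D.flipS α * D.ve (D.Q.s α) = D.flipS α := by
  unfold flipS; split_ifs
  · exact (D.isVertex _).se
  · exact (D.isVertex _).ee

lemma ve_mul_unt (α : D.Q.E) : D.ve (D.Q.t α) * D.unt α = D.unt α := by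
  rw [unt, ← mul_assoc, ← mul_assoc, ve_mul_flipT]

lemma unt_mul_ve (α : D.Q.E) : D.unt α * D.ve (D.Q.s α) = D.unt α := by
  rw [unt, mul_assoc, flipS_mul_ve]

/-- The simple bimodule at an arrow. -/
noncomputable abbrev bim (α : D.Q.E) : SimpleBimod (D.kind (D.Q.t α)) (D.kind (D.Q.s α)) := by
  classical exact SimpleBimod.std _ _ (decide (D.σ α ≠ AlgEquiv.refl))

lemma balanced_unt (α : D.Q.E) : (D.bim α).Balanced D.im (D.unt α) := by
  refine SimpleBimod.balanced_std _ _ _ _ _ ?_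
  have ht := D.isVertex (D.Q.t α)
  have hs := D.isVertex (D.Q.s α)
  unfold unt flipT flipS FlipT FlipS
  by_cases hσ : D.σ α = AlgEquiv.refl
  · simp [hσ, mul_assoc, D.ve_mul_im, D.ar_mul_ve, D.ve_mul_ar, D.ar_mul_im α hσ, ht.eJ_mul]
  · by_cases h1 : D.kind (D.Q.t α) = .C
    · by_cases h2 : D.kind (D.Q.s α) = .C
      · simp only [hσ, h1, h2, ne_eq, not_true_eq_false, and_false, if_false, decide_true, decide_false, not_false_eq_true,
          and_self, if_true]
        rw [D.ve_mul_ar, D.ar_mul_ve, D.ar_mul_im_of_ne α hσ]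
      · simp only [hσ, h1, h2, ne_eq, not_true_eq_false, and_false, if_false, decide_true, decide_false, not_false_eq_true,
          and_self, if_true, false_and]
        rw [D.ve_mul_ar, mul_assoc, hs.sJ, mul_neg, ← mul_assoc, D.ar_mul_im_of_ne α hσ, neg_mul,
          neg_neg, mul_assoc]
    · simp only [hσ, h1, ne_eq, not_true_eq_false, and_false, if_false, decide_true, decide_false, not_false_eq_true,
        and_self, if_true, false_and]
      rw [mul_assoc, mul_assoc, D.ve_mul_im, ← mul_assoc (D.ar α), D.ar_mul_im_of_ne α hσ, neg_mul,
        mul_neg, mul_assoc, D.ar_mul_ve, ht.sJ_mul, neg_neg, mul_assoc, D.ar_mul_ve]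

/-- The image of the generator of the bimodule at an arrow of `Q^b`. -/
noncomputable def bunt (p : D.BasicArrow) : D.LoopAlg :=
  if p.1.2 then D.im * D.unt p.1.1 else D.unt p.1.1

lemma ve_mul_bunt (p : D.BasicArrow) : D.ve (D.Q.t p.1.1) * D.bunt p = D.bunt p := by
  unfold bunt; split_ifs
  · rw [← mul_assoc, D.ve_mul_im, mul_assoc, D.ve_mul_unt]
  · exact D.ve_mul_unt _

lemma bunt_mul_ve (p : D.BasicArrow) : D.bunt p * D.ve (D.Q.s p.1.1) = D.bunt p := by
  unfold bunt; split_ifs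
  · rw [mul_assoc, D.unt_mul_ve]
  · exact D.unt_mul_ve _

lemma balanced_bunt (p : D.BasicArrow) : (D.bim p.1.1).Balanced D.im (D.bunt p) := by
  unfold bunt; split_ifs
  · exact (D.balanced_unt _).J_mul
  · exact D.balanced_unt _

/-- `p * a * q`, for `p` and `q` in the division rings at the ends of `α`. -/
noncomputable def sand (α : D.Q.E) (a : D.LoopAlg) :
    (D.kind (D.Q.t α)).carrier → (D.kind (D.Q.s α)).carrier → D.LoopAlg :=
  sandwich _ _ D.im (D.ve (D.Q.t α)) (D.spl (D.Q.t α)) (D.ve (D.Q.s α)) (D.spl (D.Q.s α)) a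

/-- The embedding of `M(α)` in `ℂ_σ Q/⟨S⟩`. -/
noncomputable def amap (p : D.BasicArrow) : (D.bim p.1.1).carrier →+ D.LoopAlg :=
  AddMonoidHom.mk' ((D.bim p.1.1).arrfun (D.sand p.1.1 (D.bunt p))) (arrfun_add (D.bim p.1.1))

lemma exists_Psi : ∃ Ψ : D.basic.T →ₙₐ[ℝ] D.LoopAlg,
    (∀ (i : D.Q.V) (a : (D.kind i).carrier), Ψ (D.basic.ofVert i a) = D.vmap i a) ∧
    ∀ (p : D.BasicArrow) (m : (D.bim p.1.1).carrier), Ψ (D.basic.ofArr p m) = D.amap p m := by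
  refine D.basic.exists_lift (fun i => (D.isVertex i).hom) (fun p => D.amap p) ?_ ?_ ?_
  · intro i j hij
    change D.vmap i 1 * D.vmap j 1 = 0
    have key : ∀ v, D.ve v * D.vmap v 1 = D.vmap v 1 ∧ D.vmap v 1 * D.ve v = D.vmap v 1 := by
      intro v
      have h := D.isVertex v
      rw [vmap, vfun_one]; split_ifs
      · simp only [mul_add, add_mul, mul_smul_comm, smul_mul_assoc, h.ee, h.es, h.se, and_self]
      · exact ⟨h.ee, h.ee⟩
    rw [← (key i).2, ← (key j).1, mul_assoc, ← mul_assoc (D.ve i), D.ve_mul_of_ne hij, zero_mul,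
      mul_zero]
  · intro p a m
    exact arrfun_smul (D.isVertex _) (D.isVertex _) (D.ve_mul_bunt p) (D.bunt_mul_ve p) _
      (D.balanced_bunt p) a m
  · intro p a m
    exact arrfun_op_smul (D.isVertex _) (D.isVertex _) (D.ve_mul_bunt p) (D.bunt_mul_ve p) _
      (D.balanced_bunt p) a m

/-- The embedding of `T(Q^b, M)` in `ℂ_σ Q/⟨S⟩`. -/
noncomputable def Psi : D.basic.T →ₙₐ[ℝ] D.LoopAlg := D.exists_Psi.choose

lemma Psi_ofVert (i : D.Q.V) (a : (D.kind i).carrier) : D.Psi (D.basic.ofVert i a) = D.vmap i a :=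
  D.exists_Psi.choose_spec.1 i a

lemma Psi_ofArr (p : D.BasicArrow) (m : (D.bim p.1.1).carrier) :
    D.Psi (D.basic.ofArr p m) = (D.bim p.1.1).arrfun (D.sand p.1.1 (D.bunt p)) m :=
  D.exists_Psi.choose_spec.2 p m

lemma Psi_one : D.Psi 1 = D.eps := by
  rw [D.basic.one_eq_sum, map_sum, eps]
  exact Finset.sum_congr rfl fun i _ => (D.Psi_ofVert i 1).trans (D.vmap_one i)

end ClannishDatum

/-! ### Two by two matrices at a vertex -/

/-- The square root of `-1` in `ℂ` and `ℍ`. -/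
noncomputable def DivKind.J : (x : DivKind) → x.carrier
  | .R => (0 : ℝ)
  | .C => Complex.I
  | .H => qj

/-- The quaternion unit `𝐤` in `ℍ`. -/
noncomputable def DivKind.K : (x : DivKind) → x.carrier
  | .R => (0 : ℝ)
  | .C => (0 : ℂ)
  | .H => qk

@[simp] lemma re_qj : qj.re = 0 := rfl
@[simp] lemma imI_qj : qj.imI = 1 := rfl
@[simp] lemma imJ_qj : qj.imJ = 0 := rfl
@[simp] lemma imK_qj : qj.imK = 0 := rfl
@[simp] lemma re_qk : qk.re = 0 := rfl
@[simp] lemma imI_qk : qk.imI = 0 := rfl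
@[simp] lemma imJ_qk : qk.imJ = 1 := rfl
@[simp] lemma imK_qk : qk.imK = 0 := rfl

lemma quaternion_one : (1 : Quaternion ℝ).re = 1 ∧ (1 : Quaternion ℝ).imI = 0 ∧
    (1 : Quaternion ℝ).imJ = 0 ∧ (1 : Quaternion ℝ).imK = 0 := ⟨rfl, rfl, rfl, rfl⟩

lemma qj_mul_qj : qj * qj = -1 := by
  ext <;> simp [Quaternion.re_mul, Quaternion.imI_mul, Quaternion.imJ_mul, Quaternion.imK_mul,
    quaternion_one]

lemma qk_mul_qk : qk * qk = -1 := by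
  ext <;> simp [Quaternion.re_mul, Quaternion.imI_mul, Quaternion.imJ_mul, Quaternion.imK_mul,
    quaternion_one]

lemma qk_mul_qj : qk * qj = -(qj * qk) := by
  ext <;> simp [Quaternion.re_mul, Quaternion.imI_mul, Quaternion.imJ_mul, Quaternion.imK_mul,
    quaternion_one]

lemma quaternion_eq (a : Quaternion ℝ) :
    a = a.re • (1 : Quaternion ℝ) + a.imI • qj + a.imJ • qk + a.imK • (qj * qk) := by
  ext <;> simp [Quaternion.re_mul, Quaternion.imI_mul, Quaternion.imJ_mul, Quaternion.imK_mul,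
    quaternion_one]

lemma quatMatrix_qj : quatMatrix qj = !![Complex.I, 0; 0, -Complex.I] := by
  change quatMatrix ⟨0, 1, 0, 0⟩ = _
  ext i j
  fin_cases i <;> fin_cases j <;> apply Complex.ext <;> simp [quatMatrix]

lemma quatMatrix_qk : quatMatrix qk = !![0, 1; -1, 0] := by
  change quatMatrix ⟨0, 0, 1, 0⟩ = _
  ext i j
  fin_cases i <;> fin_cases j <;> apply Complex.ext <;> simp [quatMatrix]

lemma DivKind.J_mul_J {x : DivKind} (hx : x ≠ .R) : x.J * x.J = -1 := by
  cases x with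
  | R => exact absurd rfl hx
  | C => exact Complex.I_mul_I
  | H => exact qj_mul_qj

lemma DivKind.H_K_mul_K : DivKind.H.K * DivKind.H.K = -1 := qk_mul_qk

lemma DivKind.H_K_mul_J : DivKind.H.K * DivKind.H.J = -(DivKind.H.J * DivKind.H.K) := qk_mul_qj

/-- The matrix of the trivial path. -/
noncomputable def omat : (x : DivKind) → Matrix (Fin 2) (Fin 2) x.carrier
  | .R => !![1, 0; 0, 1]
  | .C => !![1, 0; 0, 0]
  | .H => !![1, 0; 0, 0]

/-- The matrix of the scalar `𝐢`. -/
noncomputable def imat : (x : DivKind) → Matrix (Fin 2) (Fin 2) x.carrier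
  | .R => !![0, -1; 1, 0]
  | .C => !![DivKind.J .C, 0; 0, 0]
  | .H => !![DivKind.J .H, 0; 0, 0]

/-- The matrix of the special loop. -/
noncomputable def smat : (x : DivKind) → Matrix (Fin 2) (Fin 2) x.carrier
  | .R => !![1, 0; 0, -1]
  | .C => 0
  | .H => !![DivKind.K .H, 0; 0, 0]

/-- The inverse of the matrix of the special loop. -/
noncomputable def sinv : (x : DivKind) → Matrix (Fin 2) (Fin 2) x.carrier
  | .R => smat .R
  | .C => 0
  | .H => -smat .H

lemma matrix_two_ext {R : Type*} {A B : Matrix (Fin 2) (Fin 2) R} (h00 : A 0 0 = B 0 0)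
    (h01 : A 0 1 = B 0 1) (h10 : A 1 0 = B 1 0) (h11 : A 1 1 = B 1 1) : A = B := by
  ext i j
  fin_cases i <;> fin_cases j <;> assumption

section Mat

variable (x : DivKind)

lemma omat_mul_omat : omat x * omat x = omat x := by
  cases x <;> apply matrix_two_ext <;> simp [Matrix.mul_apply, Fin.sum_univ_two, omat]

lemma omat_mul_imat : omat x * imat x = imat x := by
  cases x <;> apply matrix_two_ext <;> simp [Matrix.mul_apply, Fin.sum_univ_two, omat, imat]

lemma imat_mul_omat : imat x * omat x = imat x := by
  cases x <;> apply matrix_two_ext <;> simp [Matrix.mul_apply, Fin.sum_univ_two, omat, imat]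

lemma imat_mul_imat : imat x * imat x = -omat x := by
  cases x <;> apply matrix_two_ext <;> simp [Matrix.mul_apply, Fin.sum_univ_two, omat, imat, DivKind.J_mul_J]

lemma omat_mul_smat : omat x * smat x = smat x := by
  cases x <;> apply matrix_two_ext <;> simp [Matrix.mul_apply, Fin.sum_univ_two, omat, smat]

lemma smat_mul_omat : smat x * omat x = smat x := by
  cases x <;> apply matrix_two_ext <;> simp [Matrix.mul_apply, Fin.sum_univ_two, omat, smat]

lemma smat_mul_imat : smat x * imat x = -(imat x * smat x) := by
  cases x <;> apply matrix_two_ext <;> simp [Matrix.mul_apply, Fin.sum_univ_two, smat, imat, DivKind.H_K_mul_J]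

lemma smat_mul_smat_R : smat .R * smat .R = omat .R := by
  apply matrix_two_ext <;> simp [Matrix.mul_apply, Fin.sum_univ_two, smat, omat]

lemma smat_mul_smat_H : smat .H * smat .H = -omat .H := by
  apply matrix_two_ext <;> simp [Matrix.mul_apply, Fin.sum_univ_two, smat, omat, DivKind.H_K_mul_K]

lemma omat_mul_sinv : omat x * sinv x = sinv x := by
  cases x <;> apply matrix_two_ext <;> simp [Matrix.mul_apply, Fin.sum_univ_two, omat, sinv, smat]

lemma sinv_mul_omat : sinv x * omat x = sinv x := by
  cases x <;> apply matrix_two_ext <;> simp [Matrix.mul_apply, Fin.sum_univ_two, omat, sinv, smat]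

lemma sinv_mul_imat : sinv x * imat x = -(imat x * sinv x) := by
  cases x <;> simp [sinv, smat_mul_imat]

lemma smat_mul_sinv (hx : x ≠ .C) : smat x * sinv x = omat x := by
  cases x <;> simp_all [sinv, smat_mul_smat_R, smat_mul_smat_H]

lemma sinv_mul_smat (hx : x ≠ .C) : sinv x * smat x = omat x := by
  cases x <;> simp_all [sinv, smat_mul_smat_R, smat_mul_smat_H]

lemma vfun_mat (a : x.carrier) :
    vfun x (imat x) (omat x) (smat x) a = !![a, 0; 0, 0] := by
  cases x with
  | R =>
    have aux : ∀ a : ℝ, rfun (!![1, 0; 0, 1] : Matrix (Fin 2) (Fin 2) ℝ) !![1, 0; 0, -1] a =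
        !![a, 0; 0, 0] := fun a => by
      ext i j; fin_cases i <;> fin_cases j <;> simp [rfun] <;> ring
    exact aux a
  | C =>
    have aux : ∀ a : ℂ, cfun (!![Complex.I, 0; 0, 0] : Matrix (Fin 2) (Fin 2) ℂ) !![1, 0; 0, 0] a =
        !![a, 0; 0, 0] := fun a => by
      ext i j; fin_cases i <;> fin_cases j <;> simp [cfun, Complex.re_add_im]
    exact aux a
  | H =>
    have aux : ∀ a : Quaternion ℝ, qfun (!![qj, 0; 0, 0] : Matrix (Fin 2) (Fin 2) (Quaternion ℝ))
        !![1, 0; 0, 0] !![qk, 0; 0, 0] a = !![a, 0; 0, 0] := fun a => by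
      apply matrix_two_ext <;> simp [qfun]
      exact (quaternion_eq a).symm
    exact aux a

end Mat

/-! ### Two by two matrices at an arrow -/

section ArrowMat

variable {x y : DivKind} {N : Type*} [AddCommGroup N] [Module x.carrier N] [Module y.carrierᵐᵒᵖ N]

/-- Matrices over a left module, multiplied with matrices over the ring. -/
noncomputable def lmul (A : Matrix (Fin 2) (Fin 2) x.carrier) (m : Matrix (Fin 2) (Fin 2) N) :
    Matrix (Fin 2) (Fin 2) N :=
  Matrix.of fun p q => ∑ r, A p r • m r q

/-- Matrices over a right module, multiplied with matrices over the ring. -/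
noncomputable def rmul (m : Matrix (Fin 2) (Fin 2) N) (A : Matrix (Fin 2) (Fin 2) y.carrier) :
    Matrix (Fin 2) (Fin 2) N :=
  Matrix.of fun p q => ∑ r, MulOpposite.op (A r q) • m p r

end ArrowMat

/-- The standard generator of a simple bimodule. -/
noncomputable def SimpleBimod.gen : {x y : DivKind} → (b : SimpleBimod x y) → b.carrier
  | _, _, .HC => elt .HC .v₁
  | _, _, .CH => elt .CH .v₁
  | _, _, b => b.elt .one

lemma SimpleBimod.J_smul_gen {x y : DivKind} (b : SimpleBimod x y) (hx : x ≠ .R) (hy : y ≠ .R)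
    (hb : ¬ (x = .C ∧ y = .C)) : x.J • b.gen = MulOpposite.op y.J • b.gen := by
  cases b with
  | RR | RC | RH => exact absurd rfl hx
  | CR | HR => exact absurd rfl hy
  | CC | CCbar => exact absurd ⟨rfl, rfl⟩ hb
  | HH => exact ((mul_one qj).trans (one_mul qj).symm :)
  | HC =>
    have aux : (quatMatrix qj).mulVec ![1, 0] = fun i => ![1, 0] i * Complex.I := by
      ext i; fin_cases i <;> simp [quatMatrix_qj]
    exact aux
  | CH =>
    have aux : Matrix.vecMul ![1, 0] (quatMatrix qj) = fun i => Complex.I * ![1, 0] i := by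
      ext i; fin_cases i <;> simp [quatMatrix_qj]
    exact aux.symm

/-- The real number one half in the division ring. -/
noncomputable def DivKind.half (x : DivKind) : x.carrier := algebraMap ℝ _ 2⁻¹

/-- The coefficients of the image of an untwisted arrow `α`: at the arrow `α` of `Q^b` (`false`)
and at the arrow `α^𝐢` (`true`). -/
noncomputable def amat : {x y : DivKind} → (b : SimpleBimod x y) → Bool →
    Matrix (Fin 2) (Fin 2) b.carrier
  | _, _, .RR, false => !![SimpleBimod.gen .RR, 0; 0, SimpleBimod.gen .RR]
  | _, _, .RR, true => !![0, SimpleBimod.gen .RR; -SimpleBimod.gen .RR, 0]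
  | _, _, .HH, false => !![DivKind.half .H • SimpleBimod.gen .HH, 0; 0, 0]
  | _, _, .HH, true => !![-(DivKind.half .H • DivKind.J .H • SimpleBimod.gen .HH), 0; 0, 0]
  | .R, .C, b, false => !![b.gen, 0; -(MulOpposite.op (DivKind.J .C) • b.gen), 0]
  | .R, .H, b, false => !![b.gen, 0; -(MulOpposite.op (DivKind.J .H) • b.gen), 0]
  | .C, .R, b, false => !![b.gen, DivKind.J .C • b.gen; 0, 0]
  | .H, .R, b, false => !![b.gen, DivKind.J .H • b.gen; 0, 0]
  | .H, .C, b, false => !![b.gen, 0; 0, 0]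
  | .C, .H, b, false => !![b.gen, 0; 0, 0]
  | .C, .C, b, false => !![b.gen, 0; 0, 0]
  | _, _, _, _ => 0

lemma lmul_omat {x y : DivKind} (b : SimpleBimod x y) (i : Bool) :
    lmul (omat x) (amat b i) = amat b i := by
  ext p q
  cases b <;> cases i <;> fin_cases p <;> fin_cases q <;>
    simp [lmul, omat, amat, Fin.sum_univ_two]

lemma rmul_omat {x y : DivKind} (b : SimpleBimod x y) (i : Bool) :
    rmul (amat b i) (omat y) = amat b i := by
  ext p q
  cases b <;> cases i <;> fin_cases p <;> fin_cases q <;>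
    simp [rmul, omat, amat, Fin.sum_univ_two]

/-- The sign with which `J` commutes with the generator. -/
def SimpleBimod.sgn : {x y : DivKind} → SimpleBimod x y → ℤ
  | _, _, .CCbar => -1
  | _, _, _ => 1

lemma lmul_imat {x y : DivKind} (b : SimpleBimod x y) (i : Bool) :
    lmul (imat x) (amat b i) = b.sgn • rmul (amat b i) (imat y) := by
  have hC : DivKind.J .C * DivKind.J .C = -1 := DivKind.J_mul_J (by simp)
  have hH : DivKind.J .H * DivKind.J .H = -1 := DivKind.J_mul_J (by simp)
  have h1 := fun h1 h2 h3 => b.J_smul_gen h1 h2 h3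
  have h2 : ∀ m : (SimpleBimod.CC).carrier,
      MulOpposite.op (DivKind.J .C) • m = DivKind.J .C • m := fun m => by
    have aux : ∀ m : ℂ, m * Complex.I = Complex.I * m := fun m => mul_comm _ _
    exact aux m
  have h3 : ∀ m : (SimpleBimod.CCbar).carrier,
      MulOpposite.op (DivKind.J .C) • m = -(DivKind.J .C • m) := fun m => by
    have aux : ∀ m : ℂ, m * (starRingEnd ℂ Complex.I) = -(Complex.I * m) := fun m => by
      rw [Complex.conj_I]; ring
    exact aux m
  have hc : DivKind.J .H * DivKind.half .H = DivKind.half .H * DivKind.J .H :=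
    (Algebra.commutes _ _).symm
  have h4 : MulOpposite.op (DivKind.J .H) • (SimpleBimod.HH).gen = DivKind.J .H • SimpleBimod.HH.gen :=
    (SimpleBimod.HH.J_smul_gen (by simp) (by simp) (by simp)).symm
  cases b <;> cases i <;> apply matrix_two_ext <;>
    simp [lmul, rmul, imat, amat, Fin.sum_univ_two, smul_smul, SimpleBimod.sgn, hC, hH,
      ← MulOpposite.op_mul] <;> simp_all [smul_comm]
  · rw [← smul_comm, ← h1, mul_smul]
  · rw [← smul_comm, ← h1, mul_smul, mul_smul, smul_smul DivKind.H.J, hc, mul_smul]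

/-- The bimodules at pairs of parallel arrows. -/
def DivKind.Doubled (x y : DivKind) : Prop := y = x ∧ y ≠ .C

/-- The coefficients of the image of the untwisted arrow (`j = false`) and of its product with `𝐢`
(`j = true`). -/
noncomputable def bmat {x y : DivKind} (b : SimpleBimod x y) (j i : Bool) :
    Matrix (Fin 2) (Fin 2) b.carrier :=
  if j then lmul (imat x) (amat b i) else amat b i

lemma half_mul_quaternion (m : Quaternion ℝ) :
    m * (algebraMap ℝ _ 2⁻¹ * 1 * 1) - m * qk * (algebraMap ℝ _ 2⁻¹ * 1 * qk) = m := by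
  rw [mul_one, mul_one, mul_assoc m qk, Algebra.commutes, ← mul_assoc qk, qk_mul_qk,
    ← mul_sub, neg_mul, one_mul, sub_neg_eq_add, ← map_add]
  norm_num

lemma half_mul_quaternion_J (m : Quaternion ℝ) :
    m * (-(algebraMap ℝ _ 2⁻¹ * (qj * 1)) * 1) -
      m * qk * (-(algebraMap ℝ _ 2⁻¹ * (qj * 1)) * qk) = 0 := by
  have h2 : qk * (qj * qk) = qj := by
    rw [← mul_assoc, qk_mul_qj, neg_mul, mul_assoc, qk_mul_qk, mul_neg, mul_one, neg_neg]
  rw [mul_one, mul_one, mul_assoc m, neg_mul, mul_neg qk, mul_assoc (algebraMap ℝ _ _),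
    ← mul_assoc qk (algebraMap ℝ _ _), ← Algebra.commutes, mul_assoc _ qk, h2, sub_self]

lemma bmat_RR_true (i : Bool) :
    bmat .RR true i 0 0 = if i then SimpleBimod.gen .RR else 0 := by
  cases i <;> simp [bmat, lmul, imat, Fin.sum_univ_two, amat]

lemma bmat_HH_true (i : Bool) :
    bmat .HH true i 0 0 = if i then amat .HH false 0 0 else -amat .HH true 0 0 := by
  have hc : DivKind.J .H * DivKind.half .H = DivKind.half .H * DivKind.J .H :=
    (Algebra.commutes _ _).symm
  have hJ : DivKind.J .H * DivKind.J .H = -1 := DivKind.J_mul_J (by simp)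
  cases i <;> simp [bmat, lmul, imat, Fin.sum_univ_two, amat, smul_smul, hc]
  rw [← mul_assoc, hc, mul_assoc, hJ, mul_neg, mul_one, neg_smul, neg_neg]

lemma arrfun_zero {N : Type*} [AddCommGroup N] {x y : DivKind} (b : SimpleBimod x y)
    (m : b.carrier) : b.arrfun (fun _ _ => (0 : N)) m = 0 := by
  cases b with
  | HH => exact sub_self _
  | HC => exact sub_self _
  | CH => exact add_zero _
  | _ => rfl

lemma arrfun_gen {x y : DivKind} (b : SimpleBimod x y) (hb : x = .H → y ≠ .H) (m : b.carrier) :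
    b.arrfun (fun p q => p • MulOpposite.op q • b.gen) m = m := by
  cases b with
  | HH => exact absurd rfl (hb rfl)
  | RR =>
    have aux : ∀ m : ℝ, m * (1 * 1) = m := fun m => by simp
    exact aux m
  | RC =>
    have aux : ∀ m : ℂ, (1 : ℝ) • (1 * m) = m := fun m => by simp
    exact aux m
  | CR =>
    have aux : ∀ m : ℂ, m * (1 * ((1 : ℝ) : ℂ)) = m := fun m => by simp
    exact aux m
  | RH =>
    have aux : ∀ m : Quaternion ℝ, (1 : ℝ) • (1 * m) = m := fun m => by simp
    exact aux m
  | HR =>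
    have aux : ∀ m : Quaternion ℝ, m * (1 * algebraMap ℝ (Quaternion ℝ) 1) = m := fun m => by simp
    exact aux m
  | CC =>
    have aux : ∀ m : ℂ, m * (1 * 1) = m := fun m => by simp
    exact aux m
  | CCbar =>
    have aux : ∀ m : ℂ, m * (1 * starRingEnd ℂ 1) = m := fun m => by simp
    exact aux m
  | HC =>
    have aux : ∀ m : Fin 2 → ℂ, (quatHom 1).mulVec (fun i => ![1, 0] i * m 0) -
        (quatMatrix qk).mulVec (fun i => ![1, 0] i * m 1) = m := fun m => by
      rw [map_one, quatMatrix_qk]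
      ext i; fin_cases i <;> simp [Matrix.mulVec, dotProduct, Fin.sum_univ_two]
    exact aux m
  | CH =>
    have aux : ∀ m : Fin 2 → ℂ, m 0 • Matrix.vecMul ![1, 0] (quatHom 1) +
        m 1 • Matrix.vecMul ![1, 0] (quatMatrix qk) = m := fun m => by
      rw [map_one, quatMatrix_qk]
      ext i; fin_cases i <;> simp [Matrix.vecMul, dotProduct, Fin.sum_univ_two]
    exact aux m

lemma arrfun_half (m : (SimpleBimod.HH).carrier) :
    SimpleBimod.HH.arrfun (fun p q => p • MulOpposite.op q • amat .HH false 0 0) m = m :=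
  half_mul_quaternion m

lemma arrfun_half_J (m : (SimpleBimod.HH).carrier) :
    SimpleBimod.HH.arrfun (fun p q => p • MulOpposite.op q • amat .HH true 0 0) m = 0 :=
  half_mul_quaternion_J m

lemma arrfun_bmat {x y : DivKind} (b : SimpleBimod x y) (j i : Bool)
    (hj : j = true → DivKind.Doubled x y) (m : b.carrier) :
    b.arrfun (fun p q => p • MulOpposite.op q • bmat b j i 0 0) m = if i = j then m else 0 := by
  have key : ∀ z, bmat b j i 0 0 = z →
      b.arrfun (fun p q => p • MulOpposite.op q • z) m = (if i = j then m else 0) →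
      b.arrfun (fun p q => p • MulOpposite.op q • bmat b j i 0 0) m = if i = j then m else 0 :=
    fun z h1 h2 => by rw [h1]; exact h2
  have zero : b.arrfun (fun p q => p • MulOpposite.op q • (0 : b.carrier)) m = 0 := by
    simp only [smul_zero]; exact arrfun_zero b m
  cases b with
  | RR =>
    have h1 := arrfun_gen .RR (by simp) m
    cases j
    · cases i
      · exact h1
      · exact zero
    · refine key _ (bmat_RR_true i) ?_
      cases i
      · exact zero
      · exact h1
  | HH =>
    cases j
    · cases i
      · exact arrfun_half m
      · exact arrfun_half_J m
    · refine key _ (bmat_HH_true i) ?_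
      cases i
      · simp only [smul_neg, Bool.false_eq_true, if_false, reduceCtorEq]
        have := SimpleBimod.HH.arrfun_map (AddMonoidHom.id _ |> Neg.neg)
          (fun p q => p • MulOpposite.op q • amat .HH true 0 0) m
        rw [arrfun_half_J, map_zero] at this
        exact this.symm
      · exact arrfun_half m
  | _ =>
    cases j
    · cases i
      · exact arrfun_gen _ (by simp) m
      · exact zero
    · exact absurd (hj rfl) (by simp [DivKind.Doubled])

section

variable {B : Type*} [Ring B] [Algebra ℝ B] {x y : DivKind} {J e s e' s' a : B}

/-- The left coordinates at a vertex. -/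
noncomputable def lcoord (x : DivKind) (J e s : B) : Fin 2 → B :=
  ![vfun x J e s 1, if x = .R then -(vfun x J e s 1 * J) else 0]

/-- The right coordinates at a vertex. -/
noncomputable def rcoord (x : DivKind) (J e s : B) : Fin 2 → B :=
  ![vfun x J e s 1, if x = .R then J * vfun x J e s 1 else 0]

lemma vfun_J_C : vfun .C J e s (DivKind.J .C) = J * e := by
  simp [vfun, DivKind.J, cfun]

lemma vfun_J_H : vfun .H J e s (DivKind.J .H) = J * e := by
  simp [vfun, DivKind.J, qfun]

lemma vfun_half : vfun .H J e s (DivKind.half .H) = (2⁻¹ : ℝ) • e := by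
  have := vfun_smul .H J e s 2⁻¹ 1
  rw [← Algebra.algebraMap_eq_smul_one, ClannishDatum.vfun_one] at this
  exact this.trans (by rw [if_neg (by simp)])

lemma arrfun_neg (b : SimpleBimod x y) (m : b.carrier) :
    b.arrfun (sandwich x y J e s e' s' a) (-m) = -b.arrfun (sandwich x y J e s e' s' a) m :=
  map_neg (AddMonoidHom.mk' _ (arrfun_add b)) m

lemma arrfun_sandwich_zero (b : SimpleBimod x y) :
    b.arrfun (sandwich x y J e s e' s' a) 0 = 0 :=
  map_zero (AddMonoidHom.mk' _ (arrfun_add b))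

lemma arrfun_sandwich_gen (b : SimpleBimod x y) (hb : x = .H → y ≠ .H) :
    b.arrfun (sandwich x y J e s e' s' a) b.gen = vfun x J e s 1 * a * vfun y J e' s' 1 := by
  cases b with
  | HH => exact absurd rfl (hb rfl)
  | HC =>
    have aux : qfun J e s 1 * a * cfun J e' 1 - qfun J e s qk * a * cfun J e' 0 =
      qfun J e s 1 * a * cfun J e' 1 := by simp [cfun]
    exact aux
  | CH =>
    have aux : cfun J e 1 * a * qfun J e' s' 1 + cfun J e 0 * a * qfun J e' s' qk =
      cfun J e 1 * a * qfun J e' s' 1 := by simp [cfun]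
    exact aux
  | _ => rfl

lemma arrfun_sandwich_gen_HH :
    SimpleBimod.HH.arrfun (sandwich .H .H J e s e' s' a) SimpleBimod.HH.gen =
      e * a * e' - s * a * s' := by
  have aux : qfun J e s 1 * a * qfun J e' s' 1 - qfun J e s (1 * qk) * a * qfun J e' s' qk =
      e * a * e' - s * a * s' := by rw [one_mul, qfun_one, qfun_k, qfun_one, qfun_k]
  exact aux

variable (h : IsVertex x J e s) (h' : IsVertex y J e' s') (hl : e * a = a)
  (hr : a * e' = a) (b : SimpleBimod x y) (hb : b.Balanced J a)
include h h' hl hr hb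

lemma arrfun_amat (p q : Fin 2) :
    b.arrfun (sandwich x y J e s e' s' a) (amat b false p q) +
      b.arrfun (sandwich x y J e s e' s' (J * a)) (amat b true p q) =
    lcoord x J e s p * a * rcoord y J e' s' q := by
  have hJl : e * (J * a) = J * a := by rw [h.eJ_mul, hl]
  have hJr : J * a * e' = J * a := by rw [mul_assoc, hr]
  have hl' : ∀ z, e * (a * z) = a * z := fun z => by rw [← mul_assoc, hl]
  have hr' : ∀ z, a * (e' * z) = a * z := fun z => by rw [← mul_assoc, hr]
  have s1 := arrfun_smul h h' hl hr b hb
  have s2 := arrfun_op_smul h h' hl hr b hb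
  have s1' := arrfun_smul h h' hJl hJr b hb.J_mul
  have g := fun hx => arrfun_sandwich_gen (J := J) (e := e) (s := s) (e' := e') (s' := s') (a := a) b hx
  have g' := fun hx => arrfun_sandwich_gen (J := J) (e := e) (s := s) (e' := e') (s' := s') (a := J * a) b hx
  have z := arrfun_sandwich_zero (J := J) (e := e) (s := s) (e' := e') (s' := s') (a := a) b
  have z' := arrfun_sandwich_zero (J := J) (e := e) (s := s) (e' := e') (s' := s') (a := J * a) b
  have hJJ := h.JJ_mul
  have fin : a * J = J * a → ∀ z, a * (J * z) = J * (a * z) := fun hb z => by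
    rw [← mul_assoc, hb, mul_assoc]
  cases b with
  | RR =>
    have fin := fin hb
    fin_cases p <;> fin_cases q <;> simp [amat, lcoord, rcoord, z, z', g, g', arrfun_neg, s1, s2,
      s1', ClannishDatum.vfun_one, mul_assoc] <;> simp only [fin, hJJ, mul_neg, neg_neg]
  | HH =>
    have gg := arrfun_sandwich_gen_HH (J := J) (e := e) (s := s) (e' := e') (s' := s') (a := a)
    have gg' := arrfun_sandwich_gen_HH (J := J) (e := e) (s := s) (e' := e') (s' := s') (a := J * a)
    fin_cases p <;> fin_cases q <;> simp [amat, lcoord, rcoord, z, z', gg, gg', arrfun_neg, s1, s2,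
      s1', ClannishDatum.vfun_one, vfun_J_H, vfun_half, hl, hl', hr, mul_assoc]
    simp only [mul_sub, h.eJ_mul, hl, hl', h.es_mul, h.sJ_mul, mul_neg, h.JJ_mul]
    module
  | CCbar =>
    fin_cases p <;> fin_cases q <;> simp [amat, lcoord, rcoord, z, z', g, g', arrfun_neg, s1, s2,
      s1', ClannishDatum.vfun_one, vfun_J_C, vfun_J_H, hl, hl', hr, mul_assoc]
  | _ =>
    have fin := fin hb
    have fin' : a * J = J * a := hb
    fin_cases p <;> fin_cases q <;> simp [amat, lcoord, rcoord, z, z', g, g', arrfun_neg, s1, s2,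
      s1', ClannishDatum.vfun_one, vfun_J_C, vfun_J_H, hl, hl', hr, mul_assoc] <;>
      simp only [fin, fin', hr]

end

lemma vfun_mul_right {B : Type*} [Ring B] [Algebra ℝ B] (x : DivKind) {J e s : B} (ee : e * e = e)
    (es : e * s = s) (a : x.carrier) : vfun x (J * e) e s a = vfun x J e s a := by
  cases x with
  | R => rfl
  | C => simp only [vfun, cfun, mul_assoc, ee]
  | H => simp only [vfun, qfun, mul_assoc, ee, es]

lemma arrfun_sum {N : Type*} [AddCommGroup N] {x y : DivKind} (b : SimpleBimod x y)
    (A : Bool → x.carrier → y.carrier → N) (m : b.carrier) :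
    b.arrfun (fun p q => ∑ i, A i p q) m = ∑ i, b.arrfun (A i) m := by
  simp only [Fintype.sum_bool]
  cases b with
  | HH => exact add_sub_add_comm _ _ _ _
  | HC => exact add_sub_add_comm _ _ _ _
  | CH => exact add_add_add_comm _ _ _ _
  | _ => rfl

namespace ClannishDatum

variable (D : ClannishDatum.{u})

/-- Two by two matrices over `T(Q^b, M)`. -/
abbrev MatT : Type u := Matrix (Fin 2) (Fin 2) D.basic.T

/-- The matrices over `M(v)`, as matrices over `T(Q^b, M)`. -/
noncomputable def vert (v : D.Q.V) : Matrix (Fin 2) (Fin 2) (D.kind v).carrier →ₙₐ[ℝ] D.MatT where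
  toFun A := Matrix.of fun p q => D.basic.ofVert v (A p q)
  map_smul' r A := by
    ext p q
    exact D.basic.ofVert_smul v r (A p q)
  map_zero' := by
    ext p q
    have := D.basic.ofVert_smul v 0 0
    rw [zero_smul, zero_smul] at this
    exact this
  map_add' A B := by
    ext p q
    exact D.basic.ofVert_add v (A p q) (B p q)
  map_mul' A B := by
    ext p q
    simp only [Matrix.mul_apply, Fin.sum_univ_two, Matrix.of_apply]
    refine (D.basic.ofVert_add v _ _).trans ?_
    exact congrArg₂ (· + ·) (D.basic.ofVert_mul v _ _) (D.basic.ofVert_mul v _ _)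

lemma vert_apply (v : D.Q.V) (A) (p q : Fin 2) : D.vert v A p q = D.basic.ofVert v (A p q) := rfl

lemma vert_mul_of_ne {v w : D.Q.V} (h : v ≠ w) (A B) : D.vert v A * D.vert w B = 0 := by
  ext p q
  have key : ∀ a b, D.basic.ofVert v a * D.basic.ofVert w b = 0 :=
    fun a b => D.basic.ofVert_mul_of_ne h a b
  simp only [Matrix.mul_apply, Fin.sum_univ_two, vert_apply, Matrix.zero_apply]
  exact (congrArg₂ (· + ·) (key _ _) (key _ _)).trans (add_zero _)

open Classical in
/-- The inclusion of `M(α)` (`i = false`) or `M(α^𝐢)` (`i = true`) in `T(Q^b, M)`, and `0` if there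
is no such arrow. -/
noncomputable def arc (α : D.Q.E) (i : Bool) : (D.bim α).carrier →+ D.basic.T :=
  if h : α ∉ D.special ∧ (i = true → D.kind (D.Q.s α) = D.kind (D.Q.t α) ∧ D.kind (D.Q.s α) ≠ .C)
  then D.basic.ofArrHom ⟨(α, i), h⟩ else 0

lemma arc_val (p : D.BasicArrow) (m : (D.bim p.1.1).carrier) :
    D.arc p.1.1 p.1.2 m = D.basic.ofArr p m :=
  congrArg (fun f : (D.bim p.1.1).carrier →+ D.basic.T => f m) (dif_pos p.2)

lemma arc_eq_zero {α : D.Q.E} {i : Bool}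
    (h : ¬ (α ∉ D.special ∧ (i = true → D.kind (D.Q.s α) = D.kind (D.Q.t α) ∧ D.kind (D.Q.s α) ≠ .C)))
    (m : (D.bim α).carrier) : D.arc α i m = 0 :=
  congrArg (fun f : (D.bim α).carrier →+ D.basic.T => f m) (dif_neg h)

lemma ofVert_mul_arc (α : D.Q.E) (i : Bool) (a : (D.kind (D.Q.t α)).carrier)
    (m : (D.bim α).carrier) : D.basic.ofVert (D.Q.t α) a * D.arc α i m = D.arc α i (a • m) := by
  by_cases h : α ∉ D.special ∧
    (i = true → D.kind (D.Q.s α) = D.kind (D.Q.t α) ∧ D.kind (D.Q.s α) ≠ .C)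
  · have h1 := fun m => D.arc_val ⟨(α, i), h⟩ m
    refine (congrArg (_ * ·) (h1 m)).trans (Eq.trans ?_ (h1 (a • m)).symm)
    exact D.basic.ofVert_mul_ofArr ⟨(α, i), h⟩ a m
  · rw [D.arc_eq_zero h, D.arc_eq_zero h, mul_zero]

lemma arc_mul_ofVert (α : D.Q.E) (i : Bool) (a : (D.kind (D.Q.s α)).carrier)
    (m : (D.bim α).carrier) :
    D.arc α i m * D.basic.ofVert (D.Q.s α) a = D.arc α i (MulOpposite.op a • m) := by
  by_cases h : α ∉ D.special ∧
    (i = true → D.kind (D.Q.s α) = D.kind (D.Q.t α) ∧ D.kind (D.Q.s α) ≠ .C)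
  · have h1 := fun m => D.arc_val ⟨(α, i), h⟩ m
    refine (congrArg (· * _) (h1 m)).trans (Eq.trans ?_ (h1 (MulOpposite.op a • m)).symm)
    exact D.basic.ofArr_mul_ofVert ⟨(α, i), h⟩ a m
  · rw [D.arc_eq_zero h, D.arc_eq_zero h, zero_mul]

/-- The matrices over `M(α) ⊕ M(α^𝐢)`, as matrices over `T(Q^b, M)`. -/
noncomputable def arm (α : D.Q.E) (m : Bool → Matrix (Fin 2) (Fin 2) (D.bim α).carrier) : D.MatT :=
  Matrix.of fun p q => ∑ i, D.arc α i (m i p q)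

lemma vert_mul_arm (α : D.Q.E) (A) (m) :
    D.vert (D.Q.t α) A * D.arm α m = D.arm α (fun i => lmul A (m i)) := by
  ext p q
  simp only [Matrix.mul_apply, Fin.sum_univ_two, vert_apply, arm, Matrix.of_apply, lmul,
    map_add, mul_add, Fintype.sum_bool, ofVert_mul_arc]
  abel

lemma arm_mul_vert (α : D.Q.E) (A) (m) :
    D.arm α m * D.vert (D.Q.s α) A = D.arm α (fun i => rmul (m i) A) := by
  ext p q
  simp only [Matrix.mul_apply, Fin.sum_univ_two, vert_apply, arm, Matrix.of_apply, rmul,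
    map_add, add_mul, Fintype.sum_bool, arc_mul_ofVert]
  abel

lemma arm_zsmul (α : D.Q.E) (n : ℤ) (m) : D.arm α (fun i => n • m i) = n • D.arm α m := by
  ext p q
  simp only [arm, Matrix.of_apply, Matrix.smul_apply, map_zsmul, Fintype.sum_bool]
  exact (smul_add _ _ _).symm

/-- The image of `𝐢` in the matrices over `T(Q^b, M)`. -/
noncomputable def Jmat : D.MatT := ∑ v, D.vert v (imat (D.kind v))

lemma vert_mul_Jmat (v : D.Q.V) (A) : D.vert v A * D.Jmat = D.vert v (A * imat (D.kind v)) := by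
  classical
  rw [Jmat, Finset.mul_sum, Finset.sum_eq_single v, ← map_mul]
  · exact fun w _ h => D.vert_mul_of_ne h.symm _ _
  · simp

lemma Jmat_mul_vert (v : D.Q.V) (A) : D.Jmat * D.vert v A = D.vert v (imat (D.kind v) * A) := by
  classical
  rw [Jmat, Finset.sum_mul, Finset.sum_eq_single v, ← map_mul]
  · exact fun w _ h => D.vert_mul_of_ne h _ _
  · simp

/-- The image of the untwisted arrow. -/
noncomputable def uarm (α : D.Q.E) : D.MatT := D.arm α (amat (D.bim α))

lemma vert_mul_uarm (α : D.Q.E) : D.vert (D.Q.t α) (omat _) * D.uarm α = D.uarm α := by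
  rw [uarm, vert_mul_arm]; simp only [lmul_omat]

lemma uarm_mul_vert (α : D.Q.E) : D.uarm α * D.vert (D.Q.s α) (omat _) = D.uarm α := by
  rw [uarm, arm_mul_vert]; simp only [rmul_omat]

lemma uarm_mul_Jmat (α : D.Q.E) : D.Jmat * D.uarm α = (D.bim α).sgn • (D.uarm α * D.Jmat) := by
  rw [← D.vert_mul_uarm, ← mul_assoc, Jmat_mul_vert, imat_mul_omat, D.vert_mul_uarm]
  conv_rhs => rw [← D.uarm_mul_vert, mul_assoc, vert_mul_Jmat, omat_mul_imat]
  rw [uarm, vert_mul_arm, arm_mul_vert, ← arm_zsmul]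
  simp only [lmul_imat]

open Classical in
/-- The matrix which undoes the untwisting at the end of an arrow. -/
noncomputable def unflipT (α : D.Q.E) : D.MatT :=
  D.vert (D.Q.t α) (if D.FlipT α then sinv _ else omat _)

open Classical in
/-- The matrix which undoes the untwisting at the start of an arrow. -/
noncomputable def unflipS (α : D.Q.E) : D.MatT :=
  D.vert (D.Q.s α) (if D.FlipS α then sinv _ else omat _)

open Classical in
/-- The image of an arrow in the matrices over `T(Q^b, M)`. -/
noncomputable def tharr (α : D.Q.E) : D.MatT :=
  if α ∈ D.special then D.vert (D.Q.s α) (smat _) else D.unflipT α * D.uarm α * D.unflipS α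

lemma sgn_std (x y : DivKind) (tw : Bool) :
    (SimpleBimod.std x y tw).sgn = if x = .C ∧ y = .C ∧ tw = true then -1 else 1 := by
  cases x <;> cases y <;> cases tw <;> simp [SimpleBimod.std, SimpleBimod.sgn]

lemma unflipT_mul_Jmat (α : D.Q.E) [Decidable (D.FlipT α)] :
    D.unflipT α * D.Jmat = (if D.FlipT α then (-1 : ℤ) else 1) • (D.Jmat * D.unflipT α) := by
  rw [unflipT, vert_mul_Jmat, Jmat_mul_vert]
  split_ifs
  · rw [sinv_mul_imat]; simp
  · rw [omat_mul_imat, imat_mul_omat, one_smul]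

lemma unflipS_mul_Jmat (α : D.Q.E) [Decidable (D.FlipS α)] :
    D.unflipS α * D.Jmat = (if D.FlipS α then (-1 : ℤ) else 1) • (D.Jmat * D.unflipS α) := by
  rw [unflipS, vert_mul_Jmat, Jmat_mul_vert]
  split_ifs
  · rw [sinv_mul_imat]; simp
  · rw [omat_mul_imat, imat_mul_omat, one_smul]

lemma tharr_mul_Jmat (α : D.Q.E) [Decidable (D.σ α = AlgEquiv.refl)] :
    D.tharr α * D.Jmat = (if D.σ α = AlgEquiv.refl then (1 : ℤ) else -1) • (D.Jmat * D.tharr α) := by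
  classical
  unfold tharr
  split_ifs with hs hσ hσ
  · exact absurd ((D.twist α hs).symm.trans hσ) conj_ne_refl
  · rw [vert_mul_Jmat, Jmat_mul_vert, smat_mul_imat]; simp
  all_goals
    have h2 : D.uarm α * D.Jmat = (D.bim α).sgn • (D.Jmat * D.uarm α) := by
      rw [uarm_mul_Jmat, sgn_std]; split_ifs <;> simp
    rw [mul_assoc, D.unflipS_mul_Jmat, mul_smul_comm, ← mul_assoc, mul_assoc (D.unflipT α), h2,
      mul_smul_comm, ← mul_assoc, unflipT_mul_Jmat, sgn_std, smul_mul_assoc, smul_mul_assoc,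
      smul_mul_assoc, smul_smul, smul_smul, mul_assoc, mul_assoc, mul_assoc]
    congr 1
    swap
    · simp only [mul_assoc]
    by_cases h3 : D.kind (D.Q.t α) = .C <;> by_cases h4 : D.kind (D.Q.s α) = .C <;>
      simp [FlipT, FlipS, hσ, h3, h4]

lemma smat_eq_zero {x : DivKind} (h : x = .C) : smat x = 0 := by subst h; rfl

lemma smat_mul_smat_of_R {x : DivKind} (h : x = .R) : smat x * smat x = omat x := by
  subst h; exact smat_mul_smat_R

lemma smat_mul_smat_of_H {x : DivKind} (h : x = .H) : smat x * smat x = -omat x := by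
  subst h; exact smat_mul_smat_H

lemma exists_Theta : ∃ Θ : D.LoopAlg →ₙₐ[ℝ] D.MatT, Θ D.im = D.Jmat ∧
    (∀ v, Θ (D.ve v) = D.vert v (omat _)) ∧ ∀ α, Θ (D.ar α) = D.tharr α := by
  classical
  have hJ : (∑ i, D.vert i (omat _)) * D.Jmat = D.Jmat := by
    rw [Finset.sum_mul]; simp only [vert_mul_Jmat, omat_mul_imat]; rfl
  refine D.exists_loopAlg_lift D.Jmat (fun v => D.vert v (omat _)) D.tharr ?_ ?_ hJ ?_ ?_ ?_ ?_
    ?_ ?_ ?_ ?_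
  · intro i; rw [← map_mul, omat_mul_omat]
  · intro i j h; exact D.vert_mul_of_ne h _ _
  · conv_lhs => enter [1]; rw [Jmat]
    rw [Finset.sum_mul]
    simp only [vert_mul_Jmat, imat_mul_imat, map_neg, Finset.sum_neg_distrib]
  · intro i; rw [vert_mul_Jmat, Jmat_mul_vert, omat_mul_imat, imat_mul_omat]
  · intro α
    unfold tharr; split_ifs with hs
    · change D.vert (D.Q.t α) (omat (D.kind (D.Q.t α))) * _ = _
      rw [← D.isLoop α hs, ← map_mul, omat_mul_smat]
    · rw [unflipT, ← mul_assoc, ← mul_assoc, ← map_mul]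
      split_ifs <;> simp only [omat_mul_sinv, omat_mul_omat]
  · intro α
    unfold tharr; split_ifs with hs
    · change _ * D.vert (D.Q.s α) (omat (D.kind (D.Q.s α))) = _
      rw [← map_mul, smat_mul_omat]
    · rw [unflipS, mul_assoc, ← map_mul]
      split_ifs <;> simp only [sinv_mul_omat, omat_mul_omat]
  · intro α h; rw [tharr_mul_Jmat, if_pos h, one_smul]
  · intro α h; rw [tharr_mul_Jmat, if_neg h, neg_one_smul]
  · intro l hl
    have hl' : l ∈ D.special := Or.inl hl
    rw [tharr, if_pos hl', ← map_mul, smat_mul_smat_of_R ((D.kind_eq_R_iff _).mpr ⟨l, hl, rfl⟩)]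
  · intro l hl
    have hl' : l ∈ D.special := Or.inr hl
    rw [tharr, if_pos hl', ← map_mul, smat_mul_smat_of_H ((D.kind_eq_H_iff _).mpr ⟨l, hl, rfl⟩),
      map_neg]

/-- The homomorphism from `ℂ_σ Q/⟨S⟩` to the matrices over `T(Q^b, M)`. -/
noncomputable def Theta : D.LoopAlg →ₙₐ[ℝ] D.MatT := D.exists_Theta.choose

lemma Theta_im : D.Theta D.im = D.Jmat := D.exists_Theta.choose_spec.1

lemma Theta_ve (v : D.Q.V) : D.Theta (D.ve v) = D.vert v (omat _) := D.exists_Theta.choose_spec.2.1 v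

lemma Theta_ar (α : D.Q.E) : D.Theta (D.ar α) = D.tharr α := D.exists_Theta.choose_spec.2.2 α

lemma Theta_spl (v : D.Q.V) : D.Theta (D.spl v) = D.vert v (smat _) := by
  by_cases h : ∃ l ∈ D.special, D.Q.s l = v
  · obtain ⟨l, hl, rfl⟩ := h
    rw [D.spl_of_special hl, Theta_ar, tharr, if_pos hl]
  · have hC : D.kind v = .C := by
      by_contra hC; exact h ((D.kind_ne_C_iff v).mp hC)
    rw [spl, dif_neg h, map_zero, smat_eq_zero hC, map_zero]

lemma Theta_unt {α : D.Q.E} (h : α ∉ D.special) : D.Theta (D.unt α) = D.uarm α := by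
  classical
  rw [unt, map_mul, map_mul, Theta_ar, tharr, if_neg h]
  have h1 : D.Theta (D.flipT α) * D.unflipT α = D.vert (D.Q.t α) (omat _) := by
    unfold flipT unflipT
    split_ifs with hf
    · rw [Theta_spl, ← map_mul, smat_mul_sinv _ hf.2]
    · rw [Theta_ve, ← map_mul, omat_mul_omat]
  have h2 : D.unflipS α * D.Theta (D.flipS α) = D.vert (D.Q.s α) (omat _) := by
    unfold flipS unflipS
    split_ifs with hf
    · rw [Theta_spl, ← map_mul, sinv_mul_smat _ hf.2.2]
    · rw [Theta_ve, ← map_mul, omat_mul_omat]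
  rw [← mul_assoc, ← mul_assoc, h1, vert_mul_uarm, mul_assoc, h2, uarm_mul_vert]

lemma Theta_vmap (v : D.Q.V) (a : (D.kind v).carrier) :
    D.Theta (D.vmap v a) = D.vert v !![a, 0; 0, 0] := by
  rw [vmap, vfun_map, Theta_im, Theta_ve, Theta_spl, ← vfun_mul_right, Jmat_mul_vert, imat_mul_omat,
    ← vfun_map, vfun_mat]
  · rw [← map_mul, omat_mul_omat]
  · rw [← map_mul, omat_mul_smat]

lemma Theta_bunt (p : D.BasicArrow) : D.Theta (D.bunt p) = D.arm p.1.1 (bmat (D.bim p.1.1) p.1.2) := by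
  have h := D.Theta_unt p.2.1
  unfold bunt bmat
  split_ifs with hp
  · rw [map_mul, h, Theta_im, ← D.vert_mul_uarm, ← mul_assoc, Jmat_mul_vert, imat_mul_omat, uarm,
      vert_mul_arm]
  · exact h

/-- The inclusion of `T(Q^b, M)` in the matrices as the upper left corner. -/
noncomputable def corner : D.basic.T →ₙₐ[ℝ] D.MatT where
  toFun x := !![x, 0; 0, 0]
  map_smul' r x := by apply matrix_two_ext <;> simp
  map_zero' := by apply matrix_two_ext <;> simp
  map_add' x y := by apply matrix_two_ext <;> simp
  map_mul' x y := by apply matrix_two_ext <;> simp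

lemma Theta_sand {α : D.Q.E} (p : D.BasicArrow) (hp : p.1.1 = α) (i : Bool) (hi : p.1.2 = i)
    (a : (D.kind (D.Q.t α)).carrier) (b : (D.kind (D.Q.s α)).carrier) :
    D.Theta (D.sand α (D.bunt p) a b) =
        D.corner (∑ k, D.arc α k (a • MulOpposite.op b • bmat (D.bim α) i k 0 0)) := by
  subst hp hi
  change D.Theta (D.vmap _ a * D.bunt p * D.vmap _ b) = _
  rw [map_mul, map_mul, Theta_vmap, Theta_vmap, Theta_bunt, vert_mul_arm, arm_mul_vert]
  refine matrix_two_ext ?_ ?_ ?_ ?_ <;>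
    simp [arm, lmul, rmul, Fin.sum_univ_two, corner, smul_comm]

lemma Theta_amap (α : D.Q.E) (i : Bool) (h) (m : (D.bim α).carrier) :
    D.Theta (D.amap ⟨(α, i), h⟩ m) = D.corner (D.arc α i m) := by
  have h1 := (D.bim α).arrfun_map (D.Theta : D.LoopAlg →+ D.MatT) (D.sand α (D.bunt ⟨(α, i), h⟩)) m
  have h2 : (fun a b => (D.Theta : D.LoopAlg →+ D.MatT) (D.sand α (D.bunt ⟨(α, i), h⟩) a b)) =
      fun a b => (D.corner : D.basic.T →+ D.MatT)
        (∑ k, D.arc α k (a • MulOpposite.op b • bmat (D.bim α) i k 0 0)) :=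
    funext₂ (D.Theta_sand ⟨(α, i), h⟩ rfl i rfl)
  refine h1.trans ?_
  rw [h2, ← SimpleBimod.arrfun_map]
  refine congrArg D.corner ?_
  have hd : i = true → DivKind.Doubled (D.kind (D.Q.t α)) (D.kind (D.Q.s α)) := h.2
  have h3 : ∀ k, (D.bim α).arrfun
      (fun a b => D.arc α k (a • MulOpposite.op b • bmat (D.bim α) i k 0 0)) m =
      D.arc α k (if k = i then m else 0) := fun k => by
    rw [← arrfun_bmat (D.bim α) i k hd m, SimpleBimod.arrfun_map]
  rw [arrfun_sum, Fintype.sum_bool, h3, h3]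
  cases i <;> simp

lemma Theta_Psi (x : D.basic.T) : D.Theta (D.Psi x) = D.corner x := by
  induction x using D.basic.T_induction with
  | vert i a =>
    refine (congrArg D.Theta (D.Psi_ofVert i a)).trans ((D.Theta_vmap i a).trans ?_)
    have h0 := congrFun₂ (map_zero (D.vert i)) 0 0
    refine matrix_two_ext rfl ?_ ?_ ?_ <;> exact h0
  | arr p m =>
    exact (congrArg D.Theta (D.Psi_ofArr p m)).trans ((D.Theta_amap p.1.1 p.1.2 p.2 m).trans
      (congrArg D.corner (D.arc_val p m)))
  | zero => simp
  | add x y hx hy => simp only [map_add, hx, hy]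
  | mul x y hx hy => simp only [map_mul, hx, hy]
  | smul r x hx => simp only [map_smul, hx]

end ClannishDatum

section

variable {B : Type*} [Ring B] [Algebra ℝ B] {x : DivKind} {J e s : B} (h : IsVertex x J e s)
include h

lemma vfun_one_mul_e : vfun x J e s 1 * e = vfun x J e s 1 := by
  rw [ClannishDatum.vfun_one]; split_ifs
  · simp only [add_mul, smul_mul_assoc, h.ee, h.se]
  · exact h.ee

lemma e_mul_vfun_one : e * vfun x J e s 1 = vfun x J e s 1 := by
  rw [ClannishDatum.vfun_one]; split_ifs
  · simp only [mul_add, mul_smul_comm, h.ee, h.es]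
  · exact h.ee

lemma lcoord_mul_e (p : Fin 2) : lcoord x J e s p * e = lcoord x J e s p := by
  fin_cases p
  · exact vfun_one_mul_e h
  · simp only [lcoord, Fin.mk_one, Matrix.cons_val_one, Matrix.cons_val_fin_one]
    split_ifs
    · rw [neg_mul, mul_assoc, ← h.eJ, ← mul_assoc, vfun_one_mul_e h]
    · exact zero_mul _

lemma e_mul_lcoord (p : Fin 2) : e * lcoord x J e s p = lcoord x J e s p := by
  fin_cases p
  · exact e_mul_vfun_one h
  · simp only [lcoord, Fin.mk_one, Matrix.cons_val_one, Matrix.cons_val_fin_one]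
    split_ifs
    · rw [mul_neg, ← mul_assoc, e_mul_vfun_one h]
    · exact mul_zero _

lemma rcoord_mul_e (p : Fin 2) : rcoord x J e s p * e = rcoord x J e s p := by
  fin_cases p
  · exact vfun_one_mul_e h
  · simp only [rcoord, Fin.mk_one, Matrix.cons_val_one, Matrix.cons_val_fin_one]
    split_ifs
    · rw [mul_assoc, vfun_one_mul_e h]
    · exact zero_mul _

lemma e_mul_rcoord (p : Fin 2) : e * rcoord x J e s p = rcoord x J e s p := by
  fin_cases p
  · exact e_mul_vfun_one h
  · simp only [rcoord, Fin.mk_one, Matrix.cons_val_one, Matrix.cons_val_fin_one]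
    split_ifs
    · rw [h.eJ_mul, e_mul_vfun_one h]
    · exact mul_zero _

lemma sum_rcoord_mul_lcoord : ∑ p, rcoord x J e s p * lcoord x J e s p = e := by
  simp only [Fin.sum_univ_two, lcoord, rcoord, Matrix.cons_val_one, Matrix.cons_val_fin_one,
    Matrix.cons_val_zero, ClannishDatum.vfun_one]
  split_ifs with hx
  · simp only [mul_add, add_mul, mul_smul_comm, smul_mul_assoc, mul_assoc, h.ee, h.es, h.se,
      h.ssR hx, mul_neg, h.eJ, h.sJ, h.JJ_mul, h.ee_mul, h.ssR_mul hx, h.es_mul, h.se_mul, h.eJ_mul, h.sJ_mul]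
    module
  · rw [h.ee, mul_zero, add_zero]

lemma lcoord_mul_rcoord (p q : Fin 2) :
    lcoord x J e s p * e * rcoord x J e s q = vfun x J e s (omat x p q) := by
  have h0 : vfun x J e s 0 = 0 := map_zero h.hom
  rw [lcoord_mul_e h]
  have h1 := h.vfun_mul 1 1
  rw [mul_one] at h1
  cases x with
  | R =>
    have h2 : vfun .R J e s 1 * (J * vfun .R J e s 1) = 0 := by
      rw [ClannishDatum.vfun_one, if_pos rfl]
      simp only [mul_add, add_mul, mul_smul_comm, smul_mul_assoc, mul_assoc, h.ee, h.es, h.se,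
        h.ssR rfl, mul_neg, h.eJ, h.sJ, h.JJ_mul, h.ee_mul, h.ssR_mul rfl, h.es_mul, h.se_mul, h.eJ_mul, h.sJ_mul]
      module
    fin_cases p <;> fin_cases q <;>
      simp [lcoord, rcoord, omat, h0, mul_assoc, h2, ← h1, h.JJ_mul]
  | _ => fin_cases p <;> fin_cases q <;> simp [lcoord, rcoord, omat, h0, ← h1]

lemma lcoord_mul_J_mul_rcoord (p q : Fin 2) :
    lcoord x J e s p * J * rcoord x J e s q = vfun x J e s (imat x p q) := by
  have h0 : vfun x J e s 0 = 0 := map_zero h.hom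
  have hn : ∀ z, vfun x J e s (-z) = -vfun x J e s z := map_neg h.hom
  have h1 := h.vfun_mul 1 1
  rw [mul_one] at h1
  cases x with
  | R =>
    have h2 : vfun .R J e s 1 * (J * vfun .R J e s 1) = 0 := by
      rw [ClannishDatum.vfun_one, if_pos rfl]
      simp only [mul_add, add_mul, mul_smul_comm, smul_mul_assoc, mul_assoc, h.ee, h.es, h.se,
        h.ssR rfl, mul_neg, h.eJ, h.sJ, h.JJ_mul, h.ee_mul, h.ssR_mul rfl, h.es_mul, h.se_mul, h.eJ_mul, h.sJ_mul]
      module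
    fin_cases p <;> fin_cases q <;>
      simp [lcoord, rcoord, imat, h0, hn, mul_assoc, h2, ← h1, h.JJ_mul]
  | C =>
    fin_cases p <;> fin_cases q <;>
      simp [lcoord, rcoord, imat, h0, vfun_J_C, ClannishDatum.vfun_one, h.eJ, mul_assoc, h.ee]
  | H =>
    fin_cases p <;> fin_cases q <;>
      simp [lcoord, rcoord, imat, h0, vfun_J_H, ClannishDatum.vfun_one, h.eJ, mul_assoc, h.ee]

lemma lcoord_mul_s_mul_rcoord (hs : x = .C → s = 0) (p q : Fin 2) :
    lcoord x J e s p * s * rcoord x J e s q = vfun x J e s (smat x p q) := by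
  have h0 : vfun x J e s 0 = 0 := map_zero h.hom
  have hn : ∀ z, vfun x J e s (-z) = -vfun x J e s z := map_neg h.hom
  have h1 := h.vfun_mul 1 1
  rw [mul_one] at h1
  cases x with
  | R =>
    have h2 : vfun .R J e s 1 * (J * vfun .R J e s 1) = 0 := by
      rw [ClannishDatum.vfun_one, if_pos rfl]
      simp only [mul_add, add_mul, mul_smul_comm, smul_mul_assoc, mul_assoc, h.ee, h.es, h.se,
        h.ssR rfl, mul_neg, h.eJ, h.sJ, h.JJ_mul, h.ee_mul, h.ssR_mul rfl, h.es_mul, h.se_mul, h.eJ_mul, h.sJ_mul]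
      module
    have h3 : s * vfun .R J e s 1 = vfun .R J e s 1 := by
      rw [ClannishDatum.vfun_one, if_pos rfl, mul_smul_comm, mul_add, h.se, h.ssR rfl, add_comm]
    fin_cases p <;> fin_cases q <;>
      simp [lcoord, rcoord, smat, h0, hn, mul_assoc, h2, ← h1, h.JJ_mul, h.sJ_mul, h3]
  | C =>
    obtain rfl := hs rfl
    simp [smat, h0]
  | H =>
    have h3 : vfun .H J e s (DivKind.K .H) = s := qfun_k J e s
    fin_cases p <;> fin_cases q <;>
      simp [lcoord, rcoord, smat, h0, h3, ClannishDatum.vfun_one, mul_assoc, h.se, h.es]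

end

namespace ClannishDatum

variable (D : ClannishDatum.{u})

/-- The left coordinates. -/
noncomputable def lvec (p : Fin 2) : D.LoopAlg :=
  ∑ v, lcoord (D.kind v) D.im (D.ve v) (D.spl v) p

/-- The right coordinates. -/
noncomputable def rvec (p : Fin 2) : D.LoopAlg :=
  ∑ v, rcoord (D.kind v) D.im (D.ve v) (D.spl v) p

lemma lvec_mul_ve (p : Fin 2) (v : D.Q.V) :
    D.lvec p * D.ve v = lcoord (D.kind v) D.im (D.ve v) (D.spl v) p := by
  classical
  rw [lvec, Finset.sum_mul, Finset.sum_eq_single v, lcoord_mul_e (D.isVertex v)]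
  · intro w _ hw
    rw [← lcoord_mul_e (D.isVertex w), mul_assoc, D.ve_mul_of_ne hw, mul_zero]
  · simp

lemma ve_mul_rvec (p : Fin 2) (v : D.Q.V) :
    D.ve v * D.rvec p = rcoord (D.kind v) D.im (D.ve v) (D.spl v) p := by
  classical
  rw [rvec, Finset.mul_sum, Finset.sum_eq_single v, e_mul_rcoord (D.isVertex v)]
  · intro w _ hw
    rw [← e_mul_rcoord (D.isVertex w), ← mul_assoc, D.ve_mul_of_ne hw.symm, zero_mul]
  · simp

lemma lvec_zero : D.lvec 0 = D.eps := Finset.sum_congr rfl fun v _ => D.vmap_one v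

lemma rvec_zero : D.rvec 0 = D.eps := Finset.sum_congr rfl fun v _ => D.vmap_one v

lemma sum_rvec_mul_lvec : ∑ p, D.rvec p * D.lvec p = 1 := by
  have key : ∀ p, D.rvec p * D.lvec p = ∑ v, rcoord (D.kind v) D.im (D.ve v) (D.spl v) p *
      lcoord (D.kind v) D.im (D.ve v) (D.spl v) p := fun p => by
    conv_lhs => rw [lvec, Finset.mul_sum]
    refine Finset.sum_congr rfl fun v _ => ?_
    classical
    rw [rvec, Finset.sum_mul, Finset.sum_eq_single v]
    · intro w _ hw
      rw [← rcoord_mul_e (D.isVertex w), ← e_mul_lcoord (D.isVertex v), mul_assoc,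
        ← mul_assoc (D.ve w), D.ve_mul_of_ne hw, zero_mul, mul_zero]
    · simp
  simp only [key]
  rw [Finset.sum_comm, ← D.sum_ve]
  exact Finset.sum_congr rfl fun v _ => sum_rcoord_mul_lcoord (D.isVertex v)

/-- The matrix of `y` in the left and right coordinates. -/
noncomputable def coords : D.LoopAlg →ₙₐ[ℝ] Matrix (Fin 2) (Fin 2) D.LoopAlg where
  toFun y := Matrix.of fun p q => D.lvec p * y * D.rvec q
  map_smul' r y := by ext p q; simp
  map_zero' := by ext p q; simp
  map_add' y z := by ext p q; simp [mul_add, add_mul]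
  map_mul' y z := by
    ext p q
    simp only [Matrix.mul_apply, Matrix.of_apply]
    have : ∀ r, D.lvec p * y * D.rvec r * (D.lvec r * z * D.rvec q) =
      D.lvec p * y * (D.rvec r * D.lvec r) * (z * D.rvec q) := fun r => by simp only [mul_assoc]
    simp only [this]
    rw [← Finset.sum_mul, ← Finset.mul_sum, sum_rvec_mul_lvec]
    simp only [mul_one, mul_assoc]

/-- The homomorphism induced by the embedding of `T(Q^b, M)` on matrices. -/
noncomputable def matPsi : D.MatT →ₙₐ[ℝ] Matrix (Fin 2) (Fin 2) D.LoopAlg where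
  toFun A := A.map D.Psi
  map_smul' r y := by ext p q; simp
  map_zero' := by ext p q; simp
  map_add' y z := by ext p q; simp
  map_mul' y z := by ext p q; simp [Matrix.mul_apply]

lemma exists_unflipT (α : D.Q.E) : ∃ z, z * D.flipT α = D.ve (D.Q.t α) ∧
    z ∈ ({D.ve (D.Q.t α), D.spl (D.Q.t α), -D.spl (D.Q.t α)} : Set D.LoopAlg) := by
  have h := D.isVertex (D.Q.t α)
  unfold flipT
  split_ifs with hf
  · cases hk : D.kind (D.Q.t α) with
    | R => exact ⟨D.spl _, h.ssR hk, by simp⟩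
    | C => exact absurd hk hf.2
    | H => exact ⟨-D.spl _, by rw [neg_mul, h.ssH hk, neg_neg], by simp⟩
  · exact ⟨D.ve _, h.ee, by simp⟩

lemma exists_unflipS (α : D.Q.E) : ∃ z, D.flipS α * z = D.ve (D.Q.s α) ∧
    z ∈ ({D.ve (D.Q.s α), D.spl (D.Q.s α), -D.spl (D.Q.s α)} : Set D.LoopAlg) := by
  have h := D.isVertex (D.Q.s α)
  unfold flipS
  split_ifs with hf
  · cases hk : D.kind (D.Q.s α) with
    | R => exact ⟨D.spl _, h.ssR hk, by simp⟩
    | C => exact absurd hk hf.2.2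
    | H => exact ⟨-D.spl _, by rw [mul_neg, h.ssH hk, neg_neg], by simp⟩
  · exact ⟨D.ve _, h.ee, by simp⟩

lemma exists_ar_eq (α : D.Q.E) : ∃ z w, D.ar α = z * D.unt α * w ∧
    z ∈ ({D.ve (D.Q.t α), D.spl (D.Q.t α), -D.spl (D.Q.t α)} : Set D.LoopAlg) ∧
    w ∈ ({D.ve (D.Q.s α), D.spl (D.Q.s α), -D.spl (D.Q.s α)} : Set D.LoopAlg) := by
  obtain ⟨z, hz, hz'⟩ := D.exists_unflipT α
  obtain ⟨w, hw, hw'⟩ := D.exists_unflipS α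
  refine ⟨z, w, ?_, hz', hw'⟩
  rw [unt, ← mul_assoc, ← mul_assoc, hz, D.ve_mul_ar, mul_assoc, hw, D.ar_mul_ve]

lemma loopAlg_hom_ext_unt {B : Type*} [Ring B] [Algebra ℝ B] {F G : D.LoopAlg →ₙₐ[ℝ] B}
    (him : F D.im = G D.im) (hve : ∀ i, F (D.ve i) = G (D.ve i))
    (hspl : ∀ i, F (D.spl i) = G (D.spl i))
    (hunt : ∀ α ∉ D.special, F (D.unt α) = G (D.unt α)) : F = G := by
  refine DFunLike.ext _ _ (D.loopAlg_hom_ext him hve fun α => ?_)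
  by_cases hα : α ∈ D.special
  · rw [← D.spl_of_special hα, hspl]
  · obtain ⟨z, w, h, hz, hw⟩ := D.exists_ar_eq α
    have key : ∀ v, ∀ z ∈ ({D.ve v, D.spl v, -D.spl v} : Set D.LoopAlg), F z = G z := by
      rintro v z (rfl | rfl | rfl)
      · exact hve v
      · exact hspl v
      · rw [map_neg, map_neg, hspl v]
    rw [h, map_mul, map_mul, map_mul, map_mul, key _ z hz, key _ w hw, hunt α hα]

lemma Psi_arc (α : D.Q.E) (i : Bool) (h) (m : (D.bim α).carrier) :
    D.Psi (D.arc α i m) = D.amap ⟨(α, i), h⟩ m :=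
  (congrArg D.Psi (D.arc_val ⟨(α, i), h⟩ m)).trans (D.Psi_ofArr ⟨(α, i), h⟩ m)

lemma amat_true {x y : DivKind} (b : SimpleBimod x y) (h : ¬ DivKind.Doubled x y) :
    amat b true = 0 := by
  cases b with
  | RR => exact absurd ⟨rfl, by simp⟩ h
  | HH => exact absurd ⟨rfl, by simp⟩ h
  | _ => rfl

lemma bunt_false (α : D.Q.E) (h) : D.bunt ⟨(α, false), h⟩ = D.unt α := if_neg Bool.false_ne_true

lemma bunt_true (α : D.Q.E) (h) : D.bunt ⟨(α, true), h⟩ = D.im * D.unt α := if_pos rfl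

lemma matPsi_Theta : D.matPsi.comp D.Theta = D.coords := by
  refine D.loopAlg_hom_ext_unt ?_ ?_ ?_ ?_
  · ext p q
    change D.Psi (D.Theta D.im p q) = D.lvec p * D.im * D.rvec q
    rw [Theta_im, Jmat, Matrix.sum_apply, map_sum]
    simp only [vert_apply]
    have : D.im = ∑ v, D.ve v * D.im * D.ve v := by
      simp only [D.ve_mul_im, mul_assoc, D.ve_mul_self]
      rw [← Finset.mul_sum, sum_ve, mul_one]
    rw [this, Finset.mul_sum, Finset.sum_mul]
    refine Finset.sum_congr rfl fun v _ => ?_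
    rw [← mul_assoc, ← mul_assoc, lvec_mul_ve, mul_assoc _ (D.ve v), ve_mul_rvec,
      lcoord_mul_J_mul_rcoord (D.isVertex v)]
    exact D.Psi_ofVert v _
  · intro v
    ext p q
    change D.Psi (D.Theta (D.ve v) p q) = D.lvec p * D.ve v * D.rvec q
    rw [← D.ve_mul_self v, ← mul_assoc, D.lvec_mul_ve, mul_assoc, ve_mul_rvec, D.ve_mul_self,
      Theta_ve, vert_apply, ← lcoord_mul_e (D.isVertex v), lcoord_mul_rcoord (D.isVertex v)]
    exact D.Psi_ofVert v _
  · intro v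
    ext p q
    change D.Psi (D.Theta (D.spl v) p q) = D.lvec p * D.spl v * D.rvec q
    have hs : D.kind v = .C → D.spl v = 0 := fun hC => by
      rw [spl, dif_neg]
      exact fun h => (D.kind_ne_C_iff v).mpr h hC
    have h1 : D.lvec p * D.spl v * D.rvec q = D.lvec p * D.ve v * D.spl v * (D.ve v * D.rvec q) := by
      rw [mul_assoc _ (D.ve v), (D.isVertex v).es, ← mul_assoc, mul_assoc _ _ (D.ve v),
        (D.isVertex v).se]
    rw [h1, D.lvec_mul_ve, ve_mul_rvec, Theta_spl, vert_apply,
      lcoord_mul_s_mul_rcoord (D.isVertex v) hs]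
    exact D.Psi_ofVert v _
  · intro α hα
    ext p q
    change D.Psi (D.Theta (D.unt α) p q) = D.lvec p * D.unt α * D.rvec q
    rw [D.Theta_unt hα, ← D.ve_mul_unt, ← D.unt_mul_ve, ← mul_assoc, ← mul_assoc, lvec_mul_ve,
      mul_assoc _ (D.ve _), ve_mul_rvec,
      ← arrfun_amat (D.isVertex _) (D.isVertex _) (D.ve_mul_unt α) (D.unt_mul_ve α) (D.bim α)
        (D.balanced_unt α), uarm, arm, Matrix.of_apply, Fintype.sum_bool, map_add, add_comm,
      D.Psi_arc α false ⟨hα, by simp⟩]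
    refine congrArg₂ (· + ·) ?_ ?_
    · change (D.bim α).arrfun (D.sand α (D.bunt ⟨(α, false), _⟩)) _ = _
      rw [bunt_false]; rfl
    · by_cases hd : DivKind.Doubled (D.kind (D.Q.t α)) (D.kind (D.Q.s α))
      · rw [D.Psi_arc α true ⟨hα, fun _ => hd⟩]
        change (D.bim α).arrfun (D.sand α (D.bunt ⟨(α, true), _⟩)) _ = _
        rw [bunt_true]; rfl
      · rw [amat_true _ hd, Matrix.zero_apply, map_zero, map_zero]
        exact (arrfun_sandwich_zero _).symm

lemma Psi_Theta (y : D.LoopAlg) (p q : Fin 2) :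
    D.Psi (D.Theta y p q) = D.lvec p * y * D.rvec q :=
  congrFun₂ (DFunLike.congr_fun D.matPsi_Theta y) p q

lemma Psi_injective : Function.Injective D.Psi := fun x y h => by
  have := (D.Theta_Psi x).symm.trans ((congrArg D.Theta h).trans (D.Theta_Psi y))
  exact congrFun₂ this 0 0

lemma range_Psi : Set.range D.Psi = {x | ∃ y, x = D.eps * y * D.eps} := by
  ext x
  constructor
  · rintro ⟨y, rfl⟩
    exact ⟨D.Psi y, by rw [← Psi_one, ← map_mul, ← map_mul, one_mul, mul_one]⟩
  · rintro ⟨y, rfl⟩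
    exact ⟨D.Theta y 0 0, by rw [Psi_Theta, lvec_zero, rvec_zero]⟩

end ClannishDatum

namespace ClannishDatum

variable (D : ClannishDatum.{u})

lemma eq_pair {D : ClannishDatum.{u}} (hD : D.IsGentleType) {p : List D.Q.E} (hp : p ∈ D.Z) :
    ∃ α β, p = [α, β] := List.length_eq_two.mp (hD.2.2 p hp)

lemma path_of_mem_Z {α β : D.Q.E} (h : [α, β] ∈ D.Z) : D.Q.s α = D.Q.t β := by
  simpa using D.isPath _ h

lemma left_ordinary {α β : D.Q.E} (h : [α, β] ∈ D.Z) : α ∉ D.special :=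
  D.head_ordinary _ h α rfl

lemma right_ordinary {α β : D.Q.E} (h : [α, β] ∈ D.Z) : β ∉ D.special :=
  D.last_ordinary _ h β rfl

lemma zIdeal_eq {D : ClannishDatum.{u}} (hD : D.IsGentleType) :
    D.zIdeal = TwoSidedIdeal.span {x | ∃ α β, [α, β] ∈ D.Z ∧ x = D.ar α * D.ar β} := by
  rw [zIdeal]
  congr 1
  ext x
  constructor
  · rintro ⟨_, ⟨p, hp, rfl⟩, rfl⟩
    obtain ⟨α, β, rfl⟩ := eq_pair hD hp
    exact ⟨α, β, hp, by simp [ar]⟩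
  · rintro ⟨α, β, h, rfl⟩
    exact ⟨_, ⟨_, h, rfl⟩, by simp [ar]⟩

/-- The ideal of `T(Q^b, M)` that corresponds to the ideal generated by `Z`. -/
noncomputable def bIdeal : TwoSidedIdeal D.basic.T := TwoSidedIdeal.comap D.Psi D.zIdeal

lemma mem_bIdeal (x : D.basic.T) : x ∈ D.bIdeal ↔ D.Psi x ∈ D.zIdeal := TwoSidedIdeal.mem_comap ..

lemma exists_tharr_eq {α : D.Q.E} (h : α ∉ D.special) : ∃ m, D.tharr α = D.arm α m := by
  rw [tharr, if_neg h, unflipT, uarm, unflipS, vert_mul_arm, arm_mul_vert]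
  exact ⟨_, rfl⟩

/-- The sum of the spaces `M(αβ)` for paths `αβ` through `v`. -/
noncomputable def throughSpace (v : D.Q.V) : Submodule ℝ D.basic.T :=
  ⨆ α ∈ D.basic.outArrows v, ⨆ β ∈ D.basic.inArrows v, D.basic.pathSpace α β

lemma pathSpace_le {α β : D.BasicArrow} {v : D.Q.V} (hα : D.Q.s α.1.1 = v)
    (hβ : D.Q.t β.1.1 = v) : D.basic.pathSpace α β ≤ D.throughSpace v :=
  le_iSup₂_of_le (f := fun α (_ : α ∈ D.basic.outArrows v) => _) α hα
    (le_iSup₂_of_le (f := fun β (_ : β ∈ D.basic.inArrows v) => D.basic.pathSpace α β) β hβ le_rfl)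

lemma arc_mul_arc_mem {α β : D.Q.E} {v : D.Q.V} (hα : D.Q.s α = v) (hβ : D.Q.t β = v) (i j : Bool)
    (m : (D.bim α).carrier) (n : (D.bim β).carrier) :
    D.arc α i m * D.arc β j n ∈ D.throughSpace v := by
  by_cases h1 : α ∉ D.special ∧
    (i = true → D.kind (D.Q.s α) = D.kind (D.Q.t α) ∧ D.kind (D.Q.s α) ≠ .C)
  · by_cases h2 : β ∉ D.special ∧
      (j = true → D.kind (D.Q.s β) = D.kind (D.Q.t β) ∧ D.kind (D.Q.s β) ≠ .C)
    · refine D.pathSpace_le (α := ⟨(α, i), h1⟩) (β := ⟨(β, j), h2⟩) hα hβ (Submodule.subset_span ?_)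
      exact ⟨m, n, congrArg₂ (· * ·) (D.arc_val ⟨(α, i), h1⟩ m) (D.arc_val ⟨(β, j), h2⟩ n)⟩
    · rw [D.arc_eq_zero h2, mul_zero]; exact zero_mem _
  · rw [D.arc_eq_zero h1, zero_mul]; exact zero_mem _

lemma Theta_mul_mem {α β : D.Q.E} (hα : α ∉ D.special) (hβ : β ∉ D.special)
    (h : D.Q.s α = D.Q.t β) (p q : Fin 2) :
    D.Theta (D.ar α * D.ar β) p q ∈ D.throughSpace (D.Q.s α) := by
  obtain ⟨m, hm⟩ := D.exists_tharr_eq hα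
  obtain ⟨n, hn⟩ := D.exists_tharr_eq hβ
  rw [map_mul, Theta_ar, Theta_ar, hm, hn, Matrix.mul_apply]
  refine sum_mem fun r _ => ?_
  simp only [arm, Matrix.of_apply]
  rw [Finset.sum_mul_sum]
  exact sum_mem fun i _ => sum_mem fun j _ => D.arc_mul_arc_mem rfl h.symm _ _ _ _

lemma bIdeal_eq_span {D : ClannishDatum.{u}} (hD : D.IsGentleType) :
    D.bIdeal = TwoSidedIdeal.span (⋃ v : D.Q.V, D.basic.localIdeal D.bIdeal v) := by
  set K := TwoSidedIdeal.span (⋃ v : D.Q.V, D.basic.localIdeal D.bIdeal v) with hK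
  refine le_antisymm ?_ ?_
  · have key : ∀ z ∈ D.zIdeal, ∀ p q, D.Theta z p q ∈ K := by
      intro z hz
      rw [zIdeal_eq hD] at hz
      induction hz using TwoSidedIdeal.span_induction with
      | mem x hx =>
        obtain ⟨α, β, h, rfl⟩ := hx
        intro p q
        refine TwoSidedIdeal.subset_span (Set.mem_iUnion.mpr ⟨D.Q.s α,
          D.Theta_mul_mem (D.left_ordinary h) (D.right_ordinary h) (D.path_of_mem_Z h) p q, ?_⟩)
        rw [mem_bIdeal, Psi_Theta, zIdeal_eq hD]
        exact TwoSidedIdeal.mul_mem_right _ _ _ (TwoSidedIdeal.mul_mem_left _ _ _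
          (TwoSidedIdeal.subset_span ⟨α, β, h, rfl⟩))
      | zero => intro p q; rw [map_zero]; exact zero_mem _
      | add x y _ _ hx hy => intro p q; rw [map_add]; exact add_mem (hx p q) (hy p q)
      | neg x _ hx => intro p q; rw [map_neg]; exact neg_mem (hx p q)
      | left_absorb a x _ hx =>
        intro p q
        rw [map_mul, Matrix.mul_apply]
        exact sum_mem fun r _ => TwoSidedIdeal.mul_mem_left _ _ _ (hx r q)
      | right_absorb b x _ hx =>
        intro p q
        rw [map_mul, Matrix.mul_apply]
        exact sum_mem fun r _ => TwoSidedIdeal.mul_mem_right _ _ _ (hx p r)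
    intro x hx
    have h1 := key _ ((D.mem_bIdeal x).mp hx) 0 0
    rw [Theta_Psi] at h1
    exact h1
  · rw [TwoSidedIdeal.span_le]
    intro x hx
    obtain ⟨v, hv⟩ := Set.mem_iUnion.mp hx
    exact hv.2

end ClannishDatum

/-! ### Morita equivalence with a full corner -/

open CategoryTheory

open scoped ModuleCat.Algebra

/-- An isomorphism from `B` to the corner `eAe` of `A` at an idempotent `e = f 1` with `AeA = A`. -/
structure FullCorner (A B : Type u) [Ring A] [Algebra ℝ A] [Ring B] [Algebra ℝ B] where
  /-- the isomorphism from `B` to the corner -/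
  f : B →ₙₐ[ℝ] A
  inj : Function.Injective f
  surj : ∀ x, f 1 * x * f 1 ∈ Set.range f
  /-- left coordinates -/
  l : Fin 2 → A
  /-- right coordinates -/
  r : Fin 2 → A
  f_one_mul_l : ∀ p, f 1 * l p = l p
  r_mul_f_one : ∀ p, r p * f 1 = r p
  sum_eq_one : ∑ p, r p * l p = 1

namespace FullCorner

variable {A B : Type u} [Ring A] [Algebra ℝ A] [Ring B] [Algebra ℝ B] (c : FullCorner A B)

lemma f_one_mul (b : B) : c.f 1 * c.f b = c.f b := by rw [← map_mul, one_mul]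

lemma f_mul_one (b : B) : c.f b * c.f 1 = c.f b := by rw [← map_mul, mul_one]

open Classical in
/-- The inverse of `f`, and `0` outside its range. -/
noncomputable def inv (y : A) : B := if h : ∃ b, c.f b = y then h.choose else 0

lemma f_inv {y : A} (hy : c.f 1 * y = y) (hy' : y * c.f 1 = y) : c.f (c.inv y) = y := by
  have h : ∃ b, c.f b = y := by
    obtain ⟨b, hb⟩ := c.surj y
    exact ⟨b, by rw [hb, hy, hy']⟩
  rw [inv, dif_pos h]
  exact h.choose_spec

/-- The matrix coordinates of an element of `A`. -/
noncomputable def co (y : A) (p q : Fin 2) : B := c.inv (c.l p * y * c.r q)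

lemma f_co (y : A) (p q : Fin 2) : c.f (c.co y p q) = c.l p * y * c.r q :=
  c.f_inv (by rw [← mul_assoc, ← mul_assoc, c.f_one_mul_l]) (by rw [mul_assoc, c.r_mul_f_one])

/-- The coordinates of `e`, as a column. -/
noncomputable def col (p : Fin 2) : B := c.inv (c.l p * c.f 1)

lemma f_col (p : Fin 2) : c.f (c.col p) = c.l p * c.f 1 :=
  c.f_inv (by rw [← mul_assoc, c.f_one_mul_l]) (by rw [mul_assoc, f_one_mul])

/-- The coordinates of `e`, as a row. -/
noncomputable def row (p : Fin 2) : B := c.inv (c.f 1 * c.r p)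

lemma f_row (p : Fin 2) : c.f (c.row p) = c.f 1 * c.r p :=
  c.f_inv (by rw [← mul_assoc, f_one_mul]) (by rw [mul_assoc, c.r_mul_f_one])

lemma sum_mul_mul (x y : A) : ∑ p, x * c.r p * (c.l p * y) = x * y := by
  have : ∀ p, x * c.r p * (c.l p * y) = x * (c.r p * c.l p) * y := fun p => by simp only [mul_assoc]
  simp only [this]
  rw [← Finset.sum_mul, ← Finset.mul_sum, c.sum_eq_one, mul_one]

lemma co_mul (x y : A) (p q : Fin 2) : c.co (x * y) p q = ∑ k, c.co x p k * c.co y k q := by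
  refine c.inj ?_
  rw [map_sum]
  simp only [map_mul, f_co]
  have : ∀ k, c.l p * x * c.r k * (c.l k * y * c.r q) = c.l p * x * c.r k * (c.l k * (y * c.r q)) :=
    fun k => by simp only [mul_assoc]
  simp only [this, sum_mul_mul]
  simp only [mul_assoc]

lemma co_add (x y : A) (p q : Fin 2) : c.co (x + y) p q = c.co x p q + c.co y p q := by
  refine c.inj ?_
  simp only [map_add, f_co, mul_add, add_mul]

lemma co_zero (p q : Fin 2) : c.co 0 p q = 0 := by
  refine c.inj ?_
  simp only [f_co, mul_zero, zero_mul, map_zero]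

lemma sum_row_mul_col : ∑ p, c.row p * c.col p = 1 := by
  refine c.inj ?_
  rw [map_sum]
  simp only [map_mul, f_row, f_col, sum_mul_mul, f_one_mul]

lemma col_mul_row (p q : Fin 2) : c.col p * c.row q = c.co (c.f 1) p q := by
  refine c.inj ?_
  rw [map_mul, f_row, f_col, f_co, ← mul_assoc, mul_assoc _ _ (c.f 1), f_one_mul]

lemma sum_co_mul_col (y : A) (hy : y * c.f 1 = y) (p : Fin 2) (b : B) (hb : c.f b = c.l p * y) :
    ∑ q, c.co y p q * c.col q = b := by
  refine c.inj ?_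
  rw [map_sum]
  simp only [map_mul, f_co, f_col, sum_mul_mul, hb]
  rw [mul_assoc, hy]

section

variable (M : Type u) [AddCommGroup M] [Module A M]

/-- The subgroup `eM`. -/
def sub : AddSubgroup M where
  carrier := {m | c.f 1 • m = m}
  zero_mem' := smul_zero _
  add_mem' {m n} hm hn := by
    change _ • _ = _
    rw [smul_add, hm, hn]
  neg_mem' {m} hm := by
    change _ • _ = _
    rw [smul_neg, hm]

/-- The `B`-module `eM`. -/
def Sub : Type u := c.sub M

instance : AddCommGroup (c.Sub M) := inferInstanceAs (AddCommGroup (c.sub M))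

instance : Module B (c.Sub M) where
  smul b m := ⟨c.f b • m.1, by change _ • _ = _; rw [smul_smul, f_one_mul]⟩
  one_smul m := Subtype.ext m.2
  mul_smul a b m := Subtype.ext (by change c.f _ • _ = c.f a • c.f b • m.1; rw [map_mul, mul_smul])
  smul_zero b := Subtype.ext (smul_zero (c.f b))
  smul_add b m n := Subtype.ext (smul_add (c.f b) m.1 n.1)
  add_smul a b m := Subtype.ext (by
    change c.f _ • _ = c.f a • m.1 + c.f b • m.1; rw [map_add, add_smul])
  zero_smul m := Subtype.ext (by change c.f 0 • m.1 = 0; rw [map_zero, zero_smul])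

variable {M}

lemma sum_val (f : Fin 2 → c.Sub M) : (∑ q, f q).1 = ∑ q, (f q).1 :=
  map_sum (AddMonoidHom.mk' (fun m : c.Sub M => m.1) fun _ _ => rfl) f Finset.univ

lemma smul_val (b : B) (m : c.Sub M) : (b • m).1 = c.f b • m.1 := rfl

/-- `yn` as an element of `eM`, for `y ∈ eA`. -/
def smulSub (y : A) (hy : c.f 1 * y = y) (m : M) : c.Sub M :=
  ⟨y • m, by change _ • _ = _; rw [smul_smul, hy]⟩

lemma sum_smul (m : M) : ∑ p, c.r p • c.l p • m = m := by
  simp only [smul_smul]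
  rw [← Finset.sum_smul, c.sum_eq_one, one_smul]

/-- The restriction of a homomorphism of modules to `eM`. -/
def mapSub {N : Type u} [AddCommGroup N] [Module A N] (g : M →ₗ[A] N) : c.Sub M →ₗ[B] c.Sub N where
  toFun m := ⟨g m.1, by
    change _ • _ = _
    rw [← map_smul]; exact congrArg g m.2⟩
  map_add' m n := Subtype.ext (map_add g m.1 n.1)
  map_smul' b m := Subtype.ext (map_smul g (c.f b) m.1)

lemma mapSub_injective {N : Type u} [AddCommGroup N] [Module A N] {g g' : M →ₗ[A] N}
    (h : c.mapSub g = c.mapSub g') : g = g' := by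
  ext m
  rw [← c.sum_smul m, map_sum, map_sum]
  refine Finset.sum_congr rfl fun p _ => ?_
  refine (map_smul g _ _).trans (Eq.trans ?_ (map_smul g' _ _).symm)
  exact congrArg (fun k => c.r p • (k (c.smulSub (c.l p) (c.f_one_mul_l p) m)).1) h

lemma mapSub_surjective {N : Type u} [AddCommGroup N] [Module A N] (g : c.Sub M →ₗ[B] c.Sub N) :
    ∃ g' : M →ₗ[A] N, c.mapSub g' = g := by
  let s := fun p => c.smulSub (M := M) (c.l p) (c.f_one_mul_l p)
  have hs : ∀ p a m, s p (a • m) = ∑ q, c.co a p q • s q m := fun p a m => Subtype.ext (by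
    have h1 : (∑ q, c.co a p q • s q m : c.Sub M).1 = ∑ q, c.f (c.co a p q) • c.l q • m :=
      c.sum_val _
    rw [h1]
    change c.l p • a • m = _
    simp only [f_co, smul_smul]
    rw [← Finset.sum_smul]
    congr 1
    have := c.sum_mul_mul (c.l p * a) 1
    simpa only [mul_one] using this.symm)
  have hadd : ∀ p m n, s p (m + n) = s p m + s p n := fun p m n => Subtype.ext (smul_add _ m n)
  refine ⟨{ toFun := fun m => ∑ p, c.r p • (g (s p m)).1, map_add' := ?_, map_smul' := ?_ }, ?_⟩
  · intro m n
    rw [← Finset.sum_add_distrib]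
    refine Finset.sum_congr rfl fun p _ => ?_
    rw [hadd, map_add, ← smul_add]
    rfl
  · intro a m
    rw [RingHom.id_apply, Finset.smul_sum]
    have h1 : ∀ p, c.r p • (g (s p (a • m))).1 =
        ∑ q, (c.r p * (c.l p * a) * c.r q) • (g (s q m)).1 := fun p => by
      rw [hs, map_sum, sum_val, Finset.smul_sum]
      refine Finset.sum_congr rfl fun q _ => ?_
      rw [map_smul, smul_val, f_co, smul_smul, ← mul_assoc]
    simp only [h1]
    rw [Finset.sum_comm]
    refine Finset.sum_congr rfl fun q _ => ?_
    rw [← Finset.sum_smul, ← Finset.sum_mul]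
    have := c.sum_mul_mul 1 a
    simp only [one_mul] at this
    rw [this, mul_smul]
  · ext m
    refine Subtype.ext ?_
    change ∑ p, c.r p • (g (s p m.1)).1 = (g m).1
    have h1 : ∀ p, s p m.1 = c.col p • m := fun p => Subtype.ext (by
      rw [smul_val, f_col, mul_smul]
      change _ = c.l p • (c.f 1 • m.1)
      rw [show c.f 1 • m.1 = m.1 from m.2]; rfl)
    have h2 : ∀ p, (g (s p m.1)).1 = c.l p • (g m).1 := fun p => by
      rw [h1, map_smul, smul_val, f_col, mul_smul]
      rw [show c.f 1 • (g m).1 = (g m).1 from (g m).2]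
    simp only [h2]
    exact c.sum_smul _

end

section

variable (N : Type u) [AddCommGroup N] [Module B N]

/-- The action of an element of `A` on pairs of elements of a `B`-module. -/
noncomputable def act (y : A) : (Fin 2 → N) →+ (Fin 2 → N) where
  toFun v p := ∑ q, c.co y p q • v q
  map_zero' := by ext p; simp
  map_add' v w := by ext p; simp [smul_add, Finset.sum_add_distrib]

lemma act_mul (x y : A) (v : Fin 2 → N) : c.act N (x * y) v = c.act N x (c.act N y v) := by
  ext p
  change ∑ q, c.co (x * y) p q • v q = ∑ k, c.co x p k • ∑ q, c.co y k q • v q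
  simp only [co_mul, Finset.sum_smul, Finset.smul_sum, mul_smul]
  exact Finset.sum_comm

/-- The subgroup of pairs that carries the induced module. -/
noncomputable def indSub : AddSubgroup (Fin 2 → N) where
  carrier := {v | c.act N 1 v = v}
  zero_mem' := map_zero _
  add_mem' {m n} hm hn := by
    change c.act N 1 _ = _
    rw [map_add, hm, hn]
  neg_mem' {m} hm := by
    change c.act N 1 _ = _
    rw [map_neg, hm]

/-- The `A`-module induced from a `B`-module. -/
def Ind : Type u := c.indSub N

noncomputable instance : AddCommGroup (c.Ind N) := inferInstanceAs (AddCommGroup (c.indSub N))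

noncomputable instance : Module A (c.Ind N) where
  smul a v := ⟨c.act N a v.1, by change c.act N 1 _ = _; rw [← act_mul, one_mul]⟩
  one_smul v := Subtype.ext v.2
  mul_smul a b v := Subtype.ext (c.act_mul N a b v.1)
  smul_zero a := Subtype.ext (map_zero (c.act N a))
  smul_add a v w := Subtype.ext (map_add (c.act N a) v.1 w.1)
  add_smul a b v := Subtype.ext (funext fun p => by
    change ∑ q, c.co (a + b) p q • v.1 q = ∑ q, c.co a p q • v.1 q + ∑ q, c.co b p q • v.1 q
    simp only [co_add, add_smul, Finset.sum_add_distrib])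
  zero_smul v := Subtype.ext (funext fun p => by
    change ∑ q, c.co 0 p q • v.1 q = 0
    simp only [co_zero, zero_smul, Finset.sum_const_zero])

lemma act_col (y : A) (hy : y * c.f 1 = y) (n : N) (p : Fin 2) (b : B) (hb : c.f b = c.l p * y) :
    c.act N y (fun q => c.col q • n) p = b • n := by
  change ∑ q, c.co y p q • c.col q • n = _
  simp only [smul_smul]
  rw [← Finset.sum_smul, c.sum_co_mul_col y hy p b hb]

lemma act_one_col (n : N) : c.act N 1 (fun q => c.col q • n) = fun q => c.col q • n := by
  ext p
  change ∑ q, c.co 1 p q • c.col q • n = _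
  simp only [smul_smul]
  rw [← Finset.sum_smul]
  congr 1
  refine c.inj ?_
  rw [map_sum]
  simp only [map_mul, f_co, f_col, sum_mul_mul, mul_one]

/-- The corner of the induced module is the original module. -/
noncomputable def indEquiv : N ≃ₗ[B] c.Sub (c.Ind N) where
  toFun n := ⟨⟨fun q => c.col q • n, c.act_one_col N n⟩, Subtype.ext (funext fun p =>
    c.act_col N (c.f 1) (c.f_one_mul 1) n p _ (c.f_col p))⟩
  map_add' m n := Subtype.ext (Subtype.ext (funext fun p => smul_add _ m n))
  map_smul' b n := Subtype.ext (Subtype.ext (funext fun p => by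
    refine (smul_smul _ _ _).trans ?_
    refine (c.act_col N (c.f b) (c.f_mul_one b) n p (c.col p * b) ?_).symm
    rw [map_mul, f_col, mul_assoc, f_one_mul]))
  invFun v := ∑ q, c.row q • v.1.1 q
  left_inv n := by
    change ∑ q, c.row q • c.col q • n = n
    simp only [smul_smul]
    rw [← Finset.sum_smul, sum_row_mul_col, one_smul]
  right_inv v := by
    refine Subtype.ext (Subtype.ext (funext fun p => ?_))
    change c.col p • ∑ q, c.row q • v.1.1 q = v.1.1 p
    rw [Finset.smul_sum]
    simp only [smul_smul, col_mul_row]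
    exact congrFun (congrArg Subtype.val v.2) p

end

/-- The functor `M ↦ eM`. -/
def functor : ModuleCat.{u} A ⥤ ModuleCat.{u} B where
  obj M := ModuleCat.of B (c.Sub M)
  map g := ModuleCat.ofHom (c.mapSub g.hom)
  map_id _ := rfl
  map_comp _ _ := rfl

instance : c.functor.Faithful where
  map_injective h := ModuleCat.hom_ext (c.mapSub_injective (congrArg ModuleCat.Hom.hom h))

instance : c.functor.Full where
  map_surjective g := by
    obtain ⟨g', hg'⟩ := c.mapSub_surjective g.hom
    exact ⟨ModuleCat.ofHom g', ModuleCat.hom_ext hg'⟩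

instance : c.functor.EssSurj where
  mem_essImage N := ⟨ModuleCat.of A (c.Ind N), ⟨(c.indEquiv N).toModuleIso.symm⟩⟩

instance : c.functor.IsEquivalence where

instance : c.functor.Linear ℝ where
  map_smul g r := by
    refine ModuleCat.hom_ext (LinearMap.ext fun m => Subtype.ext ?_)
    change algebraMap ℝ A r • g.hom m.1 = c.f (algebraMap ℝ B r) • g.hom m.1
    rw [Algebra.algebraMap_eq_smul_one, Algebra.algebraMap_eq_smul_one, map_smul, ← map_smul, ← map_smul]
    congr 1
    rw [smul_assoc, smul_assoc, one_smul]
    exact congrArg (r • ·) m.2.symm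

theorem isMoritaEquivalent {A B : Type u} [Ring A] [Algebra ℝ A] [Ring B] [Algebra ℝ B]
    (c : FullCorner A B) : IsMoritaEquivalent ℝ A B :=
  ⟨⟨⟨c.functor.asEquivalence, inferInstanceAs (c.functor.Linear ℝ)⟩⟩⟩

end FullCorner

lemma ringCon_mk'_eq_zero_iff {R : Type*} [Ring R] (I : TwoSidedIdeal R) (x : R) :
    I.ringCon.mk' x = 0 ↔ x ∈ I := by
  rw [← TwoSidedIdeal.mem_ker, TwoSidedIdeal.ker_ringCon_mk']

namespace ClannishDatum

variable (D : ClannishDatum.{u})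

/-- The quotient map `ℂ_σ Q → ℂ_σ Q/⟨S ∪ Z⟩`. -/
noncomputable def toAlg : D.PathAlg →ₙₐ[ℝ] D.Alg where
  toFun := (TwoSidedIdeal.span (D.S ∪ D.ZElements)).ringCon.mk'
  map_smul' _ _ := rfl
  map_zero' := map_zero _
  map_add' := map_add _
  map_mul' := map_mul _

lemma toAlg_eq_zero_iff (x : D.PathAlg) :
    D.toAlg x = 0 ↔ x ∈ TwoSidedIdeal.span (D.S ∪ D.ZElements) := ringCon_mk'_eq_zero_iff _ x

lemma exists_proj : ∃ P : D.LoopAlg →ₙₐ[ℝ] D.Alg, ∀ x, P (D.toLoopAlg x) = D.toAlg x :=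
  exists_quotient_lift _ D.toAlg fun x hx =>
    (D.toAlg_eq_zero_iff x).mpr (TwoSidedIdeal.span_mono Set.subset_union_left hx)

/-- The projection `ℂ_σ Q/⟨S⟩ → ℂ_σ Q/⟨S ∪ Z⟩`. -/
noncomputable def proj : D.LoopAlg →ₙₐ[ℝ] D.Alg := D.exists_proj.choose

lemma proj_toLoopAlg (x : D.PathAlg) : D.proj (D.toLoopAlg x) = D.toAlg x :=
  D.exists_proj.choose_spec x

lemma proj_surjective : Function.Surjective D.proj := fun y => by
  obtain ⟨x, rfl⟩ := RingCon.mk'_surjective _ y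
  exact ⟨D.toLoopAlg x, D.proj_toLoopAlg x⟩

lemma proj_one : D.proj 1 = 1 := by
  rw [← map_one D.toLoopAlg, proj_toLoopAlg]
  exact map_one (TwoSidedIdeal.span (D.S ∪ D.ZElements)).ringCon.mk'

lemma proj_eq_zero_iff (x : D.LoopAlg) : D.proj x = 0 ↔ x ∈ D.zIdeal := by
  constructor
  · obtain ⟨y, rfl⟩ := D.toLoopAlg_surjective x
    rw [proj_toLoopAlg, toAlg_eq_zero_iff, ← TwoSidedIdeal.mem_comap (f := D.toLoopAlg)]
    refine fun h => TwoSidedIdeal.span_le.mpr ?_ h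
    rintro z (hz | hz)
    · refine (TwoSidedIdeal.mem_comap _).mpr ?_
      rw [(D.toLoopAlg_eq_zero_iff z).mpr (TwoSidedIdeal.subset_span hz)]
      exact zero_mem _
    · exact (TwoSidedIdeal.mem_comap _).mpr (TwoSidedIdeal.subset_span ⟨z, hz, rfl⟩)
  · intro h
    have : D.zIdeal ≤ TwoSidedIdeal.ker D.proj := by
      refine TwoSidedIdeal.span_le.mpr ?_
      rintro _ ⟨z, hz, rfl⟩
      refine (TwoSidedIdeal.mem_ker _).mpr ?_
      rw [proj_toLoopAlg, toAlg_eq_zero_iff]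
      exact TwoSidedIdeal.subset_span (Or.inr hz)
    exact (TwoSidedIdeal.mem_ker _).mp (this h)

lemma exists_quotPsi : ∃ f : D.basic.Quot D.bIdeal →ₙₐ[ℝ] D.Alg,
    ∀ x, f (D.bIdeal.ringCon.mk' x) = D.proj (D.Psi x) :=
  exists_quotient_lift _ (D.proj.comp D.Psi) fun x hx =>
    (D.proj_eq_zero_iff _).mpr ((D.mem_bIdeal x).mp hx)

lemma vfun_one_mul_lcoord {B : Type*} [Ring B] [Algebra ℝ B] {x : DivKind} {J e s : B}
    (h : IsVertex x J e s) (p : Fin 2) :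
    vfun x J e s 1 * lcoord x J e s p = lcoord x J e s p := by
  have h1 := h.vfun_mul 1 1
  rw [mul_one] at h1
  fin_cases p
  · exact h1.symm
  · simp only [lcoord, Fin.mk_one, Matrix.cons_val_one, Matrix.cons_val_fin_one]
    split_ifs
    · rw [mul_neg, ← mul_assoc, ← h1]
    · exact mul_zero _

lemma rcoord_mul_vfun_one {B : Type*} [Ring B] [Algebra ℝ B] {x : DivKind} {J e s : B}
    (h : IsVertex x J e s) (p : Fin 2) :
    rcoord x J e s p * vfun x J e s 1 = rcoord x J e s p := by
  have h1 := h.vfun_mul 1 1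
  rw [mul_one] at h1
  fin_cases p
  · exact h1.symm
  · simp only [rcoord, Fin.mk_one, Matrix.cons_val_one, Matrix.cons_val_fin_one]
    split_ifs
    · rw [mul_assoc, ← h1]
    · exact zero_mul _

lemma eps_mul_lvec (p : Fin 2) : D.eps * D.lvec p = D.lvec p := by
  rw [lvec, Finset.mul_sum]
  refine Finset.sum_congr rfl fun v _ => ?_
  rw [← e_mul_lcoord (D.isVertex v), ← mul_assoc, ← lvec_zero, lvec_mul_ve,
    e_mul_lcoord (D.isVertex v)]
  exact vfun_one_mul_lcoord (D.isVertex v) p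

lemma rvec_mul_eps (p : Fin 2) : D.rvec p * D.eps = D.rvec p := by
  rw [rvec, Finset.sum_mul]
  refine Finset.sum_congr rfl fun v _ => ?_
  rw [← rcoord_mul_e (D.isVertex v), mul_assoc, ← rvec_zero, ve_mul_rvec,
    rcoord_mul_e (D.isVertex v)]
  exact rcoord_mul_vfun_one (D.isVertex v) p

/-- The algebra `T(Q^b, M)/I` as a full corner of `ℂ_σ Q/⟨S ∪ Z⟩`. -/
noncomputable def fullCorner : FullCorner D.Alg (D.basic.Quot D.bIdeal) :=
  have h1 : D.exists_quotPsi.choose 1 = D.proj D.eps := by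
    rw [← D.Psi_one, ← D.exists_quotPsi.choose_spec, map_one D.bIdeal.ringCon.mk']
  { f := D.exists_quotPsi.choose
    inj := by
      rw [injective_iff_map_eq_zero]
      intro y hy
      obtain ⟨x, rfl⟩ := RingCon.mk'_surjective _ y
      rw [D.exists_quotPsi.choose_spec, proj_eq_zero_iff, ← mem_bIdeal] at hy
      exact (ringCon_mk'_eq_zero_iff _ x).mpr hy
    surj := fun y => by
      obtain ⟨y, rfl⟩ := D.proj_surjective y
      rw [h1, ← map_mul, ← map_mul]
      have : D.eps * y * D.eps ∈ Set.range D.Psi := by rw [range_Psi]; exact ⟨y, rfl⟩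
      obtain ⟨x, hx⟩ := this
      exact ⟨D.bIdeal.ringCon.mk' x, by rw [D.exists_quotPsi.choose_spec, hx]⟩
    l := fun p => D.proj (D.lvec p)
    r := fun p => D.proj (D.rvec p)
    f_one_mul_l := fun p => by rw [h1, ← map_mul, eps_mul_lvec]
    r_mul_f_one := fun p => by rw [h1, ← map_mul, rvec_mul_eps]
    sum_eq_one := by
      simp only [← map_mul]
      rw [← map_sum, sum_rvec_mul_lvec, proj_one] }

lemma isMoritaEquivalent : IsMoritaEquivalent ℝ D.Alg (D.basic.Quot D.bIdeal) :=
  D.fullCorner.isMoritaEquivalent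

end ClannishDatum

namespace ClannishDatum

variable (D : ClannishDatum.{u})

/-- `f` is a possible image of the arrow `γ`, over a representation `φ`. -/
structure ArrowImage {B : Type*} [Ring B] [Algebra ℝ B] (φ : D.LoopAlg →ₙₐ[ℝ] B) (γ : D.Q.E) (f : B) :
    Prop where
  left : φ (D.ve (D.Q.t γ)) * f = f
  right : f * φ (D.ve (D.Q.s γ)) = f
  comm : D.σ γ = AlgEquiv.refl → f * φ D.im = φ D.im * f
  anti : D.σ γ ≠ AlgEquiv.refl → f * φ D.im = -(φ D.im * f)

variable {D}

/-- A representation by upper triangular matrices in which only two given arrows act between the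
layers. -/
lemma exists_layers (hD : D.IsGentleType) {B : Type*} [Ring B] [Algebra ℝ B]
    (φ : D.LoopAlg →ₙₐ[ℝ] B) {α β : D.Q.E} (hα : α ∉ D.special) (hβ : β ∉ D.special) {f g : B}
    (hf : D.ArrowImage φ α f) (hg : D.ArrowImage φ β g) (hZ : [α, β] ∈ D.Z → f * g = 0) :
    ∃ ρ : D.LoopAlg →ₙₐ[ℝ] Matrix (Fin 3) (Fin 3) B,
      (ρ D.im = Matrix.diagonal fun _ => φ D.im) ∧
      (∀ v, ρ (D.ve v) = Matrix.diagonal fun _ => φ (D.ve v)) ∧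
      (∀ v, ρ (D.spl v) = Matrix.diagonal fun _ => φ (D.spl v)) ∧
      (∃ z, ρ (D.ar α) = !![0, f, 0; 0, 0, z; 0, 0, 0]) ∧
      (∃ z, ρ (D.ar β) = !![0, z, 0; 0, 0, g; 0, 0, 0]) ∧
      ∀ x ∈ D.zIdeal, ρ x = 0 := by
  classical
  let lay : D.Q.E → Matrix (Fin 3) (Fin 3) B := fun γ =>
    if γ ∈ D.special then Matrix.diagonal fun _ => φ (D.ar γ)
    else !![0, if γ = α then f else 0, 0; 0, 0, if γ = β then g else 0; 0, 0, 0]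
  have hs : ∀ γ ∈ D.special, lay γ = Matrix.diagonal fun _ => φ (D.ar γ) := fun γ h => if_pos h
  have ho : ∀ γ ∉ D.special, lay γ =
      !![0, if γ = α then f else 0, 0; 0, 0, if γ = β then g else 0; 0, 0, 0] := fun γ h => if_neg h
  obtain ⟨ρ, hJ, he, ha⟩ := D.exists_loopAlg_lift (B := Matrix (Fin 3) (Fin 3) B)
    (Matrix.diagonal fun _ => φ D.im) (fun v => Matrix.diagonal fun _ => φ (D.ve v)) lay
    (fun i => by rw [Matrix.diagonal_mul_diagonal]; simp only [← map_mul, D.ve_mul_self])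
    (fun i j h => by
      rw [Matrix.diagonal_mul_diagonal]; simp only [← map_mul, D.ve_mul_of_ne h, map_zero]
      exact Matrix.diagonal_zero)
    (by
      rw [Finset.sum_mul]
      simp only [Matrix.diagonal_mul_diagonal, ← map_mul]
      ext i j
      rw [Matrix.sum_apply]
      by_cases h : i = j
      · subst h
        simp only [Matrix.diagonal_apply_eq]
        rw [← map_sum, ← Finset.sum_mul, sum_ve, one_mul]
      · simp [Matrix.diagonal_apply_ne _ h])
    (by
      simp only [Matrix.diagonal_mul_diagonal, ← map_mul, im_mul_im]
      ext i j
      rw [Matrix.neg_apply, Matrix.sum_apply]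
      by_cases h : i = j
      · subst h
        simp only [Matrix.diagonal_apply_eq]
        rw [← map_sum, sum_ve, map_neg]
      · simp [Matrix.diagonal_apply_ne _ h])
    (fun i => by
      simp only [Matrix.diagonal_mul_diagonal, ← map_mul, D.ve_mul_im])
    (fun γ => by
      by_cases h : γ ∈ D.special
      · rw [hs γ h, Matrix.diagonal_mul_diagonal]; simp only [← map_mul, D.ve_mul_ar]
      · rw [ho γ h]
        ext i j
        rw [Matrix.diagonal_mul]
        fin_cases i <;> fin_cases j <;> simp
        · split_ifs with h1
          · subst h1; exact hf.left
          · rfl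
        · split_ifs with h1
          · subst h1; exact hg.left
          · rfl)
    (fun γ => by
      by_cases h : γ ∈ D.special
      · rw [hs γ h, Matrix.diagonal_mul_diagonal]; simp only [← map_mul, D.ar_mul_ve]
      · rw [ho γ h]
        ext i j
        rw [Matrix.mul_diagonal]
        fin_cases i <;> fin_cases j <;> simp
        · split_ifs with h1
          · subst h1; exact hf.right
          · rfl
        · split_ifs with h1
          · subst h1; exact hg.right
          · rfl)
    (fun γ hγ => by
      by_cases h : γ ∈ D.special
      · exact absurd ((D.twist γ h).symm.trans hγ) conj_ne_refl
      · rw [ho γ h]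
        ext i j
        rw [Matrix.mul_diagonal, Matrix.diagonal_mul]
        fin_cases i <;> fin_cases j <;> simp
        · split_ifs with h1
          · subst h1; exact hf.comm hγ
          · simp
        · split_ifs with h1
          · subst h1; exact hg.comm hγ
          · simp)
    (fun γ hγ => by
      by_cases h : γ ∈ D.special
      · rw [hs γ h, Matrix.diagonal_mul_diagonal, Matrix.diagonal_mul_diagonal]
        simp only [← map_mul, D.ar_mul_im_of_ne γ hγ, map_neg]
        exact (Matrix.diagonal_neg _).symm
      · rw [ho γ h]
        ext i j
        rw [Matrix.neg_apply, Matrix.mul_diagonal, Matrix.diagonal_mul]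
        fin_cases i <;> fin_cases j <;> simp
        · split_ifs with h1
          · subst h1; exact hf.anti hγ
          · simp
        · split_ifs with h1
          · subst h1; exact hg.anti hγ
          · simp)
    (fun l hl => by
      rw [hs l (Or.inl hl), Matrix.diagonal_mul_diagonal]
      simp only [← map_mul, D.ar_mul_self_of_mem_SR hl])
    (fun l hl => by
      rw [hs l (Or.inr hl), Matrix.diagonal_mul_diagonal]
      simp only [← map_mul, D.ar_mul_self_of_mem_SH hl, map_neg]
      exact (Matrix.diagonal_neg _).symm)
  refine ⟨ρ, hJ, he, ?_, ?_, ?_, ?_⟩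
  · intro v
    by_cases h : ∃ l ∈ D.special, D.Q.s l = v
    · obtain ⟨l, hl, rfl⟩ := h
      rw [D.spl_of_special hl, ha, hs l hl]
    · rw [spl, dif_neg h, map_zero, map_zero]
      exact Matrix.diagonal_zero.symm
  · rw [ha, ho α hα, if_pos rfl]
    exact ⟨_, rfl⟩
  · rw [ha, ho β hβ, if_pos rfl]
    exact ⟨_, rfl⟩
  · intro x hx
    have : D.zIdeal ≤ TwoSidedIdeal.ker ρ := by
      rw [zIdeal_eq hD]
      refine TwoSidedIdeal.span_le.mpr ?_
      rintro _ ⟨γ, δ, h, rfl⟩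
      refine (TwoSidedIdeal.mem_ker _).mpr ?_
      rw [map_mul, ha, ha, ho γ (D.left_ordinary h), ho δ (D.right_ordinary h)]
      ext i j
      fin_cases i <;> fin_cases j <;> simp [Matrix.mul_apply, Fin.sum_univ_three]
      rintro rfl rfl
      exact hZ h
    exact (TwoSidedIdeal.mem_ker _).mp (this hx)

end ClannishDatum

/-! ### Representations that detect paths of length two -/

/-- The endomorphisms of a complex plane, over `ℝ`. -/
abbrev PlaneEnd : Type := Matrix (Fin 2) (Fin 2) (Matrix (Fin 2) (Fin 2) ℝ)

namespace PlaneEnd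

/-- Multiplication by `𝐢` on a line. -/
def lineI : Matrix (Fin 2) (Fin 2) ℝ := !![0, -1; 1, 0]

/-- Complex conjugation on a line. -/
def conj : Matrix (Fin 2) (Fin 2) ℝ := !![1, 0; 0, -1]

lemma lineI_mul_lineI : lineI * lineI = -1 := by
  ext i j; fin_cases i <;> fin_cases j <;> simp [lineI]

lemma conj_mul_conj : conj * conj = 1 := by
  ext i j; fin_cases i <;> fin_cases j <;> simp [conj]

lemma conj_mul_lineI : conj * lineI = -(lineI * conj) := by
  ext i j; fin_cases i <;> fin_cases j <;> simp [conj, lineI]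

/-- Multiplication by `𝐢` on the plane. -/
def planeI : PlaneEnd := !![lineI, 0; 0, lineI]

/-- The semilinear map with square `r` that swaps the two coordinate lines. -/
def swap (r : ℝ) : PlaneEnd := !![0, conj; r • conj, 0]

lemma planeI_mul_planeI : planeI * planeI = -1 := by
  ext1 i j; fin_cases i <;> fin_cases j <;>
    simp [planeI, Matrix.mul_apply, Fin.sum_univ_two, lineI_mul_lineI]

lemma swap_mul_planeI (r : ℝ) : swap r * planeI = -(planeI * swap r) := by
  ext1 i j; fin_cases i <;> fin_cases j <;>
    simp [planeI, swap, Matrix.mul_apply, Fin.sum_univ_two, conj_mul_lineI]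

lemma swap_mul_swap (r : ℝ) : swap r * swap r = r • 1 := by
  ext1 i j; fin_cases i <;> fin_cases j <;>
    simp [swap, Matrix.mul_apply, Fin.sum_univ_two, conj_mul_conj]

end PlaneEnd

open PlaneEnd

namespace ClannishDatum

variable (D : ClannishDatum.{u})

open Classical in
/-- The linear or semilinear map given by the twist of an arrow. -/
noncomputable def twistMap (γ : D.Q.E) : Matrix (Fin 2) (Fin 2) ℝ :=
  if D.σ γ = AlgEquiv.refl then 1 else conj

lemma twistMap_mul_lineI {γ : D.Q.E} (h : D.σ γ = AlgEquiv.refl) :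
    D.twistMap γ * lineI = lineI * D.twistMap γ := by
  rw [twistMap, if_pos h, one_mul, mul_one]

lemma twistMap_mul_lineI_of_ne {γ : D.Q.E} (h : D.σ γ ≠ AlgEquiv.refl) :
    D.twistMap γ * lineI = -(lineI * D.twistMap γ) := by
  rw [twistMap, if_neg h, conj_mul_lineI]

lemma isUnit_twistMap (γ : D.Q.E) : IsUnit (D.twistMap γ) := by
  unfold twistMap; split_ifs
  · exact isUnit_one
  · exact .of_mul_eq_one _ conj_mul_conj

open Classical in
/-- The map given by a special loop. -/
noncomputable def loopMap (γ : D.Q.E) : PlaneEnd :=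
  if γ ∈ D.SR then swap 1 else if γ ∈ D.SH then swap (-1) else 0

open Classical in
/-- A representation with a plane at each vertex, in which all ordinary arrows act as zero. -/
lemma exists_planes : ∃ φ : D.LoopAlg →ₙₐ[ℝ] Matrix D.Q.V D.Q.V PlaneEnd,
    φ D.im = (Matrix.diagonal fun _ => planeI) ∧ (∀ v, φ (D.ve v) = Matrix.single v v 1) ∧
    ∀ γ, φ (D.ar γ) = Matrix.single (D.Q.t γ) (D.Q.s γ) (D.loopMap γ) := by
  have hone : ∑ i, Matrix.single i i (1 : PlaneEnd) = (1 : Matrix D.Q.V D.Q.V PlaneEnd) := by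
    ext1 i j
    rw [Matrix.sum_apply]
    by_cases h : i = j
    · subst h
      simp [Matrix.single_apply]
    · simp only [Matrix.one_apply_ne h, Matrix.single_apply]
      refine Finset.sum_eq_zero fun k _ => if_neg ?_
      rintro ⟨rfl, rfl⟩; exact h rfl
  refine D.exists_loopAlg_lift _ _ _ (fun i => by simp) (fun i j h => by simp [h])
    (by rw [hone, one_mul]) ?_ (fun i => ?_) (fun γ => by simp) (fun γ => by simp) (fun γ h => ?_)
    (fun γ _ => ?_) (fun l hl => ?_) (fun l hl => ?_)
  · rw [hone, Matrix.diagonal_mul_diagonal, planeI_mul_planeI]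
    ext1 i j
    by_cases h : i = j
    · subst h; simp
    · simp [h]
  · ext1 j k
    rw [Matrix.mul_diagonal, Matrix.diagonal_mul, Matrix.single_apply]
    split_ifs <;> simp
  · ext1 j k
    rw [Matrix.mul_diagonal, Matrix.diagonal_mul, Matrix.single_apply]
    have : D.loopMap γ = 0 := by
      rw [loopMap, if_neg, if_neg]
      · exact fun hl => conj_ne_refl ((D.twist γ (Or.inr hl)).symm.trans h)
      · exact fun hl => conj_ne_refl ((D.twist γ (Or.inl hl)).symm.trans h)
    simp [this]
  · ext1 j k
    rw [Matrix.neg_apply, Matrix.mul_diagonal, Matrix.diagonal_mul, Matrix.single_apply]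
    split_ifs
    · unfold loopMap
      split_ifs
      · exact swap_mul_planeI _
      · exact swap_mul_planeI _
      · simp
    · simp
  · rw [D.isLoop l (Or.inl hl), Matrix.single_mul_single_same, loopMap, if_pos hl, swap_mul_swap,
      one_smul]
  · rw [D.isLoop l (Or.inr hl), Matrix.single_mul_single_same, loopMap, if_pos hl, if_neg,
      swap_mul_swap]
    · ext1 j k
      rw [Matrix.neg_apply, Matrix.single_apply, Matrix.single_apply]
      split_ifs <;> simp
    · exact fun h => Set.disjoint_left.mp D.disjoint h hl

open Classical in
/-- An image for the arrow `γ` over the representation by planes. -/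
lemma arrowImage_single {φ : D.LoopAlg →ₙₐ[ℝ] Matrix D.Q.V D.Q.V PlaneEnd}
    (hJ : φ D.im = (Matrix.diagonal fun _ => planeI))
    (he : ∀ v, φ (D.ve v) = Matrix.single v v 1) (γ : D.Q.E) {k : PlaneEnd}
    (hk : D.σ γ = AlgEquiv.refl → k * planeI = planeI * k)
    (hk' : D.σ γ ≠ AlgEquiv.refl → k * planeI = -(planeI * k)) :
    D.ArrowImage φ γ (Matrix.single (D.Q.t γ) (D.Q.s γ) k) where
  left := by rw [he]; simp
  right := by rw [he]; simp
  comm h := by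
    rw [hJ]
    ext1 i j
    rw [Matrix.mul_diagonal, Matrix.diagonal_mul, Matrix.single_apply]
    split_ifs
    · exact hk h
    · simp
  anti h := by
    rw [hJ]
    ext1 i j
    rw [Matrix.neg_apply, Matrix.mul_diagonal, Matrix.diagonal_mul, Matrix.single_apply]
    split_ifs
    · exact hk' h
    · simp

lemma isUnit_conj : IsUnit conj := .of_mul_eq_one _ conj_mul_conj

/-- A corner entry of a product of upper triangular matrices. -/
lemma corner_entry {B : Type*} [Ring B] (f z w g : B) :
    (!![0, f, 0; 0, 0, z; 0, 0, 0] * !![0, w, 0; 0, 0, g; 0, 0, 0] : Matrix (Fin 3) (Fin 3) B) 0 2 =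
      f * g := by
  simp [Matrix.mul_apply, Fin.sum_univ_three]

/-- A corner entry of a product of upper triangular matrices. -/
lemma corner_entry_diagonal {B : Type*} [Ring B] (f z w g s : B) :
    (!![0, f, 0; 0, 0, z; 0, 0, 0] * (Matrix.diagonal fun _ => s) * !![0, w, 0; 0, 0, g; 0, 0, 0] :
      Matrix (Fin 3) (Fin 3) B) 0 2 = f * s * g := by
  simp [Matrix.mul_apply, Fin.sum_univ_three, Matrix.mul_diagonal]

variable {D}

lemma ar_mul_ar_notMem (hD : D.IsGentleType) {α β : D.Q.E} (hα : α ∉ D.special)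
    (hβ : β ∉ D.special) (h : D.Q.s α = D.Q.t β) (hZ : [α, β] ∉ D.Z) :
    D.ar α * D.ar β ∉ D.zIdeal := by
  classical
  intro hmem
  obtain ⟨φ, hJ, he, -⟩ := D.exists_planes
  have hf := D.arrowImage_single hJ he α (k := !![D.twistMap α, 0; 0, 0])
    (fun h => by ext1 i j; fin_cases i <;> fin_cases j <;>
      simp [planeI, Matrix.mul_apply, Fin.sum_univ_two, D.twistMap_mul_lineI h])
    (fun h => by ext1 i j; fin_cases i <;> fin_cases j <;>
      simp [planeI, Matrix.mul_apply, Fin.sum_univ_two, D.twistMap_mul_lineI_of_ne h])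
  have hg := D.arrowImage_single hJ he β (k := !![D.twistMap β, 0; 0, 0])
    (fun h => by ext1 i j; fin_cases i <;> fin_cases j <;>
      simp [planeI, Matrix.mul_apply, Fin.sum_univ_two, D.twistMap_mul_lineI h])
    (fun h => by ext1 i j; fin_cases i <;> fin_cases j <;>
      simp [planeI, Matrix.mul_apply, Fin.sum_univ_two, D.twistMap_mul_lineI_of_ne h])
  obtain ⟨ρ, -, -, -, ⟨z, hz⟩, ⟨w, hw⟩, hρ⟩ :=
    exists_layers hD φ hα hβ hf hg (fun h => absurd h hZ)
  have h1 := congrFun₂ (hρ _ hmem) 0 2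
  rw [map_mul, hz, hw, corner_entry, h, Matrix.single_mul_single_same] at h1
  have h3 := congrFun₂ h1 (D.Q.t α) (D.Q.s β)
  rw [Matrix.single_apply_same] at h3
  have h2 := congrFun₂ h3 0 0
  simp [Matrix.mul_apply, Fin.sum_univ_two] at h2
  exact ((D.isUnit_twistMap α).mul (D.isUnit_twistMap β)).ne_zero h2

lemma ar_mul_spl_mul_ar_notMem (hD : D.IsGentleType) {α β : D.Q.E} (hα : α ∉ D.special)
    (hβ : β ∉ D.special) (h : D.Q.s α = D.Q.t β) (hv : D.kind (D.Q.s α) ≠ .C) :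
    D.ar α * D.spl (D.Q.s α) * D.ar β ∉ D.zIdeal := by
  classical
  intro hmem
  obtain ⟨φ, hJ, he, hs⟩ := D.exists_planes
  have hf := D.arrowImage_single hJ he α (k := !![0, D.twistMap α; 0, 0])
    (fun h => by ext1 i j; fin_cases i <;> fin_cases j <;>
      simp [planeI, Matrix.mul_apply, Fin.sum_univ_two, D.twistMap_mul_lineI h])
    (fun h => by ext1 i j; fin_cases i <;> fin_cases j <;>
      simp [planeI, Matrix.mul_apply, Fin.sum_univ_two, D.twistMap_mul_lineI_of_ne h])
  have hg := D.arrowImage_single hJ he β (k := !![D.twistMap β, 0; 0, 0])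
    (fun h => by ext1 i j; fin_cases i <;> fin_cases j <;>
      simp [planeI, Matrix.mul_apply, Fin.sum_univ_two, D.twistMap_mul_lineI h])
    (fun h => by ext1 i j; fin_cases i <;> fin_cases j <;>
      simp [planeI, Matrix.mul_apply, Fin.sum_univ_two, D.twistMap_mul_lineI_of_ne h])
  obtain ⟨ρ, -, -, hspl, ⟨z, hz⟩, ⟨w, hw⟩, hρ⟩ := exists_layers hD φ hα hβ hf hg (fun _ => by
    have h0 : (!![0, D.twistMap α; 0, 0] * !![D.twistMap β, 0; 0, 0] : PlaneEnd) = 0 := by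
      ext1 i j; fin_cases i <;> fin_cases j <;> simp [Matrix.mul_apply, Fin.sum_univ_two]
    rw [h, Matrix.single_mul_single_same, h0, Matrix.single_zero])
  obtain ⟨l, hl, hlv⟩ := (D.kind_ne_C_iff _).mp hv
  have hsv : φ (D.spl (D.Q.s α)) = Matrix.single (D.Q.s α) (D.Q.s α) (D.loopMap l) := by
    rw [← hlv, D.spl_of_special hl, hs, D.isLoop l hl]
  have h1 := congrFun₂ (hρ _ hmem) 0 2
  rw [map_mul, map_mul, hspl, hz, hw, corner_entry_diagonal, hsv, h, Matrix.single_mul_single_same,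
    Matrix.single_mul_single_same] at h1
  have h3 := congrFun₂ h1 (D.Q.t α) (D.Q.s β)
  rw [Matrix.single_apply_same] at h3
  have h2 := congrFun₂ h3 0 0
  have key : IsUnit (D.loopMap l 1 0) := by
    unfold loopMap
    split_ifs with h3 h4
    · simpa [swap] using isUnit_conj
    · simpa [swap] using isUnit_conj
    · exact (hl.elim h3 h4).elim
  simp only [Matrix.mul_apply, Fin.sum_univ_two] at h2
  simp at h2
  exact (((D.isUnit_twistMap α).mul key).mul (D.isUnit_twistMap β)).ne_zero h2

end ClannishDatum

lemma SimpleBimod.arrfun_mem {N : Type*} [AddCommGroup N] (S : AddSubgroup N) {x y : DivKind}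
    (b : SimpleBimod x y) {A : x.carrier → y.carrier → N} (h : ∀ p q, A p q ∈ S) (m : b.carrier) :
    b.arrfun A m ∈ S := by
  cases b with
  | HH => exact sub_mem (h _ _) (h _ _)
  | HC => exact sub_mem (h _ _) (h _ _)
  | CH => exact add_mem (h _ _) (h _ _)
  | _ => exact h _ _

namespace ClannishDatum

variable {D : ClannishDatum.{u}}

/-! ### Vertices without a special loop -/

lemma snd_eq_false_of_source {p : D.BasicArrow} (h : D.kind (D.Q.s p.1.1) = .C) : p.1.2 = false :=
  Bool.eq_false_iff.mpr fun h' => (p.2.2 h').2 h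

lemma snd_eq_false_of_target {p : D.BasicArrow} (h : D.kind (D.Q.t p.1.1) = .C) : p.1.2 = false :=
  Bool.eq_false_iff.mpr fun h' => (p.2.2 h').2 ((p.2.2 h').1.trans h)

lemma vfun_C_commute {B : Type*} [Ring B] [Algebra ℝ B] {x : DivKind} (hx : x = .C) (J e s : B)
    (q : x.carrier) : ∃ z w : ℝ, vfun x J e s q = z • e + w • (J * e) := by
  subst hx
  exact ⟨_, _, rfl⟩

lemma ar_mul_im_mem (α : D.Q.E) : D.ar α * D.im ∈ (AddMonoidHom.mulRight (D.ar α)).range := by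
  by_cases h : D.σ α = AlgEquiv.refl
  · exact ⟨D.im, (D.ar_mul_im α h).symm⟩
  · exact ⟨-D.im, (neg_mul _ _).trans (D.ar_mul_im_of_ne α h).symm⟩

lemma im_mul_ar_mem (α : D.Q.E) : D.im * D.ar α ∈ (AddMonoidHom.mulLeft (D.ar α)).range := by
  by_cases h : D.σ α = AlgEquiv.refl
  · exact ⟨D.im, D.ar_mul_im α h⟩
  · refine ⟨-D.im, (mul_neg _ _).trans ?_⟩
    rw [D.ar_mul_im_of_ne α h, neg_neg]

/-- An arrow that starts at a vertex with `ℂ` factors through the arrow of `Q`. -/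
lemma exists_Psi_ofArr_of_source {p : D.BasicArrow} (h : D.kind (D.Q.s p.1.1) = .C)
    (m : (D.bim p.1.1).carrier) : ∃ z, D.Psi (D.basic.ofArr p m) = z * D.ar p.1.1 := by
  suffices D.Psi (D.basic.ofArr p m) ∈ (AddMonoidHom.mulRight (D.ar p.1.1)).range from
    this.imp fun z hz => hz.symm
  rw [Psi_ofArr]
  refine SimpleBimod.arrfun_mem _ _ (fun a b => ?_) m
  obtain ⟨r, r', hr⟩ := vfun_C_commute h D.im (D.ve (D.Q.s p.1.1)) (D.spl (D.Q.s p.1.1)) b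
  have hS : D.flipS p.1.1 = D.ve (D.Q.s p.1.1) := if_neg fun h' => h'.2.2 h
  rw [sand, sandwich, hr, bunt, snd_eq_false_of_source h, if_neg Bool.false_ne_true, unt, hS,
    mul_assoc (D.flipT _), ar_mul_ve]
  obtain ⟨z, hz⟩ := D.ar_mul_im_mem p.1.1
  change z * D.ar p.1.1 = _ at hz
  refine ⟨vfun _ D.im (D.ve (D.Q.t p.1.1)) (D.spl (D.Q.t p.1.1)) a * D.flipT p.1.1 * (r • 1 + r' • z), ?_⟩
  rw [AddMonoidHom.mulRight_apply]
  simp only [mul_add, add_mul, mul_smul_comm, smul_mul_assoc, mul_assoc, ar_mul_ve, one_mul,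
    mul_one, hz]
  rw [← ve_mul_im, ← mul_assoc (D.ar _), ar_mul_ve]

/-- An arrow that ends at a vertex with `ℂ` factors through the arrow of `Q`. -/
lemma exists_Psi_ofArr_of_target {p : D.BasicArrow} (h : D.kind (D.Q.t p.1.1) = .C)
    (m : (D.bim p.1.1).carrier) : ∃ z, D.Psi (D.basic.ofArr p m) = D.ar p.1.1 * z := by
  suffices D.Psi (D.basic.ofArr p m) ∈ (AddMonoidHom.mulLeft (D.ar p.1.1)).range from
    this.imp fun z hz => hz.symm
  rw [Psi_ofArr]
  refine SimpleBimod.arrfun_mem _ _ (fun a b => ?_) m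
  obtain ⟨r, r', hr⟩ := vfun_C_commute h D.im (D.ve (D.Q.t p.1.1)) (D.spl (D.Q.t p.1.1)) a
  have hT : D.flipT p.1.1 = D.ve (D.Q.t p.1.1) := if_neg fun h' => h'.2 h
  rw [sand, sandwich, hr, bunt, snd_eq_false_of_target h, if_neg Bool.false_ne_true, unt, hT,
    ve_mul_ar]
  obtain ⟨z, hz⟩ := D.im_mul_ar_mem p.1.1
  change D.ar p.1.1 * z = _ at hz
  refine ⟨(r • 1 + r' • z) * D.flipS p.1.1 *
    vfun _ D.im (D.ve (D.Q.s p.1.1)) (D.spl (D.Q.s p.1.1)) b, ?_⟩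
  rw [AddMonoidHom.coe_mulLeft]
  simp only [mul_add, add_mul, mul_smul_comm, smul_mul_assoc, ← mul_assoc, ve_mul_ar, one_mul,
    mul_one, hz]
  simp only [mul_assoc]
  rw [← mul_assoc (D.ve _), ve_mul_ar]

/-- An element is in an ideal if all its coordinates are. -/
lemma mem_of_Psi_Theta_mem {I : TwoSidedIdeal D.LoopAlg} {y : D.LoopAlg}
    (h : ∀ p q, D.Psi (D.Theta y p q) ∈ I) : y ∈ I := by
  have : y = ∑ p, ∑ q, D.rvec p * D.Psi (D.Theta y p q) * D.lvec q := by
    calc y = (∑ p, D.rvec p * D.lvec p) * y * (∑ q, D.rvec q * D.lvec q) := by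
          rw [sum_rvec_mul_lvec, one_mul, mul_one]
      _ = _ := by
          rw [Finset.sum_comm]
          simp only [Finset.sum_mul, Finset.mul_sum, Psi_Theta, mul_assoc]
  rw [this]
  exact sum_mem fun p _ => sum_mem fun q _ =>
    I.mul_mem_right _ _ (I.mul_mem_left _ _ (h p q))

lemma Theta_mul_mem_pathSpace {p q : D.BasicArrow} (h : D.kind (D.Q.s p.1.1) = .C)
    (h' : D.Q.s p.1.1 = D.Q.t q.1.1) (i j : Fin 2) :
    D.Theta (D.ar p.1.1 * D.ar q.1.1) i j ∈ D.basic.pathSpace p q := by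
  obtain ⟨m, hm⟩ := D.exists_tharr_eq p.2.1
  obtain ⟨n, hn⟩ := D.exists_tharr_eq q.2.1
  rw [map_mul, Theta_ar, Theta_ar, hm, hn, Matrix.mul_apply]
  refine sum_mem fun r _ => ?_
  have key : ∀ (p : D.BasicArrow) (i : Bool) (m : (D.bim p.1.1).carrier), p.1.2 = false →
      D.kind (D.Q.s p.1.1) = .C ∨ D.kind (D.Q.t p.1.1) = .C →
      ∃ m', D.arc p.1.1 i m = D.basic.ofArr p m' := by
    rintro ⟨⟨α, j⟩, hα⟩ i m hj hC
    change j = false at hj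
    subst hj
    cases i with
    | false => exact ⟨m, D.arc_val ⟨(α, false), hα⟩ m⟩
    | true =>
      refine ⟨0, (D.arc_eq_zero (α := α) (i := true) ?_ m).trans (D.basic.ofArr_zero _).symm⟩
      rintro ⟨-, h2⟩
      obtain ⟨h2, h3⟩ := h2 rfl
      exact hC.elim h3 fun h4 => h3 (h2.trans h4)
  simp only [arm, Matrix.of_apply]
  rw [Finset.sum_mul_sum]
  refine sum_mem fun a _ => sum_mem fun b _ => ?_
  obtain ⟨m', hm'⟩ := key p a _ (snd_eq_false_of_source h) (Or.inl h)
  have h2 : D.kind (D.Q.t q.1.1) = .C := by rw [← h', h]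
  obtain ⟨n', hn'⟩ := key q b _ (snd_eq_false_of_target h2) (Or.inr h2)
  exact Submodule.subset_span ⟨m', n', congrArg₂ (· * ·) hm' hn'⟩

lemma includes_iff (hD : D.IsGentleType) {p q : D.BasicArrow} (h : D.kind (D.Q.s p.1.1) = .C)
    (h' : D.Q.s p.1.1 = D.Q.t q.1.1) :
    D.basic.Includes D.bIdeal (D.basic.pathSpace p q) ↔ [p.1.1, q.1.1] ∈ D.Z := by
  constructor
  · intro hI
    by_contra hZ
    refine ar_mul_ar_notMem hD p.2.1 q.2.1 h' hZ (mem_of_Psi_Theta_mem fun i j => ?_)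
    exact (D.mem_bIdeal _).mp (hI _ (Theta_mul_mem_pathSpace h h' i j))
  · intro hZ x hx
    induction hx using Submodule.span_induction with
    | mem x hx =>
      obtain ⟨m, n, rfl⟩ := hx
      obtain ⟨z, hz⟩ := exists_Psi_ofArr_of_source h m
      obtain ⟨w, hw⟩ := exists_Psi_ofArr_of_target (p := q) (by rw [← h', h]) n
      rw [mem_bIdeal, map_mul]
      refine (congrArg₂ (fun a b => a * b ∈ D.zIdeal) hz hw).mpr ?_
      rw [mul_assoc, ← mul_assoc (D.ar _)]
      refine D.zIdeal.mul_mem_left _ _ (D.zIdeal.mul_mem_right _ _ ?_)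
      rw [zIdeal_eq hD]
      exact TwoSidedIdeal.subset_span ⟨_, _, hZ, rfl⟩
    | zero => exact zero_mem _
    | add x y _ _ hx hy => exact add_mem hx hy
    | smul r x _ hx =>
      rw [← one_mul x, ← smul_mul_assoc]
      exact TwoSidedIdeal.mul_mem_left _ _ _ hx

/-- Where `Z` imposes no relation, the ideal does not meet the space of a path. -/
lemma eq_zero_of_mem_pathSpace (hD : D.IsGentleType) {p q : D.BasicArrow}
    (hZ : [p.1.1, q.1.1] ∉ D.Z) {x : D.basic.T} (hx : x ∈ D.basic.pathSpace p q)
    (hI : x ∈ D.bIdeal) : x = 0 := by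
  have him : ∀ γ, D.ArrowImage (NonUnitalAlgHom.id ℝ D.LoopAlg) γ (D.ar γ) := fun γ =>
    ⟨D.ve_mul_ar γ, D.ar_mul_ve γ, D.ar_mul_im γ, D.ar_mul_im_of_ne γ⟩
  obtain ⟨ρ, hJ, he, hs, ⟨z, hz⟩, ⟨w, hw⟩, hρ⟩ := exists_layers hD _ p.2.1 q.2.1 (him p.1.1)
    (him q.1.1) (fun h => absurd h hZ)
  let δ : D.LoopAlg →ₙₐ[ℝ] Matrix (Fin 3) (Fin 3) D.LoopAlg :=
    ((Matrix.scalarAlgHom (Fin 3) ℝ : D.LoopAlg →ₐ[ℝ] Matrix (Fin 3) (Fin 3) D.LoopAlg) :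
      D.LoopAlg →ₙₐ[ℝ] Matrix (Fin 3) (Fin 3) D.LoopAlg)
  have hδ : ∀ y, δ y = Matrix.diagonal fun _ => y := fun y => rfl
  have hJ' : ρ D.im = δ D.im := hJ
  have he' : ∀ v, ρ (D.ve v) = δ (D.ve v) := he
  have hs' : ∀ v, ρ (D.spl v) = δ (D.spl v) := hs
  have hv : ∀ v a, ρ (vfun (D.kind v) D.im (D.ve v) (D.spl v) a) =
      δ (vfun (D.kind v) D.im (D.ve v) (D.spl v) a) := fun v a => by
    rw [vfun_map, vfun_map, hJ', he', hs']
  have hT : ∀ γ, ρ (D.flipT γ) = δ (D.flipT γ) := fun γ => by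
    unfold flipT; split_ifs
    · exact hs' _
    · exact he' _
  have hS : ∀ γ, ρ (D.flipS γ) = δ (D.flipS γ) := fun γ => by
    unfold flipS; split_ifs
    · exact hs' _
    · exact he' _
  have hform : ∀ (p : D.BasicArrow) (f z g : D.LoopAlg),
      ρ (D.ar p.1.1) = !![0, f, 0; 0, 0, g; 0, 0, 0] → ∀ a b,
      ∃ c d, D.sand p.1.1 (D.bunt p) a b = c * D.ar p.1.1 * d ∧
      ρ (D.sand p.1.1 (D.bunt p) a b) = !![0, c * f * d, 0; 0, 0, c * g * d; 0, 0, 0] := by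
    intro p f z g hp a b
    obtain ⟨j, hj, hj'⟩ : ∃ j, D.bunt p = j * D.unt p.1.1 ∧ ρ (j * D.unt p.1.1) =
        δ j * ρ (D.unt p.1.1) := by
      unfold bunt; split_ifs
      · exact ⟨D.im, rfl, by rw [map_mul, hJ']⟩
      · exact ⟨1, (one_mul _).symm, by
          rw [one_mul, show δ 1 = 1 from map_one (Matrix.scalarAlgHom (Fin 3) ℝ), one_mul]⟩
    refine ⟨vfun _ D.im (D.ve (D.Q.t p.1.1)) (D.spl (D.Q.t p.1.1)) a * j * D.flipT p.1.1,
      D.flipS p.1.1 * vfun _ D.im (D.ve (D.Q.s p.1.1)) (D.spl (D.Q.s p.1.1)) b, ?_, ?_⟩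
    · rw [sand, sandwich, hj, unt]; simp only [mul_assoc]
    · rw [sand, sandwich, map_mul, map_mul, hj, hj', unt, map_mul, map_mul, hv, hv, hT, hS, hp]
      simp only [hδ]
      ext i j
      rw [Matrix.mul_diagonal, Matrix.diagonal_mul, Matrix.diagonal_mul, Matrix.mul_diagonal,
        Matrix.diagonal_mul]
      fin_cases i <;> fin_cases j <;> simp [mul_assoc]
  have hα : ∀ m, ρ (D.Psi (D.basic.ofArr p m)) 0 0 = 0 ∧
      ρ (D.Psi (D.basic.ofArr p m)) 0 1 = D.Psi (D.basic.ofArr p m) ∧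
      ρ (D.Psi (D.basic.ofArr p m)) 0 2 = 0 := by
    intro m
    let S : AddSubgroup D.LoopAlg :=
      { carrier := {y | ρ y 0 0 = 0 ∧ ρ y 0 1 = y ∧ ρ y 0 2 = 0}
        add_mem' := fun {a b} ha hb => by
          simp only [Set.mem_ofPred_eq, map_add, Matrix.add_apply, ha.1, hb.1, ha.2.1, hb.2.1,
            ha.2.2, hb.2.2, add_zero, and_self]
        zero_mem' := by simp
        neg_mem' := fun {a} ha => by
          simp only [Set.mem_ofPred_eq, map_neg, Matrix.neg_apply, ha.1, ha.2.1, ha.2.2, neg_zero,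
            and_self] }
    change D.Psi (D.basic.ofArr p m) ∈ S
    refine (congrArg (· ∈ S) (D.Psi_ofArr p m)).mpr (SimpleBimod.arrfun_mem S _ (fun a b => ?_) m)
    obtain ⟨c, d, h1, h2⟩ := hform p _ 0 _ hz a b
    change _ ∧ _ ∧ _
    rw [h2, h1]
    simp
  have hβ : ∀ m, ρ (D.Psi (D.basic.ofArr q m)) 1 2 = D.Psi (D.basic.ofArr q m) := by
    intro m
    let S : AddSubgroup D.LoopAlg :=
      { carrier := {y | ρ y 1 2 = y}
        add_mem' := fun {a b} ha hb => by
          simp only [Set.mem_ofPred_eq, map_add, Matrix.add_apply] at ha hb ⊢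
          rw [ha, hb]
        zero_mem' := by simp
        neg_mem' := fun {a} ha => by
          simp only [Set.mem_ofPred_eq, map_neg, Matrix.neg_apply] at ha ⊢
          rw [ha] }
    change D.Psi (D.basic.ofArr q m) ∈ S
    refine (congrArg (· ∈ S) (D.Psi_ofArr q m)).mpr (SimpleBimod.arrfun_mem S _ (fun a b => ?_) m)
    obtain ⟨c, d, h1, h2⟩ := hform q _ 0 _ hw a b
    change _ = _
    rw [h2, h1]
    simp
  have key : ρ (D.Psi x) 0 2 = D.Psi x := by
    clear hI
    induction hx using Submodule.span_induction with
    | mem x hx =>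
      obtain ⟨m, n, rfl⟩ := hx
      rw [map_mul, map_mul, Matrix.mul_apply, Fin.sum_univ_three]
      have h1 := hα m
      have h2 := hβ n
      exact (congrArg₂ (· + ·) (congrArg₂ (· + ·) (congrArg (· * _) h1.1)
        (congrArg₂ (· * ·) h1.2.1 h2)) (congrArg (· * _) h1.2.2)).trans (by simp)
    | zero => simp
    | add x y _ _ hx hy => rw [map_add, map_add, Matrix.add_apply, hx, hy]
    | smul r x _ hx => rw [map_smul, map_smul, Matrix.smul_apply, hx]
  refine D.Psi_injective ?_
  rw [map_zero, ← key, hρ _ ((D.mem_bIdeal x).mp hI)]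
  rfl

lemma ordinarilyGentleC (hD : D.IsGentleType) {v : D.Q.V} (hv : D.kind v = .C) :
    D.basic.OrdinarilyGentleC D.bIdeal v := by
  have hinj : ∀ p q : D.BasicArrow, p.1.2 = false → q.1.2 = false → p.1.1 = q.1.1 → p = q :=
    fun p q hp hq h => Subtype.ext (Prod.ext h (hp.trans hq.symm))
  have hs : ∀ p : D.BasicArrow, D.Q.s p.1.1 = v → p.1.2 = false := fun p hp =>
    snd_eq_false_of_source (by rw [hp, hv])
  have ht : ∀ p : D.BasicArrow, D.Q.t p.1.1 = v → p.1.2 = false := fun p hp =>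
    snd_eq_false_of_target (by rw [hp, hv])
  have hinc : ∀ p q : D.BasicArrow, D.Q.s p.1.1 = v → D.Q.t q.1.1 = v →
      (D.basic.Includes D.bIdeal (D.basic.pathSpace p q) ↔ [p.1.1, q.1.1] ∈ D.Z) :=
    fun p q hp hq => includes_iff hD (by rw [hp, hv]) (hp.trans hq.symm)
  have hxor : ∀ a b c d : Prop, (a ↔ c) → (b ↔ d) → ¬ (c ∧ d) → ¬ (¬ c ∧ ¬ d) → Xor a b := by
    intro a b c d h1 h2 h3 h4
    unfold Xor
    tauto
  refine ⟨hv, ⟨?_, ?_⟩, ⟨?_, ?_⟩, ?_⟩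
  · refine le_trans (Set.ncard_le_ncard_of_injOn (fun p : D.BasicArrow => p.1.1)
      (t := D.Q.outArrows v) (fun p hp => hp) (fun p hp q hq h => ?_) (Set.toFinite _)) (hD.1 v).1
    exact hinj p q (hs p hp) (hs q hq) h
  · refine le_trans (Set.ncard_le_ncard_of_injOn (fun p : D.BasicArrow => p.1.1)
      (t := D.Q.inArrows v) (fun p hp => hp) (fun p hp q hq h => ?_) (Set.toFinite _)) (hD.1 v).2
    exact hinj p q (ht p hp) (ht q hq) h
  · intro (α : D.BasicArrow) hα (β : D.BasicArrow) hβ (γ : D.BasicArrow) hγ hne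
    have hpath : D.Q.s α.1.1 = D.Q.t β.1.1 := Eq.trans hα (Eq.symm hβ)
    have hpath' : D.Q.s α.1.1 = D.Q.t γ.1.1 := Eq.trans hα (Eq.symm hγ)
    refine hxor _ _ _ _ (hinc α β hα hβ) (hinc α γ hα hγ) (fun h => hne ?_) (fun h => hne ?_)
    · exact hinj β γ (ht β hβ) (ht γ hγ) ((hD.2.1 _ α.2.1).2.1 ⟨hpath, h.1⟩ ⟨hpath', h.2⟩)
    · exact hinj β γ (ht β hβ) (ht γ hγ) ((hD.2.1 _ α.2.1).1.1 ⟨hpath, h.1⟩ ⟨hpath', h.2⟩)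
  · intro (α : D.BasicArrow) hα (β : D.BasicArrow) hβ (γ : D.BasicArrow) hγ hne
    have hpath : D.Q.s β.1.1 = D.Q.t α.1.1 := Eq.trans hβ (Eq.symm hα)
    have hpath' : D.Q.s γ.1.1 = D.Q.t α.1.1 := Eq.trans hγ (Eq.symm hα)
    refine hxor _ _ _ _ (hinc β α hβ hα) (hinc γ α hγ hα) (fun h => hne ?_) (fun h => hne ?_)
    · exact hinj β γ (hs β hβ) (hs γ hγ) ((hD.2.1 _ α.2.1).2.2 ⟨hpath, h.1⟩ ⟨hpath', h.2⟩)
    · exact hinj β γ (hs β hβ) (hs γ hγ) ((hD.2.1 _ α.2.1).1.2 ⟨hpath, h.1⟩ ⟨hpath', h.2⟩)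
  · intro (α : D.BasicArrow) hα (β : D.BasicArrow) hβ _ _
    by_cases hZ : [α.1.1, β.1.1] ∈ D.Z
    · exact Or.inl ((hinc α β hα hβ).mpr hZ)
    · exact Or.inr fun x hx hI => eq_zero_of_mem_pathSpace hD hZ hx hI

end ClannishDatum

/-! ### The standard relations at a vertex with a special loop -/

section Values

variable {B : Type*} [Ring B] [Algebra ℝ B] (J e s e' s' a : B)

open SimpleBimod (std arrfun elt)
open SimpleBimod.Sym

lemma qfun_one' : qfun J e s one.toQuaternion = e := by
  change (1 : ℝ) • e + (0 : ℝ) • (J * e) + (0 : ℝ) • s + (0 : ℝ) • (J * s) = _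
  simp

lemma qfun_j : qfun J e s j.toQuaternion = J * e := by
  change (0 : ℝ) • e + (1 : ℝ) • (J * e) + (0 : ℝ) • s + (0 : ℝ) • (J * s) = _
  simp

lemma qfun_k' : qfun J e s k.toQuaternion = s := by
  change (0 : ℝ) • e + (0 : ℝ) • (J * e) + (1 : ℝ) • s + (0 : ℝ) • (J * s) = _
  simp

lemma qfun_l : qfun J e s l.toQuaternion = J * s := by
  change (0 : ℝ) • e + (0 : ℝ) • (J * e) + (0 : ℝ) • s + (1 : ℝ) • (J * s) = _
  simp

lemma cfun_one' : cfun J e one.toComplex = e := by simp [cfun, SimpleBimod.Sym.toComplex]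
lemma cfun_i : cfun J e i.toComplex = J * e := by simp [cfun, SimpleBimod.Sym.toComplex]

variable (tw : Bool) (c : SimpleBimod.Sym)

lemma arrfun_std_RR : (std .R .R tw).arrfun (sandwich .R .R J e s e' s' a) ((std .R .R tw).elt one) =
    vfun .R J e s 1 * a * vfun .R J e' s' 1 := rfl

lemma arrfun_std_HH (h : IsVertex .H J e s) :
    (std .H .H tw).arrfun (sandwich .H .H J e s e' s' a) ((std .H .H tw).elt c) =
      qfun J e s c.toQuaternion * (a * e' - s * a * s') := by
  change qfun J e s c.toQuaternion * a * qfun J e' s' 1 -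
    qfun J e s (c.toQuaternion * qk) * a * qfun J e' s' qk = _
  rw [IsVertex.qfun_mul h, qfun_k, qfun_k, qfun_one]
  simp only [mul_sub, mul_assoc]

lemma arrfun_std_RC : (std .R .C tw).arrfun (sandwich .R .C J e s e' s' a) ((std .R .C tw).elt c) =
    vfun .R J e s 1 * a * cfun J e' c.toComplex := rfl

lemma arrfun_std_CR : (std .C .R tw).arrfun (sandwich .C .R J e s e' s' a) ((std .C .R tw).elt c) =
    cfun J e c.toComplex * a * vfun .R J e' s' 1 := rfl

lemma arrfun_std_RH : (std .R .H tw).arrfun (sandwich .R .H J e s e' s' a) ((std .R .H tw).elt c) =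
    vfun .R J e s 1 * a * qfun J e' s' c.toQuaternion := rfl

lemma arrfun_std_HR : (std .H .R tw).arrfun (sandwich .H .R J e s e' s' a) ((std .H .R tw).elt c) =
    qfun J e s c.toQuaternion * a * vfun .R J e' s' 1 := rfl

lemma arrfun_std_HC_one : (std .H .C tw).arrfun (sandwich .H .C J e s e' s' a)
    ((std .H .C tw).elt v₁) = e * a * e' := by
  change qfun J e s 1 * a * cfun J e' 1 - qfun J e s qk * a * cfun J e' 0 = _
  rw [qfun_one, cfun_one, cfun]
  simp

lemma arrfun_std_HC_two : (std .H .C tw).arrfun (sandwich .H .C J e s e' s' a)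
    ((std .H .C tw).elt v₂) = -(s * a * e') := by
  change qfun J e s 1 * a * cfun J e' 0 - qfun J e s qk * a * cfun J e' 1 = _
  rw [qfun_k, cfun_one, cfun]
  simp

lemma arrfun_std_CH : (std .C .H tw).arrfun (sandwich .C .H J e s e' s' a)
    ((std .C .H tw).elt v₁) = e * a * e' := by
  change cfun J e 1 * a * qfun J e' s' 1 + cfun J e 0 * a * qfun J e' s' qk = _
  rw [qfun_one, cfun_one, cfun]
  simp

end Values

/-- Arrows `a` from `v` to `w` and `b` from `u` to `v` that commute with `J`. -/
structure Passage {B : Type*} [Ring B] (w v u : DivKind) (J ew sw ev sv eu su a b : B) : Prop where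
  hw : IsVertex w J ew sw
  hv : IsVertex v J ev sv
  hu : IsVertex u J eu su
  ewa : ew * a = a
  aev : a * ev = a
  evb : ev * b = b
  beu : b * eu = b
  aJ : a * J = J * a
  bJ : b * J = J * b

namespace Passage

variable {B : Type*} [Ring B] {w v u : DivKind} {J ew sw ev sv eu su a b : B}
  (h : Passage w v u J ew sw ev sv eu su a b)
include h

lemma ewa_mul (z : B) : ew * (a * z) = a * z := by rw [← mul_assoc, h.ewa]
lemma aev_mul (z : B) : a * (ev * z) = a * z := by rw [← mul_assoc, h.aev]
lemma evb_mul (z : B) : ev * (b * z) = b * z := by rw [← mul_assoc, h.evb]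
lemma beu_mul (z : B) : b * (eu * z) = b * z := by rw [← mul_assoc, h.beu]
lemma aJ_mul (z : B) : a * (J * z) = J * (a * z) := by rw [← mul_assoc, h.aJ, mul_assoc]
lemma bJ_mul (z : B) : b * (J * z) = J * (b * z) := by rw [← mul_assoc, h.bJ, mul_assoc]

end Passage

section Ideal

variable {B : Type*} [Ring B] [Algebra ℝ B] (I : TwoSidedIdeal B) {x : DivKind} {J e s z : B}

lemma smul_mem_iff' {r : ℝ} (hr : r ≠ 0) (z : B) : r • z ∈ I ↔ z ∈ I := by
  have key : ∀ (r : ℝ) (z : B), z ∈ I → r • z ∈ I := fun r z hz => by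
    rw [← one_mul z, ← smul_mul_assoc]
    exact I.mul_mem_left _ _ hz
  refine ⟨fun hz => ?_, key r z⟩
  have h1 := key r⁻¹ _ hz
  rwa [smul_smul, inv_mul_cancel₀ hr, one_smul] at h1

lemma loop_mul_mem_iff (h : IsVertex x J e s) (hx : x ≠ .C) (hz : e * z = z) :
    s * z ∈ I ↔ z ∈ I := by
  refine ⟨fun h1 => ?_, fun h1 => I.mul_mem_left _ _ h1⟩
  have h2 := I.mul_mem_left s _ h1
  cases x with
  | R => rwa [h.ssR_mul rfl, hz] at h2
  | C => exact absurd rfl hx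
  | H => rw [h.ssH_mul rfl, hz] at h2; simpa using neg_mem h2

lemma mul_loop_mem_iff (h : IsVertex x J e s) (hx : x ≠ .C) (hz : z * e = z) :
    z * s ∈ I ↔ z ∈ I := by
  refine ⟨fun h1 => ?_, fun h1 => I.mul_mem_right _ _ h1⟩
  have h2 := I.mul_mem_right _ s h1
  rw [mul_assoc] at h2
  cases x with
  | R => rwa [h.ssR rfl, hz] at h2
  | C => exact absurd rfl hx
  | H => rw [h.ssH rfl, mul_neg, hz] at h2; simpa using neg_mem h2

lemma half_mul_mem_iff (h : IsVertex x J e s) (hz : e * z = z)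
    (hJ : z * J = J * z ∨ z * J = -(J * z)) : vfun x J e s 1 * z ∈ I ↔ z ∈ I := by
  refine ⟨fun h1 => ?_, fun h1 => I.mul_mem_left _ _ h1⟩
  rw [ClannishDatum.vfun_one] at h1
  split_ifs at h1
  · have h2 := I.mul_mem_right _ J (I.mul_mem_left J _ h1)
    have h3 : z = (2⁻¹ : ℝ) • (e + s) * z - J * ((2⁻¹ : ℝ) • (e + s) * (J * z)) := by
      simp only [smul_mul_assoc, mul_smul_comm, add_mul, mul_add, hz, h.eJ_mul, h.sJ_mul, h.JJ_mul,
        mul_neg]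
      module
    rw [h3]
    refine sub_mem h1 ?_
    rw [mul_assoc, mul_assoc] at h2
    rcases hJ with hJ | hJ
    · rwa [hJ] at h2
    · rw [hJ, mul_neg, mul_neg] at h2; simpa using neg_mem h2
  · rwa [hz] at h1

lemma mul_half_mem_iff (h : IsVertex x J e s) (hz : z * e = z)
    (hJ : z * J = J * z ∨ z * J = -(J * z)) : z * vfun x J e s 1 ∈ I ↔ z ∈ I := by
  refine ⟨fun h1 => ?_, fun h1 => I.mul_mem_right _ _ h1⟩
  rw [ClannishDatum.vfun_one] at h1
  split_ifs at h1
  · have h2 := I.mul_mem_right _ J (I.mul_mem_left J _ h1)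
    have h3 : z = z * ((2⁻¹ : ℝ) • (e + s)) - z * J * ((2⁻¹ : ℝ) • (e + s)) * J := by
      have h4 : z * s = z * e * s := by rw [hz]
      simp only [smul_mul_assoc, mul_smul_comm, add_mul, mul_add, hz, h.eJ, h.sJ, h.JJ, mul_assoc,
        mul_neg, h.JJ_mul, neg_neg, h.eJ_mul, h.sJ_mul]
      module
    rw [h3]
    refine sub_mem h1 ?_
    rw [← mul_assoc] at h2
    rcases hJ with hJ | hJ
    · rwa [hJ]
    · rw [hJ, neg_mul, neg_mul]; exact neg_mem h2
  · rwa [hz] at h1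

end Ideal

section Middle

variable {B : Type*} [Ring B] [Algebra ℝ B]

/-- An element from `u` to `w` that commutes with `J` up to a sign. -/
structure Middle (J ew eu y : B) : Prop where
  left : ew * y = y
  right : y * eu = y
  comm : y * J = J * y ∨ y * J = -(J * y)

variable {w u : DivKind} {J ew sw eu su y : B} (hy : Middle J ew eu y) (hw : IsVertex w J ew sw)
  (hu : IsVertex u J eu su) (I : TwoSidedIdeal B) {r : ℝ} (hr : r ≠ 0)
include hy hw hu hr

lemma Middle.loop_loop (hwC : w ≠ .C) (huC : u ≠ .C) : r • (sw * y * su) ∈ I ↔ y ∈ I := by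
  rw [smul_mem_iff' I hr, mul_loop_mem_iff I hu huC (by rw [mul_assoc, hy.right]),
    loop_mul_mem_iff I hw hwC hy.left]

lemma Middle.half_loop (huC : u ≠ .C) : r • (vfun w J ew sw 1 * y * su) ∈ I ↔ y ∈ I := by
  rw [smul_mem_iff' I hr, mul_loop_mem_iff I hu huC (by rw [mul_assoc, hy.right]),
    half_mul_mem_iff I hw hy.left hy.comm]

lemma Middle.loop_half (hwC : w ≠ .C) : r • (sw * y * vfun u J eu su 1) ∈ I ↔ y ∈ I := by
  rw [smul_mem_iff' I hr, mul_assoc, loop_mul_mem_iff I hw hwC (by rw [← mul_assoc, hy.left]),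
    mul_half_mem_iff I hu hy.right hy.comm]

lemma Middle.half_half (hR : w ≠ .R ∨ u ≠ .R) :
    r • (vfun w J ew sw 1 * y * vfun u J eu su 1) ∈ I ↔ y ∈ I := by
  rw [smul_mem_iff' I hr]
  rcases hR with hR | hR
  · rw [ClannishDatum.vfun_one w, if_neg hR, hy.left, mul_half_mem_iff I hu hy.right hy.comm]
  · rw [ClannishDatum.vfun_one u, if_neg hR, mul_assoc, hy.right,
      half_mul_mem_iff I hw hy.left hy.comm]

lemma Middle.half_half_R (hwR : w = .R) {t : ℝ} (ht : t ≠ 0) :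
    r • (vfun w J ew sw 1 * y * vfun u J eu su 1) ∈ I ∧
      t • (vfun w J ew sw 1 * (J * y) * vfun u J eu su 1) ∈ I ↔ y ∈ I := by
  rw [smul_mem_iff' I hr, smul_mem_iff' I ht]
  refine ⟨fun h => ?_, fun h => ⟨I.mul_mem_right _ _ (I.mul_mem_left _ _ h),
    I.mul_mem_right _ _ (I.mul_mem_left _ _ (I.mul_mem_left _ _ h))⟩⟩
  rw [← mul_half_mem_iff I hu hy.right hy.comm]
  have h2 := sub_mem h.1 (I.mul_mem_left J _ h.2)
  convert h2 using 1
  rw [ClannishDatum.vfun_one w, if_pos hwR]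
  generalize vfun u J eu su 1 = q
  have h4 : ∀ z, ew * (y * z) = y * z := fun z => by rw [← mul_assoc, hy.left]
  simp only [smul_mul_assoc, mul_smul_comm, add_mul, mul_add, mul_assoc, h4, hw.eJ_mul,
    hw.sJ_mul, hw.JJ_mul, mul_neg, neg_mul, neg_neg, smul_neg]
  module

end Middle

/-- The images of the elements `x_α ⊗ y_β` that occur in the standard relations. -/
structure TenValues {B : Type*} [Ring B] [Algebra ℝ B] (M : ModulatedQuiver.{u}) (Ψ : M.T →ₙₐ[ℝ] B)
    (α α' β β' : M.E) (w v u : DivKind) (tw tw' : Bool) (J ew sw ev sv eu su a b : B) : Prop where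
  h00 : ∀ c d, Ψ (M.ten α c β d) =
    (SimpleBimod.std w v tw).arrfun (sandwich w v J ew sw ev sv a)
      ((SimpleBimod.std w v tw).elt c) *
    (SimpleBimod.std v u tw').arrfun (sandwich v u J ev sv eu su b)
      ((SimpleBimod.std v u tw').elt d)
  h10 : DivKind.Doubled w v → ∀ c d, Ψ (M.ten α' c β d) =
    (SimpleBimod.std w v tw).arrfun (sandwich w v J ew sw ev sv (J * a))
      ((SimpleBimod.std w v tw).elt c) *
    (SimpleBimod.std v u tw').arrfun (sandwich v u J ev sv eu su b)
      ((SimpleBimod.std v u tw').elt d)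
  h01 : DivKind.Doubled v u → ∀ c d, Ψ (M.ten α c β' d) =
    (SimpleBimod.std w v tw).arrfun (sandwich w v J ew sw ev sv a)
      ((SimpleBimod.std w v tw).elt c) *
    (SimpleBimod.std v u tw').arrfun (sandwich v u J ev sv eu su (J * b))
      ((SimpleBimod.std v u tw').elt d)
  h11 : DivKind.Doubled w v → DivKind.Doubled v u → ∀ c d, Ψ (M.ten α' c β' d) =
    (SimpleBimod.std w v tw).arrfun (sandwich w v J ew sw ev sv (J * a))
      ((SimpleBimod.std w v tw).elt c) *
    (SimpleBimod.std v u tw').arrfun (sandwich v u J ev sv eu su (J * b))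
      ((SimpleBimod.std v u tw').elt d)

lemma TwoSidedIdeal.mem_congr {B : Type*} [Ring B] {I : TwoSidedIdeal B} {x y : B} (h : x = y) :
    x ∈ I ↔ y ∈ I := by rw [h]

section Table

variable {B : Type*} [Ring B] [Algebra ℝ B] {M : ModulatedQuiver.{u}} {Ψ : M.T →ₙₐ[ℝ] B}
  {α α' β β' : M.E} {tw tw' : Bool} {J ew sw ev sv eu su a b : B}

lemma Passage.middle₀ {w v u : DivKind} (h : Passage w v u J ew sw ev sv eu su a b) :
    Middle J ew eu (a * b) where
  left := h.ewa_mul b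
  right := by rw [mul_assoc, h.beu]
  comm := .inl (by rw [mul_assoc, h.bJ, h.aJ_mul])

lemma Passage.middle₁ {w v u : DivKind} (h : Passage w v u J ew sw ev sv eu su a b) :
    Middle J ew eu (a * sv * b) where
  left := by rw [mul_assoc, h.ewa_mul]
  right := by rw [mul_assoc, h.beu]
  comm := .inr (by rw [mul_assoc, h.bJ, mul_assoc, h.hv.sJ_mul, mul_neg, h.aJ_mul, mul_assoc])

/-- Rewriting rules that bring products into a normal form. -/
lemma Passage.rules {w v u : DivKind} (h : Passage w v u J ew sw ev sv eu su a b) :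
    ((∀ x y z : B, x * (y + z) = x * y + x * z) ∧ (∀ x y z : B, (x + y) * z = x * z + y * z) ∧
      (∀ x y z : B, x * (y - z) = x * y - x * z) ∧ (∀ x y z : B, (x - y) * z = x * z - y * z) ∧
      (∀ x y : B, x * -y = -(x * y)) ∧ (∀ x y : B, -x * y = -(x * y)) ∧ (∀ x : B, - -x = x) ∧
      (∀ x y z : B, x * y * z = x * (y * z)) ∧ (∀ (r : ℝ) (x y : B), r • x * y = r • (x * y)) ∧
      (∀ (r : ℝ) (x y : B), x * r • y = r • (x * y)) ∧
      (∀ (r : ℝ) (x y : B), r • (x + y) = r • x + r • y) ∧ (∀ (r : ℝ) (x : B), r • -x = -(r • x))) ∧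
    (J * J = -1 ∧ ew * ew = ew ∧ ew * J = J * ew ∧ ew * sw = sw ∧ sw * ew = sw ∧
      sw * J = -(J * sw) ∧ (w = .R → sw * sw = ew) ∧ (w = .H → sw * sw = -ew) ∧
      ev * ev = ev ∧ ev * J = J * ev ∧ ev * sv = sv ∧ sv * ev = sv ∧
      sv * J = -(J * sv) ∧ (v = .R → sv * sv = ev) ∧ (v = .H → sv * sv = -ev) ∧
      eu * eu = eu ∧ eu * J = J * eu ∧ eu * su = su ∧ su * eu = su ∧
      su * J = -(J * su) ∧ (u = .R → su * su = eu) ∧ (u = .H → su * su = -eu) ∧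
      ew * a = a ∧ a * ev = a ∧ ev * b = b ∧ b * eu = b ∧ a * J = J * a ∧ b * J = J * b) ∧
    ∀ z : B, J * (J * z) = -z ∧ ew * (ew * z) = ew * z ∧ ew * (J * z) = J * (ew * z) ∧
      ew * (sw * z) = sw * z ∧ sw * (ew * z) = sw * z ∧ sw * (J * z) = -(J * (sw * z)) ∧
      (w = .R → sw * (sw * z) = ew * z) ∧ (w = .H → sw * (sw * z) = -(ew * z)) ∧
      ev * (ev * z) = ev * z ∧ ev * (J * z) = J * (ev * z) ∧
      ev * (sv * z) = sv * z ∧ sv * (ev * z) = sv * z ∧ sv * (J * z) = -(J * (sv * z)) ∧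
      (v = .R → sv * (sv * z) = ev * z) ∧ (v = .H → sv * (sv * z) = -(ev * z)) ∧
      eu * (eu * z) = eu * z ∧ eu * (J * z) = J * (eu * z) ∧
      eu * (su * z) = su * z ∧ su * (eu * z) = su * z ∧ su * (J * z) = -(J * (su * z)) ∧
      (u = .R → su * (su * z) = eu * z) ∧ (u = .H → su * (su * z) = -(eu * z)) ∧
      ew * (a * z) = a * z ∧ a * (ev * z) = a * z ∧ ev * (b * z) = b * z ∧ b * (eu * z) = b * z ∧
      a * (J * z) = J * (a * z) ∧ b * (J * z) = J * (b * z) := by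
  obtain ⟨hw, hv, hu, h1, h2, h3, h4, h5, h6⟩ := id h
  refine ⟨⟨mul_add, add_mul, mul_sub, sub_mul, mul_neg, neg_mul, neg_neg, mul_assoc,
    smul_mul_assoc, fun r x y => mul_smul_comm r x y, smul_add, smul_neg⟩,
    ⟨hw.JJ, hw.ee, hw.eJ, hw.es, hw.se, hw.sJ, hw.ssR, hw.ssH, hv.ee, hv.eJ, hv.es, hv.se, hv.sJ,
      hv.ssR, hv.ssH, hu.ee, hu.eJ, hu.es, hu.se, hu.sJ, hu.ssR, hu.ssH, h1, h2, h3, h4, h5, h6⟩,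
    fun z => ⟨hw.JJ_mul z, hw.ee_mul z, hw.eJ_mul z, hw.es_mul z, hw.se_mul z, hw.sJ_mul z,
      fun e => hw.ssR_mul e z, fun e => hw.ssH_mul e z, hv.ee_mul z, hv.eJ_mul z, hv.es_mul z,
      hv.se_mul z, hv.sJ_mul z, fun e => hv.ssR_mul e z, fun e => hv.ssH_mul e z, hu.ee_mul z,
      hu.eJ_mul z, hu.es_mul z, hu.se_mul z, hu.sJ_mul z, fun e => hu.ssR_mul e z,
      fun e => hu.ssH_mul e z, h.ewa_mul z, h.aev_mul z, h.evb_mul z, h.beu_mul z, h.aJ_mul z,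
      h.bJ_mul z⟩⟩

/-- The elements named by symbols. -/
lemma symbol_values : (∀ J e s : B, qfun J e s SimpleBimod.Sym.one.toQuaternion = e ∧
    qfun J e s SimpleBimod.Sym.j.toQuaternion = J * e ∧
    qfun J e s SimpleBimod.Sym.k.toQuaternion = s ∧
    qfun J e s SimpleBimod.Sym.l.toQuaternion = J * s) ∧
    ∀ J e : B, cfun J e SimpleBimod.Sym.one.toComplex = e ∧
      cfun J e SimpleBimod.Sym.i.toComplex = J * e :=
  ⟨fun J e s => ⟨qfun_one' J e s, qfun_j J e s, qfun_k' J e s, qfun_l J e s⟩,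
    fun J e => ⟨cfun_one' J e, cfun_i J e⟩⟩

variable (I : TwoSidedIdeal B)

lemma relations_RRR (h : Passage .R .R .R J ew sw ev sv eu su a b)
    (ht : TenValues M Ψ α α' β β' .R .R .R tw tw' J ew sw ev sv eu su a b) :
    ((∀ r ∈ (M.relations α α' β β' .R .R .R).1, Ψ r ∈ I) ↔ a * b ∈ I) ∧
      ((∀ r ∈ (M.relations α α' β β' .R .R .R).2, Ψ r ∈ I) ↔ a * sv * b ∈ I) := by
  simp only [ModulatedQuiver.relations, Set.mem_singleton_iff, Set.mem_insert_iff, forall_eq_or_imp,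
    forall_eq, map_add, map_sub, map_neg,
    ht.h00, ht.h10 ⟨rfl, by simp⟩, ht.h01 ⟨rfl, by simp⟩, ht.h11 ⟨rfl, by simp⟩ ⟨rfl, by simp⟩,
    arrfun_std_RR, symbol_values]
  constructor
  · refine ((TwoSidedIdeal.mem_congr
      (y := (1 : ℝ) • (vfun .R J ew sw 1 * (a * b) * vfun .R J eu su 1)) ?_).and
      (TwoSidedIdeal.mem_congr
        (y := (-1 : ℝ) • (vfun .R J ew sw 1 * (J * (a * b)) * vfun .R J eu su 1)) ?_)).trans ?_
    · simp only [ClannishDatum.vfun_one, if_true, if_false, reduceCtorEq, h.rules]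
      module
    · simp only [ClannishDatum.vfun_one, if_true, if_false, reduceCtorEq, h.rules]
      module
    · exact h.middle₀.half_half_R h.hw h.hu I (by norm_num) rfl (by norm_num)
  · refine ((TwoSidedIdeal.mem_congr
      (y := (1 : ℝ) • (vfun .R J ew sw 1 * (a * sv * b) * vfun .R J eu su 1)) ?_).and
      (TwoSidedIdeal.mem_congr
        (y := (-1 : ℝ) • (vfun .R J ew sw 1 * (J * (a * sv * b)) * vfun .R J eu su 1)) ?_)).trans ?_
    · simp only [ClannishDatum.vfun_one, if_true, if_false, reduceCtorEq, h.rules]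
      module
    · simp only [ClannishDatum.vfun_one, if_true, if_false, reduceCtorEq, h.rules]
      module
    · exact h.middle₁.half_half_R h.hw h.hu I (by norm_num) rfl (by norm_num)

lemma relations_RRH (h : Passage .H .R .R J ew sw ev sv eu su a b)
    (ht : TenValues M Ψ α α' β β' .H .R .R tw tw' J ew sw ev sv eu su a b) :
    ((∀ r ∈ (M.relations α α' β β' .R .R .H).1, Ψ r ∈ I) ↔ a * sv * b ∈ I) ∧
      ((∀ r ∈ (M.relations α α' β β' .R .R .H).2, Ψ r ∈ I) ↔ a * b ∈ I) := by
  simp only [ModulatedQuiver.relations, Set.mem_singleton_iff, Set.mem_insert_iff, forall_eq_or_imp,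
    forall_eq, map_add, map_sub, map_neg,
    ht.h00, ht.h01 ⟨rfl, by simp⟩,
    arrfun_std_HR, arrfun_std_RR, symbol_values]
  constructor
  · refine (TwoSidedIdeal.mem_congr
      (y := (1 : ℝ) • (vfun .H J ew sw 1 * (a * sv * b) * vfun .R J eu su 1)) ?_).trans ?_
    · simp only [ClannishDatum.vfun_one, if_true, if_false, reduceCtorEq, h.rules]
      module
    · exact h.middle₁.half_half h.hw h.hu I (by norm_num) (by simp)
  · refine (TwoSidedIdeal.mem_congr
      (y := (1 : ℝ) • (vfun .H J ew sw 1 * (a * b) * vfun .R J eu su 1)) ?_).trans ?_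
    · simp only [ClannishDatum.vfun_one, if_true, if_false, reduceCtorEq, h.rules]
      module
    · exact h.middle₀.half_half h.hw h.hu I (by norm_num) (by simp)

lemma relations_RRC (h : Passage .C .R .R J ew sw ev sv eu su a b)
    (ht : TenValues M Ψ α α' β β' .C .R .R tw tw' J ew sw ev sv eu su a b) :
    ((∀ r ∈ (M.relations α α' β β' .R .R .C).1, Ψ r ∈ I) ↔ a * sv * b ∈ I) ∧
      ((∀ r ∈ (M.relations α α' β β' .R .R .C).2, Ψ r ∈ I) ↔ a * b ∈ I) := by
  simp only [ModulatedQuiver.relations, Set.mem_singleton_iff, Set.mem_insert_iff, forall_eq_or_imp,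
    forall_eq, map_add, map_sub, map_neg,
    ht.h00, ht.h01 ⟨rfl, by simp⟩,
    arrfun_std_CR, arrfun_std_RR, symbol_values]
  constructor
  · refine (TwoSidedIdeal.mem_congr
      (y := (1 : ℝ) • (vfun .C J ew sw 1 * (a * sv * b) * vfun .R J eu su 1)) ?_).trans ?_
    · simp only [ClannishDatum.vfun_one, if_true, if_false, reduceCtorEq, h.rules]
      module
    · exact h.middle₁.half_half h.hw h.hu I (by norm_num) (by simp)
  · refine (TwoSidedIdeal.mem_congr
      (y := (1 : ℝ) • (vfun .C J ew sw 1 * (a * b) * vfun .R J eu su 1)) ?_).trans ?_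
    · simp only [ClannishDatum.vfun_one, if_true, if_false, reduceCtorEq, h.rules]
      module
    · exact h.middle₀.half_half h.hw h.hu I (by norm_num) (by simp)

lemma relations_HHR (h : Passage .R .H .H J ew sw ev sv eu su a b)
    (ht : TenValues M Ψ α α' β β' .R .H .H tw tw' J ew sw ev sv eu su a b) :
    ((∀ r ∈ (M.relations α α' β β' .H .H .R).1, Ψ r ∈ I) ↔ a * sv * b ∈ I) ∧
      ((∀ r ∈ (M.relations α α' β β' .H .H .R).2, Ψ r ∈ I) ↔ a * b ∈ I) := by
  simp only [ModulatedQuiver.relations, Set.mem_singleton_iff, Set.mem_insert_iff, forall_eq_or_imp,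
    forall_eq, map_add, map_sub, map_neg,
    ht.h00, ht.h01 ⟨rfl, by simp⟩,
    arrfun_std_RH, arrfun_std_HH _ _ _ _ _ _ _ _ h.hv, symbol_values]
  constructor
  · refine (TwoSidedIdeal.mem_congr
      (y := (-2 : ℝ) • (vfun .R J ew sw 1 * (a * sv * b) * su)) ?_).trans ?_
    · simp only [ClannishDatum.vfun_one, if_true, if_false, reduceCtorEq, h.rules]
      module
    · exact h.middle₁.half_loop h.hw h.hu I (by norm_num) (by simp)
  · refine (TwoSidedIdeal.mem_congr
      (y := (2 : ℝ) • (vfun .R J ew sw 1 * (a * b) * su)) ?_).trans ?_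
    · simp only [ClannishDatum.vfun_one, if_true, if_false, reduceCtorEq, h.rules]
      module
    · exact h.middle₀.half_loop h.hw h.hu I (by norm_num) (by simp)

lemma relations_HHH (h : Passage .H .H .H J ew sw ev sv eu su a b)
    (ht : TenValues M Ψ α α' β β' .H .H .H tw tw' J ew sw ev sv eu su a b) :
    ((∀ r ∈ (M.relations α α' β β' .H .H .H).1, Ψ r ∈ I) ↔ a * b ∈ I) ∧
      ((∀ r ∈ (M.relations α α' β β' .H .H .H).2, Ψ r ∈ I) ↔ a * sv * b ∈ I) := by
  simp only [ModulatedQuiver.relations, Set.mem_singleton_iff, Set.mem_insert_iff, forall_eq_or_imp,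
    forall_eq, map_add, map_sub, map_neg,
    ht.h00, ht.h10 ⟨rfl, by simp⟩, ht.h01 ⟨rfl, by simp⟩, ht.h11 ⟨rfl, by simp⟩ ⟨rfl, by simp⟩,
    arrfun_std_HH _ _ _ _ _ _ _ _ h.hw, arrfun_std_HH _ _ _ _ _ _ _ _ h.hv, symbol_values]
  constructor
  · refine (TwoSidedIdeal.mem_congr
      (y := (-4 : ℝ) • (sw * (a * b) * su)) ?_).trans ?_
    · simp only [ClannishDatum.vfun_one, if_true, if_false, reduceCtorEq, h.rules]
      module
    · exact h.middle₀.loop_loop h.hw h.hu I (by norm_num) (by simp) (by simp)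
  · refine (TwoSidedIdeal.mem_congr
      (y := (-4 : ℝ) • (sw * (a * sv * b) * su)) ?_).trans ?_
    · simp only [ClannishDatum.vfun_one, if_true, if_false, reduceCtorEq, h.rules]
      module
    · exact h.middle₁.loop_loop h.hw h.hu I (by norm_num) (by simp) (by simp)

lemma relations_HHC (h : Passage .C .H .H J ew sw ev sv eu su a b)
    (ht : TenValues M Ψ α α' β β' .C .H .H tw tw' J ew sw ev sv eu su a b) :
    ((∀ r ∈ (M.relations α α' β β' .H .H .C).1, Ψ r ∈ I) ↔ a * sv * b ∈ I) ∧
      ((∀ r ∈ (M.relations α α' β β' .H .H .C).2, Ψ r ∈ I) ↔ a * b ∈ I) := by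
  simp only [ModulatedQuiver.relations, Set.mem_singleton_iff, Set.mem_insert_iff, forall_eq_or_imp,
    forall_eq, map_add, map_sub, map_neg,
    ht.h00, ht.h01 ⟨rfl, by simp⟩,
    arrfun_std_CH, arrfun_std_HH _ _ _ _ _ _ _ _ h.hv, symbol_values]
  constructor
  · refine (TwoSidedIdeal.mem_congr
      (y := (-2 : ℝ) • (vfun .C J ew sw 1 * (a * sv * b) * su)) ?_).trans ?_
    · simp only [ClannishDatum.vfun_one, if_true, if_false, reduceCtorEq, h.rules]
      module
    · exact h.middle₁.half_loop h.hw h.hu I (by norm_num) (by simp)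
  · refine (TwoSidedIdeal.mem_congr
      (y := (2 : ℝ) • (vfun .C J ew sw 1 * (a * b) * su)) ?_).trans ?_
    · simp only [ClannishDatum.vfun_one, if_true, if_false, reduceCtorEq, h.rules]
      module
    · exact h.middle₀.half_loop h.hw h.hu I (by norm_num) (by simp)

lemma relations_HRR (h : Passage .R .R .H J ew sw ev sv eu su a b)
    (ht : TenValues M Ψ α α' β β' .R .R .H tw tw' J ew sw ev sv eu su a b) :
    ((∀ r ∈ (M.relations α α' β β' .H .R .R).1, Ψ r ∈ I) ↔ a * sv * b ∈ I) ∧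
      ((∀ r ∈ (M.relations α α' β β' .H .R .R).2, Ψ r ∈ I) ↔ a * b ∈ I) := by
  simp only [ModulatedQuiver.relations, Set.mem_singleton_iff, Set.mem_insert_iff, forall_eq_or_imp,
    forall_eq, map_add, map_sub, map_neg,
    ht.h00, ht.h10 ⟨rfl, by simp⟩,
    arrfun_std_RR, arrfun_std_RH, symbol_values]
  constructor
  · refine (TwoSidedIdeal.mem_congr
      (y := (1 : ℝ) • (vfun .R J ew sw 1 * (a * sv * b) * vfun .H J eu su 1)) ?_).trans ?_
    · simp only [ClannishDatum.vfun_one, if_true, if_false, reduceCtorEq, h.rules]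
      module
    · exact h.middle₁.half_half h.hw h.hu I (by norm_num) (by simp)
  · refine (TwoSidedIdeal.mem_congr
      (y := (1 : ℝ) • (vfun .R J ew sw 1 * (a * b) * vfun .H J eu su 1)) ?_).trans ?_
    · simp only [ClannishDatum.vfun_one, if_true, if_false, reduceCtorEq, h.rules]
      module
    · exact h.middle₀.half_half h.hw h.hu I (by norm_num) (by simp)

lemma relations_CRR (h : Passage .R .R .C J ew sw ev sv eu su a b)
    (ht : TenValues M Ψ α α' β β' .R .R .C tw tw' J ew sw ev sv eu su a b) :
    ((∀ r ∈ (M.relations α α' β β' .C .R .R).1, Ψ r ∈ I) ↔ a * sv * b ∈ I) ∧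
      ((∀ r ∈ (M.relations α α' β β' .C .R .R).2, Ψ r ∈ I) ↔ a * b ∈ I) := by
  simp only [ModulatedQuiver.relations, Set.mem_singleton_iff, Set.mem_insert_iff, forall_eq_or_imp,
    forall_eq, map_add, map_sub, map_neg,
    ht.h00, ht.h10 ⟨rfl, by simp⟩,
    arrfun_std_RR, arrfun_std_RC, symbol_values]
  constructor
  · refine (TwoSidedIdeal.mem_congr
      (y := (1 : ℝ) • (vfun .R J ew sw 1 * (a * sv * b) * vfun .C J eu su 1)) ?_).trans ?_
    · simp only [ClannishDatum.vfun_one, if_true, if_false, reduceCtorEq, h.rules]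
      module
    · exact h.middle₁.half_half h.hw h.hu I (by norm_num) (by simp)
  · refine (TwoSidedIdeal.mem_congr
      (y := (1 : ℝ) • (vfun .R J ew sw 1 * (a * b) * vfun .C J eu su 1)) ?_).trans ?_
    · simp only [ClannishDatum.vfun_one, if_true, if_false, reduceCtorEq, h.rules]
      module
    · exact h.middle₀.half_half h.hw h.hu I (by norm_num) (by simp)

lemma relations_RHH (h : Passage .H .H .R J ew sw ev sv eu su a b)
    (ht : TenValues M Ψ α α' β β' .H .H .R tw tw' J ew sw ev sv eu su a b) :
    ((∀ r ∈ (M.relations α α' β β' .R .H .H).1, Ψ r ∈ I) ↔ a * sv * b ∈ I) ∧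
      ((∀ r ∈ (M.relations α α' β β' .R .H .H).2, Ψ r ∈ I) ↔ a * b ∈ I) := by
  simp only [ModulatedQuiver.relations, Set.mem_singleton_iff, Set.mem_insert_iff, forall_eq_or_imp,
    forall_eq, map_add, map_sub, map_neg,
    ht.h00, ht.h10 ⟨rfl, by simp⟩,
    arrfun_std_HH _ _ _ _ _ _ _ _ h.hw, arrfun_std_HR, symbol_values]
  constructor
  · refine (TwoSidedIdeal.mem_congr
      (y := (-2 : ℝ) • (sw * (a * sv * b) * vfun .R J eu su 1)) ?_).trans ?_
    · simp only [ClannishDatum.vfun_one, if_true, if_false, reduceCtorEq, h.rules]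
      module
    · exact h.middle₁.loop_half h.hw h.hu I (by norm_num) (by simp)
  · refine (TwoSidedIdeal.mem_congr
      (y := (2 : ℝ) • (sw * (a * b) * vfun .R J eu su 1)) ?_).trans ?_
    · simp only [ClannishDatum.vfun_one, if_true, if_false, reduceCtorEq, h.rules]
      module
    · exact h.middle₀.loop_half h.hw h.hu I (by norm_num) (by simp)

lemma relations_CHH (h : Passage .H .H .C J ew sw ev sv eu su a b)
    (ht : TenValues M Ψ α α' β β' .H .H .C tw tw' J ew sw ev sv eu su a b) :
    ((∀ r ∈ (M.relations α α' β β' .C .H .H).1, Ψ r ∈ I) ↔ a * sv * b ∈ I) ∧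
      ((∀ r ∈ (M.relations α α' β β' .C .H .H).2, Ψ r ∈ I) ↔ a * b ∈ I) := by
  simp only [ModulatedQuiver.relations, Set.mem_singleton_iff, Set.mem_insert_iff, forall_eq_or_imp,
    forall_eq, map_add, map_sub, map_neg,
    ht.h00, ht.h10 ⟨rfl, by simp⟩,
    arrfun_std_HH _ _ _ _ _ _ _ _ h.hw, arrfun_std_HC_one, arrfun_std_HC_two, symbol_values]
  constructor
  · refine (TwoSidedIdeal.mem_congr
      (y := (-2 : ℝ) • (sw * (a * sv * b) * vfun .C J eu su 1)) ?_).trans ?_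
    · simp only [ClannishDatum.vfun_one, if_true, if_false, reduceCtorEq, h.rules]
      module
    · exact h.middle₁.loop_half h.hw h.hu I (by norm_num) (by simp)
  · refine (TwoSidedIdeal.mem_congr
      (y := (2 : ℝ) • (sw * (a * b) * vfun .C J eu su 1)) ?_).trans ?_
    · simp only [ClannishDatum.vfun_one, if_true, if_false, reduceCtorEq, h.rules]
      module
    · exact h.middle₀.loop_half h.hw h.hu I (by norm_num) (by simp)

lemma relations_HRH (h : Passage .H .R .H J ew sw ev sv eu su a b)
    (ht : TenValues M Ψ α α' β β' .H .R .H tw tw' J ew sw ev sv eu su a b) :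
    ((∀ r ∈ (M.relations α α' β β' .H .R .H).1, Ψ r ∈ I) ↔ a * b ∈ I) ∧
      ((∀ r ∈ (M.relations α α' β β' .H .R .H).2, Ψ r ∈ I) ↔ a * sv * b ∈ I) := by
  simp only [ModulatedQuiver.relations, Set.mem_singleton_iff, Set.mem_insert_iff, forall_eq_or_imp,
    forall_eq, map_add, map_sub, map_neg,
    ht.h00,
    arrfun_std_HR, arrfun_std_RH, symbol_values]
  constructor
  · refine (TwoSidedIdeal.mem_congr
      (y := (1 : ℝ) • (vfun .H J ew sw 1 * (a * b) * vfun .H J eu su 1)) ?_).trans ?_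
    · simp only [ClannishDatum.vfun_one, if_true, if_false, reduceCtorEq, h.rules]
      module
    · exact h.middle₀.half_half h.hw h.hu I (by norm_num) (by simp)
  · refine (TwoSidedIdeal.mem_congr
      (y := (1 : ℝ) • (vfun .H J ew sw 1 * (a * sv * b) * vfun .H J eu su 1)) ?_).trans ?_
    · simp only [ClannishDatum.vfun_one, if_true, if_false, reduceCtorEq, h.rules]
      module
    · exact h.middle₁.half_half h.hw h.hu I (by norm_num) (by simp)

lemma relations_HRC (h : Passage .C .R .H J ew sw ev sv eu su a b)
    (ht : TenValues M Ψ α α' β β' .C .R .H tw tw' J ew sw ev sv eu su a b) :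
    ((∀ r ∈ (M.relations α α' β β' .H .R .C).1, Ψ r ∈ I) ↔ a * b ∈ I) ∧
      ((∀ r ∈ (M.relations α α' β β' .H .R .C).2, Ψ r ∈ I) ↔ a * sv * b ∈ I) := by
  simp only [ModulatedQuiver.relations, Set.mem_singleton_iff, Set.mem_insert_iff, forall_eq_or_imp,
    forall_eq, map_add, map_sub, map_neg,
    ht.h00,
    arrfun_std_CR, arrfun_std_RH, symbol_values]
  constructor
  · refine (TwoSidedIdeal.mem_congr
      (y := (1 : ℝ) • (vfun .C J ew sw 1 * (a * b) * vfun .H J eu su 1)) ?_).trans ?_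
    · simp only [ClannishDatum.vfun_one, if_true, if_false, reduceCtorEq, h.rules]
      module
    · exact h.middle₀.half_half h.hw h.hu I (by norm_num) (by simp)
  · refine (TwoSidedIdeal.mem_congr
      (y := (1 : ℝ) • (vfun .C J ew sw 1 * (a * sv * b) * vfun .H J eu su 1)) ?_).trans ?_
    · simp only [ClannishDatum.vfun_one, if_true, if_false, reduceCtorEq, h.rules]
      module
    · exact h.middle₁.half_half h.hw h.hu I (by norm_num) (by simp)

lemma relations_CRH (h : Passage .H .R .C J ew sw ev sv eu su a b)
    (ht : TenValues M Ψ α α' β β' .H .R .C tw tw' J ew sw ev sv eu su a b) :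
    ((∀ r ∈ (M.relations α α' β β' .C .R .H).1, Ψ r ∈ I) ↔ a * b ∈ I) ∧
      ((∀ r ∈ (M.relations α α' β β' .C .R .H).2, Ψ r ∈ I) ↔ a * sv * b ∈ I) := by
  simp only [ModulatedQuiver.relations, Set.mem_singleton_iff, Set.mem_insert_iff, forall_eq_or_imp,
    forall_eq, map_add, map_sub, map_neg,
    ht.h00,
    arrfun_std_HR, arrfun_std_RC, symbol_values]
  constructor
  · refine (TwoSidedIdeal.mem_congr
      (y := (1 : ℝ) • (vfun .H J ew sw 1 * (a * b) * vfun .C J eu su 1)) ?_).trans ?_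
    · simp only [ClannishDatum.vfun_one, if_true, if_false, reduceCtorEq, h.rules]
      module
    · exact h.middle₀.half_half h.hw h.hu I (by norm_num) (by simp)
  · refine (TwoSidedIdeal.mem_congr
      (y := (1 : ℝ) • (vfun .H J ew sw 1 * (a * sv * b) * vfun .C J eu su 1)) ?_).trans ?_
    · simp only [ClannishDatum.vfun_one, if_true, if_false, reduceCtorEq, h.rules]
      module
    · exact h.middle₁.half_half h.hw h.hu I (by norm_num) (by simp)

lemma relations_CRC (h : Passage .C .R .C J ew sw ev sv eu su a b)
    (ht : TenValues M Ψ α α' β β' .C .R .C tw tw' J ew sw ev sv eu su a b) :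
    ((∀ r ∈ (M.relations α α' β β' .C .R .C).1, Ψ r ∈ I) ↔ a * b ∈ I) ∧
      ((∀ r ∈ (M.relations α α' β β' .C .R .C).2, Ψ r ∈ I) ↔ a * sv * b ∈ I) := by
  simp only [ModulatedQuiver.relations, Set.mem_singleton_iff, Set.mem_insert_iff, forall_eq_or_imp,
    forall_eq, map_add, map_sub, map_neg,
    ht.h00,
    arrfun_std_CR, arrfun_std_RC, symbol_values]
  constructor
  · refine (TwoSidedIdeal.mem_congr
      (y := (1 : ℝ) • (vfun .C J ew sw 1 * (a * b) * vfun .C J eu su 1)) ?_).trans ?_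
    · simp only [ClannishDatum.vfun_one, if_true, if_false, reduceCtorEq, h.rules]
      module
    · exact h.middle₀.half_half h.hw h.hu I (by norm_num) (by simp)
  · refine (TwoSidedIdeal.mem_congr
      (y := (1 : ℝ) • (vfun .C J ew sw 1 * (a * sv * b) * vfun .C J eu su 1)) ?_).trans ?_
    · simp only [ClannishDatum.vfun_one, if_true, if_false, reduceCtorEq, h.rules]
      module
    · exact h.middle₁.half_half h.hw h.hu I (by norm_num) (by simp)

lemma relations_RHC (h : Passage .C .H .R J ew sw ev sv eu su a b)
    (ht : TenValues M Ψ α α' β β' .C .H .R tw tw' J ew sw ev sv eu su a b) :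
    ((∀ r ∈ (M.relations α α' β β' .R .H .C).1, Ψ r ∈ I) ↔ a * b ∈ I) ∧
      ((∀ r ∈ (M.relations α α' β β' .R .H .C).2, Ψ r ∈ I) ↔ a * sv * b ∈ I) := by
  simp only [ModulatedQuiver.relations, Set.mem_singleton_iff, Set.mem_insert_iff, forall_eq_or_imp,
    forall_eq, map_add, map_sub, map_neg,
    ht.h00,
    arrfun_std_CH, arrfun_std_HR, symbol_values]
  constructor
  · refine (TwoSidedIdeal.mem_congr
      (y := (1 : ℝ) • (vfun .C J ew sw 1 * (a * b) * vfun .R J eu su 1)) ?_).trans ?_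
    · simp only [ClannishDatum.vfun_one, if_true, if_false, reduceCtorEq, h.rules]
      module
    · exact h.middle₀.half_half h.hw h.hu I (by norm_num) (by simp)
  · refine (TwoSidedIdeal.mem_congr
      (y := (1 : ℝ) • (vfun .C J ew sw 1 * (a * sv * b) * vfun .R J eu su 1)) ?_).trans ?_
    · simp only [ClannishDatum.vfun_one, if_true, if_false, reduceCtorEq, h.rules]
      module
    · exact h.middle₁.half_half h.hw h.hu I (by norm_num) (by simp)

lemma relations_CHR (h : Passage .R .H .C J ew sw ev sv eu su a b)
    (ht : TenValues M Ψ α α' β β' .R .H .C tw tw' J ew sw ev sv eu su a b) :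
    ((∀ r ∈ (M.relations α α' β β' .C .H .R).1, Ψ r ∈ I) ↔ a * b ∈ I) ∧
      ((∀ r ∈ (M.relations α α' β β' .C .H .R).2, Ψ r ∈ I) ↔ a * sv * b ∈ I) := by
  simp only [ModulatedQuiver.relations, Set.mem_singleton_iff, Set.mem_insert_iff, forall_eq_or_imp,
    forall_eq, map_add, map_sub, map_neg,
    ht.h00,
    arrfun_std_RH, arrfun_std_HC_one, arrfun_std_HC_two, symbol_values]
  constructor
  · refine (TwoSidedIdeal.mem_congr
      (y := (1 : ℝ) • (vfun .R J ew sw 1 * (a * b) * vfun .C J eu su 1)) ?_).trans ?_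
    · simp only [ClannishDatum.vfun_one, if_true, if_false, reduceCtorEq, h.rules]
      module
    · exact h.middle₀.half_half h.hw h.hu I (by norm_num) (by simp)
  · refine (TwoSidedIdeal.mem_congr
      (y := (-1 : ℝ) • (vfun .R J ew sw 1 * (a * sv * b) * vfun .C J eu su 1)) ?_).trans ?_
    · simp only [ClannishDatum.vfun_one, if_true, if_false, reduceCtorEq, h.rules]
      module
    · exact h.middle₁.half_half h.hw h.hu I (by norm_num) (by simp)

lemma relations_CHC (h : Passage .C .H .C J ew sw ev sv eu su a b)
    (ht : TenValues M Ψ α α' β β' .C .H .C tw tw' J ew sw ev sv eu su a b) :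
    ((∀ r ∈ (M.relations α α' β β' .C .H .C).1, Ψ r ∈ I) ↔ a * b ∈ I) ∧
      ((∀ r ∈ (M.relations α α' β β' .C .H .C).2, Ψ r ∈ I) ↔ a * sv * b ∈ I) := by
  simp only [ModulatedQuiver.relations, Set.mem_singleton_iff, Set.mem_insert_iff, forall_eq_or_imp,
    forall_eq, map_add, map_sub, map_neg,
    ht.h00,
    arrfun_std_CH, arrfun_std_HC_one, arrfun_std_HC_two, symbol_values]
  constructor
  · refine (TwoSidedIdeal.mem_congr
      (y := (1 : ℝ) • (vfun .C J ew sw 1 * (a * b) * vfun .C J eu su 1)) ?_).trans ?_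
    · simp only [ClannishDatum.vfun_one, if_true, if_false, reduceCtorEq, h.rules]
      module
    · exact h.middle₀.half_half h.hw h.hu I (by norm_num) (by simp)
  · refine (TwoSidedIdeal.mem_congr
      (y := (-1 : ℝ) • (vfun .C J ew sw 1 * (a * sv * b) * vfun .C J eu su 1)) ?_).trans ?_
    · simp only [ClannishDatum.vfun_one, if_true, if_false, reduceCtorEq, h.rules]
      module
    · exact h.middle₁.half_half h.hw h.hu I (by norm_num) (by simp)

lemma relations_RHR (h : Passage .R .H .R J ew sw ev sv eu su a b)
    (ht : TenValues M Ψ α α' β β' .R .H .R tw tw' J ew sw ev sv eu su a b) :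
    ((∀ r ∈ (M.relations α α' β β' .R .H .R).1, Ψ r ∈ I) ↔ a * b ∈ I) ∧
      ((∀ r ∈ (M.relations α α' β β' .R .H .R).2, Ψ r ∈ I) ↔ a * sv * b ∈ I) := by
  simp only [ModulatedQuiver.relations, Set.mem_singleton_iff, Set.mem_insert_iff, forall_eq_or_imp,
    forall_eq, map_add, map_sub, map_neg,
    ht.h00,
    arrfun_std_RH, arrfun_std_HR, symbol_values]
  constructor
  · refine ((TwoSidedIdeal.mem_congr
      (y := (1 : ℝ) • (vfun .R J ew sw 1 * (a * b) * vfun .R J eu su 1)) ?_).and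
      (TwoSidedIdeal.mem_congr
        (y := (1 : ℝ) • (vfun .R J ew sw 1 * (J * (a * b)) * vfun .R J eu su 1)) ?_)).trans ?_
    · simp only [ClannishDatum.vfun_one, if_true, if_false, reduceCtorEq, h.rules]
      module
    · simp only [ClannishDatum.vfun_one, if_true, if_false, reduceCtorEq, h.rules]
      module
    · exact h.middle₀.half_half_R h.hw h.hu I (by norm_num) rfl (by norm_num)
  · refine ((TwoSidedIdeal.mem_congr
      (y := (1 : ℝ) • (vfun .R J ew sw 1 * (a * sv * b) * vfun .R J eu su 1)) ?_).and
      (TwoSidedIdeal.mem_congr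
        (y := (1 : ℝ) • (vfun .R J ew sw 1 * (J * (a * sv * b)) * vfun .R J eu su 1)) ?_)).trans ?_
    · simp only [ClannishDatum.vfun_one, if_true, if_false, reduceCtorEq, h.rules]
      module
    · simp only [ClannishDatum.vfun_one, if_true, if_false, reduceCtorEq, h.rules]
      module
    · exact h.middle₁.half_half_R h.hw h.hu I (by norm_num) rfl (by norm_num)

end Table

section Table

variable {B : Type*} [Ring B] [Algebra ℝ B] {M : ModulatedQuiver.{u}} {Ψ : M.T →ₙₐ[ℝ] B}
  {α α' β β' : M.E} {tw tw' : Bool} {J ew sw ev sv eu su a b : B}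

/-- One of the two sets of standard relations generates the same ideal as `ab`, the other one the
same ideal as `asb`, where `s` is the special loop in the middle. -/
lemma relations_mem_iff (I : TwoSidedIdeal B) {w v u : DivKind} (hv : v ≠ .C)
    (h : Passage w v u J ew sw ev sv eu su a b)
    (ht : TenValues M Ψ α α' β β' w v u tw tw' J ew sw ev sv eu su a b) :
    (((∀ r ∈ (M.relations α α' β β' u v w).1, Ψ r ∈ I) ↔ a * b ∈ I) ∧
      ((∀ r ∈ (M.relations α α' β β' u v w).2, Ψ r ∈ I) ↔ a * sv * b ∈ I)) ∨
    (((∀ r ∈ (M.relations α α' β β' u v w).1, Ψ r ∈ I) ↔ a * sv * b ∈ I) ∧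
      ((∀ r ∈ (M.relations α α' β β' u v w).2, Ψ r ∈ I) ↔ a * b ∈ I)) := by
  cases v with
  | C => exact absurd rfl hv
  | R =>
    cases u with
    | R =>
      cases w with
      | R => exact .inl (relations_RRR I h ht)
      | C => exact .inr (relations_RRC I h ht)
      | H => exact .inr (relations_RRH I h ht)
    | C =>
      cases w with
      | R => exact .inr (relations_CRR I h ht)
      | C => exact .inl (relations_CRC I h ht)
      | H => exact .inl (relations_CRH I h ht)
    | H =>
      cases w with
      | R => exact .inr (relations_HRR I h ht)
      | C => exact .inl (relations_HRC I h ht)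
      | H => exact .inl (relations_HRH I h ht)
  | H =>
    cases u with
    | R =>
      cases w with
      | R => exact .inl (relations_RHR I h ht)
      | C => exact .inl (relations_RHC I h ht)
      | H => exact .inr (relations_RHH I h ht)
    | C =>
      cases w with
      | R => exact .inl (relations_CHR I h ht)
      | C => exact .inl (relations_CHC I h ht)
      | H => exact .inr (relations_CHH I h ht)
    | H =>
      cases w with
      | R => exact .inr (relations_HHR I h ht)
      | C => exact .inr (relations_HHC I h ht)
      | H => exact .inl (relations_HHH I h ht)

lemma relations_subset (S : AddSubgroup M.T) (h00 : ∀ c d, M.ten α c β d ∈ S)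
    (h10 : ∀ c d, M.ten α' c β d ∈ S) (h01 : ∀ c d, M.ten α c β' d ∈ S)
    (h11 : ∀ c d, M.ten α' c β' d ∈ S) (u v w : DivKind) :
    (∀ r ∈ (M.relations α α' β β' u v w).1, r ∈ S) ∧
      ∀ r ∈ (M.relations α α' β β' u v w).2, r ∈ S := by
  cases u <;> cases v <;> cases w <;>
    simp only [ModulatedQuiver.relations, Set.mem_singleton_iff, Set.mem_insert_iff,
      forall_eq_or_imp, forall_eq, Set.mem_empty_iff_false, false_imp_iff, implies_true,
      and_true, and_self, neg_mem_iff, h00] <;>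
    (try refine ⟨?_, ?_⟩) <;> (try refine ⟨?_, ?_⟩) <;>
    repeat' first
      | apply h00
      | apply h10
      | apply h01
      | apply h11
      | apply sub_mem
      | apply add_mem
      | apply neg_mem

end Table

lemma SimpleBimod.Balanced.comm {B : Type*} [Ring B] {x y : DivKind} {b : SimpleBimod x y} {J a : B}
    (h : b.Balanced J a) (hC : x ≠ .C ∨ y ≠ .C) : a * J = J * a := by
  cases b with
  | CCbar => simp at hC
  | _ => exact h

namespace ModulatedQuiver

variable {M : ModulatedQuiver.{u}}

lemma includes_bimodSpan_iff (I : TwoSidedIdeal M.T) (w u : M.V) {X : Set M.T}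
    (hX : ∀ r ∈ X, M.ofVert w 1 * r * M.ofVert u 1 = r) :
    M.Includes I (M.bimodSpan w u X) ↔ ∀ r ∈ X, r ∈ I := by
  constructor
  · intro h r hr
    exact h r (Submodule.subset_span ⟨1, 1, r, hr, (hX r hr).symm⟩)
  · intro h x hx
    induction hx using Submodule.span_induction with
    | mem x hx =>
      obtain ⟨a, b, r, hr, rfl⟩ := hx
      exact I.mul_mem_right _ _ (I.mul_mem_left _ _ (h r hr))
    | zero => exact zero_mem _
    | add x y _ _ hx hy => exact add_mem hx hy
    | smul r x _ hx =>
      rw [← one_mul x, ← smul_mul_assoc]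
      exact I.mul_mem_left _ _ hx

lemma ofVert_mul_ten_mul_ofVert (α β : M.E) (c d : SimpleBimod.Sym) :
    M.ofVert (M.t α) 1 * M.ten α c β d * M.ofVert (M.s β) 1 = M.ten α c β d := by
  rw [ten, ← mul_assoc, M.ofVert_mul_ofArr, one_smul, mul_assoc, M.ofArr_mul_ofVert,
    MulOpposite.op_one, one_smul]

lemma ofVert_mul_relations_mul_ofVert {α α' β β' : M.E} (hα : M.t α' = M.t α)
    (hβ : M.s β' = M.s β) (u v w : DivKind) :
    (∀ r ∈ (M.relations α α' β β' u v w).1, M.ofVert (M.t α) 1 * r * M.ofVert (M.s β) 1 = r) ∧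
      ∀ r ∈ (M.relations α α' β β' u v w).2, M.ofVert (M.t α) 1 * r * M.ofVert (M.s β) 1 = r := by
  let S : AddSubgroup M.T := ((AddMonoidHom.mulRight (M.ofVert (M.s β) 1)).comp
    (AddMonoidHom.mulLeft (M.ofVert (M.t α) 1))).eqLocus (AddMonoidHom.id M.T)
  have hS : ∀ x, x ∈ S ↔ M.ofVert (M.t α) 1 * x * M.ofVert (M.s β) 1 = x := fun x => Iff.rfl
  refine relations_subset S (fun c d => ?_) (fun c d => ?_) (fun c d => ?_) (fun c d => ?_) u v w
  · exact (hS _).mpr (M.ofVert_mul_ten_mul_ofVert α β c d)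
  · rw [hS, ← hα]; exact M.ofVert_mul_ten_mul_ofVert α' β c d
  · rw [hS, ← hβ]; exact M.ofVert_mul_ten_mul_ofVert α β' c d
  · rw [hS, ← hα, ← hβ]; exact M.ofVert_mul_ten_mul_ofVert α' β' c d

lemma xor_includes_relations {B : Type*} [Ring B] [Algebra ℝ B] {Ψ : M.T →ₙₐ[ℝ] B}
    {α α' β β' : M.E} {tw tw' : Bool} {J ew sw ev sv eu su a b : B} {w v u : DivKind}
    {I : TwoSidedIdeal M.T} {Z : TwoSidedIdeal B} (hI : ∀ x, x ∈ I ↔ Ψ x ∈ Z) (hv : v ≠ .C)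
    (hα : M.t α' = M.t α) (hβ : M.s β' = M.s β)
    (h : Passage w v u J ew sw ev sv eu su a b)
    (ht : TenValues M Ψ α α' β β' w v u tw tw' J ew sw ev sv eu su a b)
    (hx : Xor (a * b ∈ Z) (a * sv * b ∈ Z)) :
    Xor (M.Includes I (M.bimodSpan (M.t α) (M.s β) (M.relations α α' β β' u v w).1))
      (M.Includes I (M.bimodSpan (M.t α) (M.s β) (M.relations α α' β β' u v w).2)) := by
  have hr := ofVert_mul_relations_mul_ofVert hα hβ u v w
  have h1 := (includes_bimodSpan_iff I _ _ hr.1).trans (forall₂_congr fun r _ => hI r)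
  have h2 := (includes_bimodSpan_iff I _ _ hr.2).trans (forall₂_congr fun r _ => hI r)
  have h3 := relations_mem_iff Z hv h ht
  unfold Xor at *
  tauto

end ModulatedQuiver

namespace ClannishDatum

variable {D : ClannishDatum.{u}}

/-! ### Vertices with a special loop -/

lemma mem_Z_of_kind_ne_C (hD : D.IsGentleType) {α β : D.Q.E} (hα : α ∉ D.special)
    (hβ : β ∉ D.special) (h : D.Q.s α = D.Q.t β) (hv : D.kind (D.Q.s α) ≠ .C) : [α, β] ∈ D.Z := by
  obtain ⟨l, hl, hlv⟩ := (D.kind_ne_C_iff _).mp hv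
  by_contra hZ
  have h1 := (hD.2.1 α hα).1.1 ⟨h, hZ⟩
    ⟨hlv.symm.trans (D.isLoop l hl), fun h' => D.right_ordinary h' hl⟩
  exact hβ (h1 ▸ hl)

lemma eq_of_source (hD : D.IsGentleType) {α γ : D.Q.E} (hα : α ∉ D.special) (hγ : γ ∉ D.special)
    (h : D.Q.s γ = D.Q.s α) (hv : D.kind (D.Q.s α) ≠ .C) : γ = α := by
  obtain ⟨l, hl, hlv⟩ := (D.kind_ne_C_iff _).mp hv
  by_contra hne
  refine absurd (hD.1 (D.Q.s α)).1 (not_le.mpr ((Set.two_lt_ncard_iff (Set.toFinite _)).mpr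
    ⟨l, α, γ, hlv, rfl, h, ?_, ?_, ?_⟩))
  · exact fun h => hα (h ▸ hl)
  · exact fun h => hγ (h ▸ hl)
  · exact fun h => hne h.symm

lemma eq_of_target (hD : D.IsGentleType) {α γ : D.Q.E} (hα : α ∉ D.special) (hγ : γ ∉ D.special)
    (h : D.Q.t γ = D.Q.t α) (hv : D.kind (D.Q.t α) ≠ .C) : γ = α := by
  obtain ⟨l, hl, hlv⟩ := (D.kind_ne_C_iff _).mp hv
  by_contra hne
  refine absurd (hD.1 (D.Q.t α)).2 (not_le.mpr ((Set.two_lt_ncard_iff (Set.toFinite _)).mpr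
    ⟨l, α, γ, (D.isLoop l hl).symm.trans hlv, rfl, h, ?_, ?_, ?_⟩))
  · exact fun h => hα (h ▸ hl)
  · exact fun h => hγ (h ▸ hl)
  · exact fun h => hne h.symm

/-- The arrow `α` of `Q^b`. -/
def first (α : D.Q.E) (h : α ∉ D.special) : D.BasicArrow := ⟨(α, false), h, fun h => by simp at h⟩

open Classical in
/-- The arrow `α^𝐢` of `Q^b`, if there is one, and `α` otherwise. -/
noncomputable def twin (α : D.Q.E) (h : α ∉ D.special) : D.BasicArrow :=
  if h' : D.kind (D.Q.s α) = D.kind (D.Q.t α) ∧ D.kind (D.Q.s α) ≠ .C then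
    ⟨(α, true), h, fun _ => h'⟩
  else first α h

lemma twin_of_doubled {α : D.Q.E} (h : α ∉ D.special)
    (h' : D.kind (D.Q.s α) = D.kind (D.Q.t α) ∧ D.kind (D.Q.s α) ≠ .C) :
    twin α h = ⟨(α, true), h, fun _ => h'⟩ := dif_pos h'

lemma twin_of_not_doubled {α : D.Q.E} (h : α ∉ D.special)
    (h' : ¬ (D.kind (D.Q.s α) = D.kind (D.Q.t α) ∧ D.kind (D.Q.s α) ≠ .C)) :
    twin α h = first α h := dif_neg h'

lemma fst_twin (α : D.Q.E) (h : α ∉ D.special) : (twin α h).1.1 = α := by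
  by_cases h' : D.kind (D.Q.s α) = D.kind (D.Q.t α) ∧ D.kind (D.Q.s α) ≠ .C
  · rw [twin_of_doubled h h']
  · rw [twin_of_not_doubled h h']; rfl

lemma eq_first_or_eq_twin {α : D.Q.E} (h : α ∉ D.special) {p : D.BasicArrow} (hp : p.1.1 = α) :
    p = first α h ∨ p = twin α h := by
  obtain ⟨⟨γ, i⟩, hγ⟩ := p
  obtain rfl : γ = α := hp
  cases i with
  | false => exact .inl rfl
  | true => exact .inr (twin_of_doubled h (hγ.2 rfl)).symm

lemma first_ne_twin_iff {α : D.Q.E} (h : α ∉ D.special) :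
    first α h ≠ twin α h ↔ D.kind (D.Q.s α) = D.kind (D.Q.t α) ∧ D.kind (D.Q.s α) ≠ .C := by
  by_cases h' : D.kind (D.Q.s α) = D.kind (D.Q.t α) ∧ D.kind (D.Q.s α) ≠ .C
  · refine ⟨fun _ => h', fun _ h1 => Bool.false_ne_true ?_⟩
    exact congrArg (fun p : D.BasicArrow => p.1.2) (h1.trans (twin_of_doubled h h'))
  · exact ⟨fun h1 => absurd (twin_of_not_doubled h h').symm h1, fun h1 => absurd h1 h'⟩

lemma outPair (hD : D.IsGentleType) {α : D.Q.E} (hα : α ∉ D.special)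
    (hv : D.kind (D.Q.s α) ≠ .C) : D.basic.OutPair (D.Q.s α) (first α hα) (twin α hα) := by
  refine ⟨?_, congrArg D.Q.t (fst_twin α hα), (first_ne_twin_iff hα).trans
    ⟨fun h => h.1.symm, fun h => ⟨h.symm, hv⟩⟩⟩
  ext (p : D.BasicArrow)
  constructor
  · intro hp
    exact eq_first_or_eq_twin hα (eq_of_source hD hα p.2.1 hp hv)
  · rintro (rfl | rfl)
    · rfl
    · exact congrArg D.Q.s (fst_twin α hα)

lemma inPair (hD : D.IsGentleType) {β : D.Q.E} (hβ : β ∉ D.special)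
    (hv : D.kind (D.Q.t β) ≠ .C) : D.basic.InPair (D.Q.t β) (first β hβ) (twin β hβ) := by
  refine ⟨?_, congrArg D.Q.s (fst_twin β hβ), (first_ne_twin_iff hβ).trans
    ⟨fun h => h.1, fun (h : D.kind (D.Q.s β) = D.kind (D.Q.t β)) => ⟨h, h ▸ hv⟩⟩⟩
  ext (p : D.BasicArrow)
  constructor
  · intro hp
    exact eq_first_or_eq_twin hβ (eq_of_target hD hβ p.2.1 hp hv)
  · rintro (rfl | rfl)
    · rfl
    · exact congrArg D.Q.t (fst_twin β hβ)

lemma Psi_elt_source {α : D.Q.E} {v : D.Q.V} (hv : D.Q.s α = v) :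
    ∃ tw, ∀ i h c y, D.bunt ⟨(α, i), h⟩ = y →
      D.Psi (D.basic.ofArr ⟨(α, i), h⟩ ((D.basic.arr ⟨(α, i), h⟩).elt c)) =
      (SimpleBimod.std (D.kind (D.Q.t α)) (D.kind v) tw).arrfun
        (sandwich _ _ D.im (D.ve (D.Q.t α)) (D.spl (D.Q.t α)) (D.ve v) (D.spl v)
          y) ((SimpleBimod.std (D.kind (D.Q.t α)) (D.kind v) tw).elt c) := by
  subst hv
  classical
  refine ⟨decide (D.σ α ≠ AlgEquiv.refl), ?_⟩
  rintro i h c _ rfl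
  exact D.Psi_ofArr ⟨(α, i), h⟩ ((D.bim α).elt c)

lemma Psi_elt_target {β : D.Q.E} {v : D.Q.V} (hv : D.Q.t β = v) :
    ∃ tw, ∀ i h c y, D.bunt ⟨(β, i), h⟩ = y →
      D.Psi (D.basic.ofArr ⟨(β, i), h⟩ ((D.basic.arr ⟨(β, i), h⟩).elt c)) =
      (SimpleBimod.std (D.kind v) (D.kind (D.Q.s β)) tw).arrfun
        (sandwich _ _ D.im (D.ve v) (D.spl v) (D.ve (D.Q.s β)) (D.spl (D.Q.s β))
          y) ((SimpleBimod.std (D.kind v) (D.kind (D.Q.s β)) tw).elt c) := by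
  subst hv
  classical
  refine ⟨decide (D.σ β ≠ AlgEquiv.refl), ?_⟩
  rintro i h c _ rfl
  exact D.Psi_ofArr ⟨(β, i), h⟩ ((D.bim β).elt c)

lemma passage {α β : D.Q.E} {v : D.Q.V} (hα : D.Q.s α = v) (hβ : D.Q.t β = v)
    (hv : D.kind v ≠ .C) :
    Passage (D.kind (D.Q.t α)) (D.kind v) (D.kind (D.Q.s β)) D.im (D.ve (D.Q.t α))
      (D.spl (D.Q.t α)) (D.ve v) (D.spl v) (D.ve (D.Q.s β)) (D.spl (D.Q.s β)) (D.unt α)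
      (D.unt β) where
  hw := D.isVertex _
  hv := D.isVertex _
  hu := D.isVertex _
  ewa := D.ve_mul_unt α
  aev := hα ▸ D.unt_mul_ve α
  evb := hβ ▸ D.ve_mul_unt β
  beu := D.unt_mul_ve β
  aJ := (D.balanced_unt α).comm (.inr (hα ▸ hv))
  bJ := (D.balanced_unt β).comm (.inl (hβ ▸ hv))

lemma exists_tenValues {α β : D.Q.E} (hαs : α ∉ D.special) (hβs : β ∉ D.special) {v : D.Q.V}
    (hα : D.Q.s α = v) (hβ : D.Q.t β = v) : ∃ tw tw',
    TenValues D.basic D.Psi (first α hαs) (twin α hαs) (first β hβs) (twin β hβs)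
      (D.kind (D.Q.t α)) (D.kind v) (D.kind (D.Q.s β)) tw tw' D.im (D.ve (D.Q.t α))
      (D.spl (D.Q.t α)) (D.ve v) (D.spl v) (D.ve (D.Q.s β)) (D.spl (D.Q.s β)) (D.unt α)
      (D.unt β) := by
  obtain ⟨tw, h1⟩ := Psi_elt_source hα
  obtain ⟨tw', h2⟩ := Psi_elt_target hβ
  have a0 := fun c => h1 false (first α hαs).2 c _ (D.bunt_false α _)
  have b0 := fun c => h2 false (first β hβs).2 c _ (D.bunt_false β _)
  have a1 : DivKind.Doubled (D.kind (D.Q.t α)) (D.kind v) → ∀ c,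
      D.Psi (D.basic.ofArr (twin α hαs) ((D.basic.arr (twin α hαs)).elt c)) =
      (SimpleBimod.std (D.kind (D.Q.t α)) (D.kind v) tw).arrfun
        (sandwich _ _ D.im (D.ve (D.Q.t α)) (D.spl (D.Q.t α)) (D.ve v) (D.spl v)
          (D.im * D.unt α)) ((SimpleBimod.std (D.kind (D.Q.t α)) (D.kind v) tw).elt c) := by
    intro h c
    have h' : D.kind (D.Q.s α) = D.kind (D.Q.t α) ∧ D.kind (D.Q.s α) ≠ .C := by rw [hα]; exact h
    rw [twin_of_doubled hαs h']
    exact h1 true _ c _ (D.bunt_true α _)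
  have b1 : DivKind.Doubled (D.kind v) (D.kind (D.Q.s β)) → ∀ c,
      D.Psi (D.basic.ofArr (twin β hβs) ((D.basic.arr (twin β hβs)).elt c)) =
      (SimpleBimod.std (D.kind v) (D.kind (D.Q.s β)) tw').arrfun
        (sandwich _ _ D.im (D.ve v) (D.spl v) (D.ve (D.Q.s β)) (D.spl (D.Q.s β))
          (D.im * D.unt β)) ((SimpleBimod.std (D.kind v) (D.kind (D.Q.s β)) tw').elt c) := by
    intro h c
    have h' : D.kind (D.Q.s β) = D.kind (D.Q.t β) ∧ D.kind (D.Q.s β) ≠ .C := by rw [hβ]; exact h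
    rw [twin_of_doubled hβs h']
    exact h2 true _ c _ (D.bunt_true β _)
  exact ⟨tw, tw', fun c d => (map_mul D.Psi _ _).trans (congrArg₂ (· * ·) (a0 c) (b0 d)),
    fun h c d => (map_mul D.Psi _ _).trans (congrArg₂ (· * ·) (a1 h c) (b0 d)),
    fun h c d => (map_mul D.Psi _ _).trans (congrArg₂ (· * ·) (a0 c) (b1 h d)),
    fun h h' c d => (map_mul D.Psi _ _).trans (congrArg₂ (· * ·) (a1 h c) (b1 h' d))⟩

/-- Untwisting does not change the membership in an ideal. -/
lemma flip_mul_flip_mem_iff (I : TwoSidedIdeal D.LoopAlg) (α β : D.Q.E) (z : D.LoopAlg) :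
    D.flipT α * (D.ar α * z * D.ar β) * D.flipS β ∈ I ↔ D.ar α * z * D.ar β ∈ I := by
  refine ⟨fun h => ?_, fun h => I.mul_mem_right _ _ (I.mul_mem_left _ _ h)⟩
  obtain ⟨p, hp, -⟩ := D.exists_unflipT α
  obtain ⟨q, hq, -⟩ := D.exists_unflipS β
  have h1 := I.mul_mem_right _ q (I.mul_mem_left p _ h)
  convert h1 using 1
  simp only [mul_assoc]
  rw [hq, ar_mul_ve, ← mul_assoc p, hp, ← mul_assoc (D.ve _), ve_mul_ar]

/-- At a special loop, exactly one of the two passages vanishes. -/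
lemma xor_mem (hD : D.IsGentleType) {α β : D.Q.E} (hα : α ∉ D.special) (hβ : β ∉ D.special)
    (h : D.Q.s α = D.Q.t β) (hv : D.kind (D.Q.s α) ≠ .C) :
    Xor (D.unt α * D.unt β ∈ D.zIdeal) (D.unt α * D.spl (D.Q.s α) * D.unt β ∈ D.zIdeal) := by
  have hZ := mem_Z_of_kind_ne_C hD hα hβ h hv
  have hV := D.isVertex (D.Q.s α)
  have h0 : D.ar α * D.ve (D.Q.s α) * D.ar β ∈ D.zIdeal := by
    rw [ar_mul_ve, zIdeal_eq hD]
    exact TwoSidedIdeal.subset_span ⟨α, β, hZ, rfl⟩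
  have h1 := ar_mul_spl_mul_ar_notMem hD hα hβ h hv
  have e0 : D.unt α * D.unt β =
      D.flipT α * (D.ar α * (D.flipS α * D.flipT β) * D.ar β) * D.flipS β := by
    simp only [unt, mul_assoc]
  have e1 : D.unt α * D.spl (D.Q.s α) * D.unt β =
      D.flipT α * (D.ar α * (D.flipS α * D.spl (D.Q.s α) * D.flipT β) * D.ar β) * D.flipS β := by
    simp only [unt, mul_assoc]
  rw [e0, e1, flip_mul_flip_mem_iff, flip_mul_flip_mem_iff]
  have hss : D.spl (D.Q.s α) * D.spl (D.Q.s α) = D.ve (D.Q.s α) ∨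
      D.spl (D.Q.s α) * D.spl (D.Q.s α) = -D.ve (D.Q.s α) := by
    cases hk : D.kind (D.Q.s α) with
    | R => exact .inl (hV.ssR hk)
    | C => exact absurd hk hv
    | H => exact .inr (hV.ssH hk)
  have hS : D.flipS α = D.ve (D.Q.s α) ∨ D.flipS α = D.spl (D.Q.s α) := by
    unfold flipS; split_ifs <;> simp
  have hT : D.flipT β = D.ve (D.Q.s α) ∨ D.flipT β = D.spl (D.Q.s α) := by
    unfold flipT; split_ifs <;> simp [h]
  have hneg : ∀ z, D.ar α * -z * D.ar β ∈ D.zIdeal ↔ D.ar α * z * D.ar β ∈ D.zIdeal := fun z => by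
    rw [mul_neg, neg_mul]; exact neg_mem_iff
  rcases hS with hS | hS <;> rcases hT with hT | hT <;> rcases hss with hss | hss <;>
    simp only [hS, hT, hss, hV.ee, hV.es, hV.se, neg_mul, hneg, h0, h1,
      not_true_eq_false, not_false_eq_true, Xor, and_true, and_false, or_true,
      or_false, and_self]

lemma speciallyGentle (hD : D.IsGentleType) {v : D.Q.V} (hv : D.kind v ≠ .C) :
    D.basic.SpeciallyGentle D.bIdeal v := by
  refine ⟨hv, ?_⟩
  by_cases ho : ∃ α ∉ D.special, D.Q.s α = v
  · obtain ⟨α, hα, rfl⟩ := ho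
    by_cases hi : ∃ β ∉ D.special, D.Q.t β = D.Q.s α
    · obtain ⟨β, hβ, h⟩ := hi
      refine .inl ⟨first α hα, twin α hα, first β hβ, twin β hβ, outPair hD hα hv, ?_, ?_, ?_⟩
      · have := inPair hD hβ (h ▸ hv)
        rwa [h] at this
      · intro h'
        obtain rfl : β = α := eq_of_target hD hα hβ (h.trans (Eq.symm h'))
          (Eq.mpr (congrArg (fun x => D.kind x ≠ .C) h') hv)
        exact ⟨rfl, rfl⟩
      · obtain ⟨tw, tw', ht⟩ := exists_tenValues hα hβ rfl h
        exact D.basic.xor_includes_relations D.mem_bIdeal hv (congrArg D.Q.t (fst_twin α hα))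
          (congrArg D.Q.s (fst_twin β hβ)) (passage rfl h hv) ht (xor_mem hD hα hβ h.symm hv)
    · refine .inr (.inr (.inl ⟨?_, _, _, outPair hD hα hv⟩))
      exact Set.eq_empty_of_forall_notMem fun (p : D.BasicArrow) hp => hi ⟨p.1.1, p.2.1, hp⟩
  · have hoe : D.basic.outArrows v = ∅ :=
      Set.eq_empty_of_forall_notMem fun (p : D.BasicArrow) hp => ho ⟨p.1.1, p.2.1, hp⟩
    by_cases hi : ∃ β ∉ D.special, D.Q.t β = v
    · obtain ⟨β, hβ, rfl⟩ := hi
      exact .inr (.inr (.inr ⟨hoe, _, _, inPair hD hβ hv⟩))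
    · exact .inr (.inl ⟨hoe, Set.eq_empty_of_forall_notMem
        fun (p : D.BasicArrow) hp => hi ⟨p.1.1, p.2.1, hp⟩⟩)

end ClannishDatum

end CGentle

theorem mainTheorem5 (D : CGentle.ClannishDatum) (hD : D.IsGentleType) :
    CGentle.IsLocallyComplexifiedGentleOfSpecialType D.Alg ∧
    ∃ (Ψ : D.basic.T →ₙₐ[ℝ] D.LoopAlg) (I : TwoSidedIdeal D.basic.T),
      (Function.Injective Ψ ∧ Set.range Ψ = {x | ∃ y, x = D.eps * y * D.eps} ∧
        ∀ i : D.Q.V, Ψ (D.basic.ofVert i 1) = D.epsV i) ∧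
      (∀ x, x ∈ I ↔ Ψ x ∈ D.zIdeal) ∧
      IsMoritaEquivalent ℝ D.Alg (D.basic.Quot I) ∧
      (∀ v : D.Q.V, D.basic.OrdinarilyGentleC I v ∨ D.basic.SpeciallyGentle I v) ∧
      I = TwoSidedIdeal.span (⋃ v : D.Q.V, D.basic.localIdeal I v) := by
  have hv : ∀ v : D.Q.V, D.basic.OrdinarilyGentleC D.bIdeal v ∨
      D.basic.SpeciallyGentle D.bIdeal v := fun v => by
    by_cases h : D.kind v = .C
    · exact .inl (CGentle.ClannishDatum.ordinarilyGentleC hD h)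
    · exact .inr (CGentle.ClannishDatum.speciallyGentle hD h)
  have hI := CGentle.ClannishDatum.bIdeal_eq_span hD
  exact ⟨⟨D.basic, D.bIdeal, ⟨hv, hI⟩, D.isMoritaEquivalent⟩, D.Psi, D.bIdeal,
    ⟨D.Psi_injective, D.range_Psi, fun i => (D.Psi_ofVert i 1).trans (D.vmap_one i)⟩,
    D.mem_bIdeal, D.isMoritaEquivalent, hv, hI⟩
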